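/- **Setting.** For $p\in\mathbb N$ let $y^{(p)},\lambda^{(p)}\in\mathbb R^p$ with $0\le\lambda^{(p)}_1\le\dots\le\lambda^{(p)}_p$, and let $$\mathrm{Prox}_{\lambda}(y)=\arg\min_{x\in\mathbb R^p}\ \tfrac12\|y-x\|^2+\sum_{i=1}^p\lambda_i|x|_{(i)},$$ where $|x|_{(1)}\le\dots\le|x|_{(p)}$ are the ordered absolute values of the coordinates. A sequence $x^{(p)}\in\mathbb R^p$ is called converging with limiting law $\mu$ if $\frac1p\sum_i\delta_{x_i^{(p)}}\to\mu$ weakly, $\int t^2\,d\mu<\infty$ and $\frac1p\|x^{(p)}\|^2\to\int t^2\,d\mu(t)$. Let $Y\sim F_y$ and $\lambda\sim F_\lambda$ be real random variables with finite second moments and $\lambda\ge0$ almost surely. Let $F_{|y|}$ be the distribution function of $|Y|$, and $F_\lambda^{-1}(u)=\inf\{x:F_\lambda(x)\ge u\}$ for $0<u\le 1$, $F_\lambda^{-1}(0)=\inf\{x:F_\lambda(x)>0\}$. Let $S=\{y\ge0:\mathbb P(|Y|\ge y)>0\}$. **Construction (continuum pool-adjacent-violators).** Put $G_0(y)=y-\lambda(y)$,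 where $\lambda(y)=F_\lambda^{-1}(F_{|y|}(y))$ if $\mathbb P(|Y|=y)=0$, and $\lambda(y)=\frac{1}{F_{|y|}(y)-F_{|y|}(y^-)}\int_{F_{|y|}(y^-)}^{F_{|y|}(y)}F_\lambda^{-1}(u)\,du$ otherwise. For $t=0,1,\dots$, as long as $G_t$ is not non-decreasing on $S$: * Let $I_2=[b_1,b_2]$ be the first maximal decreasing interval of $G_t$ in $S$: $G_t$ is non-decreasing on $I_1=[0,b_1)$ but on no neighbourhood of $b_1$ in $S$, is strictly decreasing on $I_2$ (which may be one point, where $G_t$ jumps down), and either is non-decreasing on a right neighbourhood $(b_2,b_2+\varepsilon)\cap S$ with $\mathbb P(|Y|>b_2)>0$, or $I_2=S\cap[b_1,\infty)$. For $v\le w\le\infty$ let $\mathcal T(v,w)=\mathbb E\big[G_t(|Y|)\,\big|\,v\le|Y|\le w\big]$. * If $I_2=S\cap[b_1,\infty)$, let $T=\sup_{0\le v\le b_1}\mathcal T(v,\infty)$ and $I_3=\emptyset$. Otherwise let $I_3$ be the maximal relatively open interval of $S$ with left end $b_2$ (excluded) on which $G_t$ is non-decreasing, and let $T=\inf_{w\in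 I_3}\sup_{0\le v\le b_1}\mathcal T(v,w)$. * $G_{t+1}$ equals $T$ on $\{v\in I_1:G_t(v)>T\}\cup I_2\cup\{w\in I_3:G_t(w)<T\}$, and equals $G_t$ elsewhere. If for some $t$ the function $G_t$ is non-decreasing on $S$, the procedure stops with $G=G_t$ on $S$ and $G(y)=y-\sup_{z\in S}(z-G_t(z))$ for $y\ge 0$, $y\notin S$, and its output is the function $y\mapsto\mathrm{sign}(y)\max\{0,G(|y|)\}$. **Proposition 1.** For all $F_y,F_\lambda$ as above there is a function $\eta=\eta(\cdot\,;F_y,F_\lambda):\mathbb R\to\mathbb R$ such that 1. $\eta$ is odd, non-decreasing and $1$-Lipschitz; 2. whenever the procedure stops, its output is $\eta$; and it does stop if $S$ is, up to finitely many points, a finite union of intervals on each of which $G_0$ is non-decreasing or strictly decreasing; 3. for all converging sequences $y^{(p)}$ and $\lambda^{(p)}$ (with $0\le\lambda_1^{(p)}\le\dots\le\lambda_p^{(p)}$) whose limiting laws have distribution functions $F_y$ and $F_\lambda$, $$\lim_{p\to\infty}\frac1p\,\big\|\mathrm{Prox}_{\lambda^{(p)}}(y^{(p)})-\eta(y^{(p)};F_y,F_\lambda)\big\|^2=0,$$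 with $\eta$ applied coordinate-wise. -/

import Mathlib

open MeasureTheory Set Filter Topology ProbabilityTheory

/-! ### Converging sequences and the proximal operator -/

/-- A converging sequence of vectors `x p ∈ ℝᵖ` with limiting measure `μ`: the empirical measures
`(1/p) ∑ i, δ_{x p i}` converge weakly to `μ` (tested against bounded continuous functions), and
their second moments converge to the finite second moment of `μ`. -/
structure IsConvergingSequence (x : (p : ℕ) → Fin p → ℝ) (μ : Measure ℝ) : Prop where
  weak : ∀ f : BoundedContinuousFunction ℝ ℝ,
    Tendsto (fun p : ℕ => (∑ i, f (x p i)) / (p : ℝ)) atTop (𝓝 (∫ t, f t ∂μ))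
  integrable_sq : Integrable (fun t : ℝ => t ^ 2) μ
  secondMoment :
    Tendsto (fun p : ℕ => (∑ i, (x p i) ^ 2) / (p : ℝ)) atTop (𝓝 (∫ t, t ^ 2 ∂μ))

/-- `orderStat a` is the non-decreasing rearrangement `a_(1) ≤ ⋯ ≤ a_(p)` of `a`. -/
noncomputable def orderStat {p : ℕ} (a : Fin p → ℝ) (i : Fin p) : ℝ :=
  a (Tuple.sort a i)

/-- The objective `½‖y - x‖² + ∑ i, lam i * |x|_(i)`. -/
noncomputable def slopeObjective {p : ℕ} (lam y x : Fin p → ℝ) : ℝ :=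
  (1 / 2) * ∑ i, (y i - x i) ^ 2 + ∑ i, lam i * orderStat (fun j => |x j|) i

/-- `Prox_lam(y)`: the minimizer of the objective, which exists and is unique when
`0 ≤ lam 1 ≤ ⋯ ≤ lam p`. -/
noncomputable def slopeProx {p : ℕ} (lam y : Fin p → ℝ) : Fin p → ℝ :=
  Classical.epsilon fun x => ∀ z, slopeObjective lam y x ≤ slopeObjective lam y z

/-! ### The initial function `G₀(y) = y - λ(y)` -/

/-- The law of `|Y|` when `Y` has law `μ`. -/
noncomputable def absLaw (μ : Measure ℝ) : Measure ℝ := μ.map fun y => |y|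

/-- The quantile function `F⁻¹(u) = inf {x | u ≤ F x}` of `μ` for `0 < u`.  At `u = 0`, where this
infimum is `-∞`, it is continued by its right limit `inf {x | 0 < F x}`, the left end of the
support. -/
noncomputable def quantile (μ : Measure ℝ) (u : ℝ) : ℝ :=
  if 0 < u then sInf {x | u ≤ cdf μ x} else sInf {x | 0 < cdf μ x}

open Classical in
/-- The function `λ(y)`; `ν` is the law of `|Y|` and `μl` the limiting law of the
regularization sequence. -/
noncomputable def lamFun (ν μl : Measure ℝ) (y : ℝ) : ℝ :=
  if ν {y} = 0 then quantile μl (cdf ν y)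
  else (∫ u in (Function.leftLim (cdf ν) y)..(cdf ν y), quantile μl u) /
    (cdf ν y - Function.leftLim (cdf ν) y)

/-- `G₀(y) = y - λ(y)`. -/
noncomputable def initialG (ν μl : Measure ℝ) (y : ℝ) : ℝ := y - lamFun ν μl y

/-! ### Pooling

All functions `G` are looked at on the interval `massRange ν` of those `y ≥ 0` for which `|Y|` still has
mass in `[y, ∞)`: it is `[0, ∞)` if `|Y|` is unbounded, and otherwise it ends at `ess sup |Y|`
(included if and only if it is an atom). -/

/-- The interval `{y ≥ 0 | ℙ(|Y| ≥ y) > 0}`. -/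
def massRange (ν : Measure ℝ) : Set ℝ := {y | 0 ≤ y ∧ 0 < ν (Ici y)}

/-- `b₁` is the left end point of the first place where `G` decreases: `G` is non-decreasing on
`[0, b₁)`, but on no neighbourhood of `b₁`. -/
structure StartsFirstDescent (ν : Measure ℝ) (G : ℝ → ℝ) (b₁ : ℝ) : Prop where
  mem : b₁ ∈ massRange ν
  mono_left : MonotoneOn G (Ico 0 b₁)
  descent : ∀ ε > 0, ¬ MonotoneOn G (massRange ν ∩ Ioo (b₁ - ε) (b₁ + ε))

/-- `[b₁, b₂]` is the first maximal decreasing interval (MDI) of `G` and `ℙ(|Y| > b₂) > 0`.  The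
interval may consist of one point, at which `G` then jumps down. -/
structure IsFirstMDI (ν : Measure ℝ) (G : ℝ → ℝ) (b₁ b₂ : ℝ) : Prop
    extends StartsFirstDescent ν G b₁ where
  le : b₁ ≤ b₂
  mass_right : 0 < ν (Ioi b₂)
  anti : StrictAntiOn G (Icc b₁ b₂)
  mono_right : ∃ ε > 0, MonotoneOn G (massRange ν ∩ Ioo b₂ (b₂ + ε))

/-- The first maximal decreasing interval of `G` starts at `b₁` and has no mass of `|Y|` to its
right: it is all of the mass range from `b₁` on (its right end may be infinite). -/
structure IsFirstMDIToEnd (ν : Measure ℝ) (G : ℝ → ℝ) (b₁ : ℝ) : Prop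
    extends StartsFirstDescent ν G b₁ where
  anti : StrictAntiOn G (massRange ν ∩ Ici b₁)

/-- The right neighbouring maximal non-decreasing interval `I₃ = (b₂, b₃)` of an MDI ending at
`b₂`. -/
def rightMNDI (ν : Measure ℝ) (G : ℝ → ℝ) (b₂ : ℝ) : Set ℝ :=
  {w ∈ massRange ν | b₂ < w ∧ ∃ ε > 0, MonotoneOn G (massRange ν ∩ Ioo b₂ (w + ε))}

/-- `𝒯(v, w; G) = 𝔼[G(|Y|) | |Y| ∈ [v, w]]`. -/
noncomputable def condMean (ν : Measure ℝ) (G : ℝ → ℝ) (v w : ℝ) : ℝ :=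
  ⨍ y in Icc v w, G y ∂ν

/-- `𝒯(v, ∞; G) = 𝔼[G(|Y|) | |Y| ≥ v]`. -/
noncomputable def condMeanToEnd (ν : Measure ℝ) (G : ℝ → ℝ) (v : ℝ) : ℝ :=
  ⨍ y in Ici v, G y ∂ν

/-- The optimal value `min_{w ∈ I₃} max_{v ≤ b₁} 𝒯(v, w; G)`. -/
noncomputable def minMaxValue (ν : Measure ℝ) (G : ℝ → ℝ) (b₁ b₂ : ℝ) : ℝ :=
  ⨅ w : rightMNDI ν G b₂, ⨆ v : Icc (0 : ℝ) b₁, condMean ν G v w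

/-- The optimal value `max_{v ≤ b₁} 𝒯(v, ∞; G)`. -/
noncomputable def maxValueToEnd (ν : Measure ℝ) (G : ℝ → ℝ) (b₁ : ℝ) : ℝ :=
  ⨆ v : Icc (0 : ℝ) b₁, condMeanToEnd ν G v

/-- The pooled interval `[b_L, b_R]` for an MDI `[b₁, b₂]` and the optimal value `t`: the points of
the left neighbouring MNDI with `t < G`, the MDI itself, and the points of the right neighbouring
MNDI with `G < t`.  Its infimum is the left balance point `b_L = v*` and its supremum (possibly `∞`)
the right balance point `b_R = w*`.  End points of `[b_L, b_R]` in the two neighbouring intervals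
that are left out here satisfy `G = t` already, by continuity of `G` there. -/
def pooledInterval (ν : Measure ℝ) (G : ℝ → ℝ) (b₁ b₂ t : ℝ) : Set ℝ :=
  {v ∈ Ico 0 b₁ | t < G v} ∪ Icc b₁ b₂ ∪ {w ∈ rightMNDI ν G b₂ | G w < t}

/-- The pooled interval for an MDI that extends from `b₁` to the end of the mass range. -/
def pooledIntervalToEnd (ν : Measure ℝ) (G : ℝ → ℝ) (b₁ t : ℝ) : Set ℝ :=
  {v ∈ Ico 0 b₁ | t < G v} ∪ (massRange ν ∩ Ici b₁)

open Classical in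
/-- One pass through the loop: on the pooled interval of the first MDI, `G` is replaced by the
optimal value. -/
inductive PoolStep (ν : Measure ℝ) (G : ℝ → ℝ) : (ℝ → ℝ) → Prop
  | inner (b₁ b₂ : ℝ) (h : IsFirstMDI ν G b₁ b₂) :
      PoolStep ν G fun y =>
        if y ∈ pooledInterval ν G b₁ b₂ (minMaxValue ν G b₁ b₂)
        then minMaxValue ν G b₁ b₂ else G y
  | toEnd (b₁ : ℝ) (h : IsFirstMDIToEnd ν G b₁) :
      PoolStep ν G fun y =>
        if y ∈ pooledIntervalToEnd ν G b₁ (maxValueToEnd ν G b₁)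
        then maxValueToEnd ν G b₁ else G y

open Classical in
/-- The scalar function `y ↦ sign(y) max{0, G(|y|)}`.  Beyond the mass range, `G` is continued with
slope one. -/
noncomputable def scalarOfG (ν : Measure ℝ) (G : ℝ → ℝ) (y : ℝ) : ℝ :=
  Real.sign y * max 0
    (if |y| ∈ massRange ν then G |y| else |y| - ⨆ z : massRange ν, ((z : ℝ) - G z))

/-- `η` is the output of the procedure on the limiting laws `μy`, `μl`: finitely many passes through
the loop lead from `G₀` to a `G` without decreasing parts, and `η` is its scalar function. -/
def IsPoolOutput (μy μl : Measure ℝ) (η : ℝ → ℝ) : Prop :=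
  ∃ G : ℝ → ℝ,
    Relation.ReflTransGen (PoolStep (absLaw μy)) (initialG (absLaw μy) μl) G ∧
    MonotoneOn G (massRange (absLaw μy)) ∧
    η = scalarOfG (absLaw μy) G

/-- `G` has finitely many monotonicity intervals (hence finitely many MDIs) on the mass range:
after removal of finitely many points it is, on each remaining interval, either non-decreasing or
strictly decreasing. -/
def HasFinitelyManyMDIs (ν : Measure ℝ) (G : ℝ → ℝ) : Prop :=
  ∃ A : Finset ℝ, ∀ C : Set ℝ, C ⊆ massRange ν → C.OrdConnected → Disjoint C (A : Set ℝ) →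
    MonotoneOn G C ∨ StrictAntiOn G C

/-! Everything is transported to the unit interval. Let `q` and `ℓ` be the quantile functions of
`|Y|` and `λ`. The right `η` makes `η ∘ q` the projection of `q - ℓ` in `L²(0,1)` onto the cone of
nonnegative non-decreasing functions. `IsOptimalShrinkage` records this by its dual description: the
residual `q - η ∘ q - ℓ` has nonpositive integrals over all `(a, 1)`, and it is orthogonal to `η ∘
q`.

These two facts already imply the limit statement. Inserting `z = η(y)` into the minimality of the
proximal point `x` bounds `½‖x - z‖²` by `J(z) - ⟨y - z, z⟩` plus `⟨y - z, x⟩ - J(x)`, where `J` is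
the sorted `ℓ₁` norm. Since `η` and `t ↦ t - η t` are monotone, sorting and the rearrangement
inequality turn both terms, divided by `p`, into integrals of step functions on the unit interval.
The first tends to the orthogonality relation. The second is at most a tail term of the right sign
plus a Cauchy-Schwarz error (`IsOptimalShrinkage.sum_sq_sub_le`). Sorted converging sequences
converge in `L²` to quantile functions (`tendsto_integral_sq_sub_quantile`), so everything vanishes
in the limit.

Pooling produces such an `η`. Each step replaces `G` by its mean on a set where `G - T` passes from
positive to negative, and hence keeps the slope bound, the tail inequalities and the orthogonality
(`PoolInvariant.pool`). The function `λ(y)` is the conditional expectation of `ℓ` given `q = y`,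
which carries these properties from the law of `|Y|` to the unit interval. Steps are deterministic,
so there is at most one output. A frontier, always `0` or a break point of `G₀`, moves strictly to
the right, so finitely many monotonicity intervals force termination (`exists_poolOutput`).

If the procedure does not stop, `|Y|` is rounded to finite grids. For these laws it stops, and a
subsequence of the resulting odd, monotone, `1`-Lipschitz functions converges pointwise to an
optimal one (`exists_isOptimalShrinkage`). Uniqueness of optimal functions is never needed: `η` is
the output when there is one, and any optimal function otherwise. -/

set_option linter.unusedSectionVars false

/-! ### The mass range -/

section MassRange

variable {ν : Measure ℝ}

theorem massRange_of_le {x y : ℝ} (hy : y ∈ massRange ν) (hx : 0 ≤ x) (hxy : x ≤ y) :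
    x ∈ massRange ν :=
  ⟨hx, hy.2.trans_le (measure_mono (Ici_subset_Ici.2 hxy))⟩

theorem ordConnected_massRange : (massRange ν).OrdConnected :=
  ⟨fun _ hx _ hy _ hz => massRange_of_le hy (hx.1.trans hz.1) hz.2⟩

theorem measurableSet_massRange : MeasurableSet (massRange ν) :=
  ordConnected_massRange.measurableSet

theorem measure_Ici_of_nonpos [IsProbabilityMeasure ν] (hν : ν (Iio 0) = 0) {x : ℝ} (hx : x ≤ 0) :
    ν (Ici x) = 1 := by
  have h : ν (Iio x) = 0 := measure_mono_null (Iio_subset_Iio hx) hν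
  rw [← compl_Iio, prob_compl_eq_one_iff measurableSet_Iio]
  exact h

theorem zero_mem_massRange [IsProbabilityMeasure ν] (hν : ν (Iio 0) = 0) : 0 ∈ massRange ν :=
  ⟨le_rfl, by rw [measure_Ici_of_nonpos hν le_rfl]; exact one_pos⟩

/-- The points `y` with no mass in `[y, ∞)` form a ray. If it contains its left end point it lies in
a null closed ray; otherwise it is covered by countably many null closed rays. -/
theorem measure_compl_massRange [IsProbabilityMeasure ν] (hν : ν (Iio 0) = 0) :
    ν (massRange ν)ᶜ = 0 := by
  set N : Set ℝ := {y | ν (Ici y) = 0} with hN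
  have hsub : (massRange ν)ᶜ ⊆ Iio 0 ∪ N := by
    intro y hy
    rcases lt_or_ge y 0 with h | h
    · exact Or.inl h
    · refine Or.inr ?_
      by_contra hne
      exact hy ⟨h, pos_iff_ne_zero.2 hne⟩
  refine measure_mono_null hsub (measure_union_null hν ?_)
  rcases N.eq_empty_or_nonempty with h | hne
  · rw [h]; exact measure_empty
  have hbdd : BddBelow N := by
    refine ⟨0, fun y hy => ?_⟩
    by_contra hlt
    have := measure_Ici_of_nonpos hν (not_le.1 hlt).le
    rw [show ν (Ici y) = 0 from hy] at this
    exact zero_ne_one this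
  have hup : ∀ x, sInf N < x → ν (Ici x) = 0 := by
    intro x hx
    obtain ⟨y, hy, hyx⟩ := exists_lt_of_csInf_lt hne hx
    exact measure_mono_null (Ici_subset_Ici.2 hyx.le) hy
  by_cases hm : sInf N ∈ N
  · exact measure_mono_null (fun y hy => csInf_le hbdd hy) hm
  · have : N ⊆ ⋃ n : ℕ, Ici (sInf N + 1 / ((n : ℝ) + 1)) := by
      intro y hy
      have hlt : sInf N < y :=
        lt_of_le_of_ne (csInf_le hbdd hy) (fun h => hm (h ▸ hy))
      obtain ⟨n, hn⟩ := exists_nat_one_div_lt (sub_pos.2 hlt)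
      exact mem_iUnion.2 ⟨n, by simp only [mem_Ici]; linarith⟩
    refine measure_mono_null this (measure_iUnion_null fun n => hup _ ?_)
    have : (0 : ℝ) < 1 / ((n : ℝ) + 1) := by positivity
    linarith

theorem ae_mem_massRange [IsProbabilityMeasure ν] (hν : ν (Iio 0) = 0) :
    ∀ᵐ y ∂ν, y ∈ massRange ν := by
  rw [ae_iff]
  exact measure_compl_massRange hν

end MassRange

/-! ### Averages and monotone limits of set integrals -/

/-- Comparing a conditional mean with `t` thus becomes the sign of the integral of `G - t`, which is
additive in the set. -/
theorem setAverage_sub_mul {ν : Measure ℝ} [IsFiniteMeasure ν] {G : ℝ → ℝ} (hG : Integrable G ν)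
    {s : Set ℝ} (hs : 0 < ν s) (t : ℝ) :
    ((⨍ y in s, G y ∂ν) - t) * ν.real s = ∫ y in s, (G y - t) ∂ν := by
  have h0 : ν.real s ≠ 0 := (ENNReal.toReal_pos hs.ne' (measure_ne_top _ _)).ne'
  rw [integral_sub hG.integrableOn (integrable_const _), setIntegral_const, setAverage_eq, smul_eq_mul,
    smul_eq_mul]
  field_simp

theorem setAverage_le {ν : Measure ℝ} [IsFiniteMeasure ν] {G : ℝ → ℝ} (hG : Integrable G ν)
    {s : Set ℝ} (hs : 0 < ν s) {t : ℝ} (h : ∫ y in s, (G y - t) ∂ν ≤ 0) :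
    ⨍ y in s, G y ∂ν ≤ t := by
  have h0 : 0 < ν.real s := ENNReal.toReal_pos hs.ne' (measure_ne_top _ _)
  have := setAverage_sub_mul hG hs t
  by_contra hlt
  have := mul_pos (sub_pos.2 (not_le.1 hlt)) h0
  linarith

theorem le_setAverage {ν : Measure ℝ} [IsFiniteMeasure ν] {G : ℝ → ℝ} (hG : Integrable G ν)
    {s : Set ℝ} (hs : 0 < ν s) {t : ℝ} (h : 0 ≤ ∫ y in s, (G y - t) ∂ν) :
    t ≤ ⨍ y in s, G y ∂ν := by
  have h0 : 0 < ν.real s := ENNReal.toReal_pos hs.ne' (measure_ne_top _ _)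
  have := setAverage_sub_mul hG hs t
  by_contra hlt
  have := mul_neg_of_neg_of_pos (sub_neg.2 (not_le.1 hlt)) h0
  linarith

/-- On an upper part `s` of `[0, b)`, integrals over `[v, b)` approximate the integral over `s`. -/
theorem exists_setIntegral_Ico_near {ν : Measure ℝ} {f : ℝ → ℝ} (hf : Integrable f ν) {b : ℝ}
    (hb : 0 ≤ b) {s : Set ℝ} (hs : s ⊆ Ico 0 b) (hup : ∀ x ∈ s, ∀ y, x ≤ y → y < b → y ∈ s)
    {ε : ℝ} (hε : 0 < ε) :
    ∃ v ∈ Icc 0 b, |(∫ x in Ico v b, f x ∂ν) - ∫ x in s, f x ∂ν| < ε := by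
  rcases s.eq_empty_or_nonempty with rfl | hne
  · exact ⟨b, ⟨hb, le_rfl⟩, by simpa using hε⟩
  have : s.OrdConnected := ⟨fun x hx y hy z hz => hup x hx z hz.1 (hz.2.trans_lt (hs hy).2)⟩
  have : Nonempty s := hne.to_subtype
  -- The index `v` runs through `s` in reversed order, so that the intervals `[v, b)` increase to
  -- `s`.
  have hU : (⋃ v : (s : Type)ᵒᵈ, Ico ((OrderDual.ofDual v : s) : ℝ) b) = s := by
    ext x
    simp only [mem_iUnion, mem_Ico]
    constructor
    · rintro ⟨v, h1, h2⟩
      exact hup _ (OrderDual.ofDual v : s).2 x h1 h2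
    · intro hx
      exact ⟨OrderDual.toDual ⟨x, hx⟩, le_rfl, (hs hx).2⟩
  have hlim := tendsto_setIntegral_of_monotone (μ := ν) (f := f)
    (s := fun v : (s : Type)ᵒᵈ => Ico ((OrderDual.ofDual v : s) : ℝ) b)
    (fun _ => measurableSet_Ico)
    (fun v w hvw => Ico_subset_Ico_left (show ((OrderDual.ofDual w : s) : ℝ) ≤ (OrderDual.ofDual v : s) from hvw))
    hf.integrableOn
  rw [hU] at hlim
  obtain ⟨v, hv⟩ := ((Metric.tendsto_nhds.1 hlim) ε hε).exists
  exact ⟨_, ⟨(hs (OrderDual.ofDual v : s).2).1, (hs (OrderDual.ofDual v : s).2).2.le⟩, hv⟩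

/-- On a lower part `s` of an interval `I` starting (excluded) at `b`, integrals over `(b, w]`
approximate the integral over `s`. -/
theorem exists_setIntegral_Ioc_near {ν : Measure ℝ} {f : ℝ → ℝ} (hf : Integrable f ν) {b : ℝ}
    {I s : Set ℝ} (hI : I ⊆ Ioi b) (hIlow : ∀ x ∈ I, ∀ y, b < y → y ≤ x → y ∈ I)
    (hne : I.Nonempty) (hs : s ⊆ I) (hlow : ∀ x ∈ s, ∀ y, b < y → y ≤ x → y ∈ s)
    {ε : ℝ} (hε : 0 < ε) :
    ∃ w ∈ I, |(∫ x in Ioc b w, f x ∂ν) - ∫ x in s, f x ∂ν| < ε := by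
  -- When `s` is empty there is no `w` in `s` to increase along; instead `w` decreases to `b` inside
  -- `I` and the intervals `(b, w]` shrink to the empty set.
  rcases s.eq_empty_or_nonempty with rfl | hsne
  · have : I.OrdConnected :=
      ⟨fun x hx y hy z hz => hIlow y hy z ((hI hx : b < x).trans_le hz.1) hz.2⟩
    have : Nonempty I := hne.to_subtype
    have hU : (⋂ w : (I : Type)ᵒᵈ, Ioc b ((OrderDual.ofDual w : I) : ℝ)) = ∅ := by
      rw [eq_empty_iff_forall_notMem]
      intro x hx
      simp only [mem_iInter, mem_Ioc] at hx
      obtain ⟨w, hw⟩ := hne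
      have h1 := hx (OrderDual.toDual ⟨w, hw⟩)
      have hbx : b < x := h1.1
      have hm : (b + x) / 2 ∈ I := hIlow w hw _ (by linarith) (by
        have : x ≤ w := h1.2
        linarith)
      have h2 : x ≤ (b + x) / 2 := (hx (OrderDual.toDual ⟨_, hm⟩)).2
      linarith
    have hlim := tendsto_setIntegral_of_antitone (μ := ν) (f := f)
      (s := fun w : (I : Type)ᵒᵈ => Ioc b ((OrderDual.ofDual w : I) : ℝ))
      (fun _ => measurableSet_Ioc)
      (fun v w hvw => Ioc_subset_Ioc_right
        (show ((OrderDual.ofDual w : I) : ℝ) ≤ (OrderDual.ofDual v : I) from hvw))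
      ⟨OrderDual.toDual ⟨_, hne.some_mem⟩, hf.integrableOn⟩
    rw [hU] at hlim
    obtain ⟨w, hw⟩ := ((Metric.tendsto_nhds.1 hlim) ε hε).exists
    exact ⟨_, (OrderDual.ofDual w : I).2, hw⟩
  · have : s.OrdConnected :=
      ⟨fun x hx y hy z hz => hlow y hy z ((hI (hs hx) : b < x).trans_le hz.1) hz.2⟩
    have : Nonempty s := hsne.to_subtype
    have hU : (⋃ w : s, Ioc b (w : ℝ)) = s := by
      ext x
      simp only [mem_iUnion, mem_Ioc]
      constructor
      · rintro ⟨w, h1, h2⟩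
        exact hlow _ w.2 x h1 h2
      · intro hx
        exact ⟨⟨x, hx⟩, hI (hs hx), le_rfl⟩
    have hlim := tendsto_setIntegral_of_monotone (μ := ν) (f := f)
      (s := fun w : s => Ioc b (w : ℝ)) (fun _ => measurableSet_Ioc)
      (fun v w hvw => Ioc_subset_Ioc_right hvw) hf.integrableOn
    rw [hU] at hlim
    obtain ⟨w, hw⟩ := ((Metric.tendsto_nhds.1 hlim) ε hε).exists
    exact ⟨_, hs w.2, hw⟩

/-! ### Invariants of the pooling procedure -/

/-- The properties of the function from which pooling starts. -/
structure IsPoolStart (ν : Measure ℝ) (G₀ : ℝ → ℝ) : Prop where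
  sub : MonotoneOn (fun y => y - G₀ y) (massRange ν)
  zero : G₀ 0 ≤ 0
  memLp : MemLp G₀ 2 ν
  gap : ∀ a b w, 0 ≤ a → a < b → b < w → b ∈ massRange ν → ν (Icc b w) = 0 →
    MonotoneOn G₀ (Ioo a b) → MonotoneOn G₀ (Ioo a w)
  gap_zero : ∀ w, 0 < w → ν (Icc 0 w) = 0 → MonotoneOn G₀ (Ico 0 w)

/-- The properties that every pooling step preserves.  `tail` and `orth` say that `G` is the
projection of `G₀` onto the functions which are constant on the pools, and that the pools are
legitimate. -/
structure PoolInvariant (ν : Measure ℝ) (G₀ G : ℝ → ℝ) : Prop where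
  sub : MonotoneOn (fun y => y - G y) (massRange ν)
  zero : G 0 ≤ 0
  memLp : MemLp G 2 ν
  tail : ∀ A : Set ℝ, IsUpperSet A → ∫ y in A, (G₀ y - G y) ∂ν ≤ 0
  orth : ∀ ψ : ℝ → ℝ, Measurable ψ → (∃ C, ∀ x, |ψ x| ≤ C) →
    ∫ y, (G₀ y - G y) * ψ (G y) ∂ν = 0

/-- `G` is non-decreasing before `c` and untouched by pooling from `c` on. -/
structure PoolFrontier (ν : Measure ℝ) (G₀ G : ℝ → ℝ) (c : ℝ) : Prop where
  mem : c ∈ massRange ν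
  mono : MonotoneOn G (Ico 0 c)
  eqOn : ∀ y ∈ massRange ν, c ≤ y → G y = G₀ y
  start : c = 0 ∨ ∃ a, 0 ≤ a ∧ a < c ∧ MonotoneOn G₀ (Ioo a c) ∧
    ∀ w, c < w → ¬ MonotoneOn G₀ (massRange ν ∩ Ioo a w)

theorem IsPoolStart.invariant {ν : Measure ℝ} {G₀ : ℝ → ℝ} (h : IsPoolStart ν G₀) :
    PoolInvariant ν G₀ G₀ where
  sub := h.sub
  zero := h.zero
  memLp := h.memLp
  tail A _ := by simp
  orth ψ _ _ := by simp

theorem IsPoolStart.frontier {ν : Measure ℝ} [IsProbabilityMeasure ν] (hν : ν (Iio 0) = 0)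
    {G₀ : ℝ → ℝ} : PoolFrontier ν G₀ G₀ 0 where
  mem := zero_mem_massRange hν
  mono := by simp [MonotoneOn]
  eqOn _ _ _ := rfl
  start := Or.inl rfl

theorem PoolInvariant.le_id {ν : Measure ℝ} [IsProbabilityMeasure ν] (hν : ν (Iio 0) = 0)
    {G₀ G : ℝ → ℝ} (h : PoolInvariant ν G₀ G) {y : ℝ} (hy : y ∈ massRange ν) : G y ≤ y := by
  have := h.sub (zero_mem_massRange hν) hy hy.1
  have h0 := h.zero
  simp only at this
  linarith

theorem PoolInvariant.integrable {ν : Measure ℝ} [IsProbabilityMeasure ν]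
    {G₀ G : ℝ → ℝ} (h : PoolInvariant ν G₀ G) : Integrable G ν :=
  h.memLp.integrable (by norm_num)

/-- Gluing of monotonicity on `[0, b)` and near `b`. -/
theorem monotoneOn_glue {S : Set ℝ} (hS : S ⊆ Ici 0) (hSc : S.OrdConnected) {G : ℝ → ℝ} {a b w : ℝ}
    (hb : b ∈ S) (h0 : MonotoneOn G (Ico 0 b)) (ha : a < b)
    (h1 : MonotoneOn G (S ∩ Ioo a w)) : MonotoneOn G (S ∩ Iio w) := by
  intro x hx y hy hxy
  rcases lt_or_ge y b with hyb | hyb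
  · exact h0 ⟨hS hx.1, hxy.trans_lt hyb⟩ ⟨hS hy.1, hyb⟩ hxy
  rcases lt_or_ge a x with hax | hax
  · exact h1 ⟨hx.1, hax, hx.2⟩ ⟨hy.1, hax.trans_le hxy, hy.2⟩ hxy
  have hm : (a + b) / 2 ∈ S := hSc.out hx.1 hb ⟨by linarith, by linarith⟩
  refine (h0 (b := (a + b) / 2) ⟨hS hx.1, by linarith⟩ ⟨hS hm, by linarith⟩ (by linarith)).trans ?_
  exact h1 ⟨hm, by linarith, (by linarith : (a + b) / 2 < y).trans hy.2⟩
    ⟨hy.1, ha.trans_le hyb, hy.2⟩ (by linarith)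

theorem massRange_subset_Ici {ν : Measure ℝ} : massRange ν ⊆ Ici 0 := fun _ h => h.1

/-- The frontier lies to the left of the first descent. -/
theorem PoolFrontier.le_of_descent {ν : Measure ℝ} {G₀ G : ℝ → ℝ} {c b : ℝ}
    (hc : PoolFrontier ν G₀ G c) (hb : StartsFirstDescent ν G b) : c ≤ b := by
  by_contra hlt
  rw [not_le] at hlt
  refine hb.descent (c - b) (by linarith) fun x hx y hy hxy => ?_
  exact hc.mono ⟨hx.1.1, by linarith [hx.2.2]⟩ ⟨hy.1.1, by linarith [hy.2.2]⟩ hxy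

/-- There is mass immediately to the right of (or at) the start of a descent. -/
theorem PoolFrontier.measure_Icc_pos {ν : Measure ℝ} {G₀ G : ℝ → ℝ} {c b w : ℝ}
    (h₀ : IsPoolStart ν G₀) (hc : PoolFrontier ν G₀ G c) (hb : StartsFirstDescent ν G b)
    (hw : b < w) : 0 < ν (Icc b w) := by
  refine pos_iff_ne_zero.2 fun h0 => ?_
  have hcb := hc.le_of_descent hb
  -- If the frontier is strictly left of `b`, then `G = G₀` near `b` and a null interval would let
  -- monotonicity continue across `b`. If it equals `b`, monotonicity of `G₀` across it is excluded
  -- by `start`, or `b = 0` and `gap_zero` applies.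
  rcases hcb.lt_or_eq with hlt | rfl
  · have hm : MonotoneOn G₀ (Ioo c b) := by
      intro x hx y hy hxy
      have h0c := hc.mem.1
      rw [← hc.eqOn x (massRange_of_le hb.mem (h0c.trans hx.1.le) hx.2.le) hx.1.le,
        ← hc.eqOn y (massRange_of_le hb.mem (h0c.trans hy.1.le) hy.2.le) hy.1.le]
      exact hb.mono_left ⟨h0c.trans hx.1.le, hx.2⟩ ⟨h0c.trans hy.1.le, hy.2⟩ hxy
    have hm' := h₀.gap c b w hc.mem.1 hlt hw hb.mem h0 hm
    refine hb.descent (min (b - c) (w - b)) (lt_min (by linarith) (by linarith)) ?_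
    intro x hx y hy hxy
    have e1 := min_le_left (b - c) (w - b)
    have e2 := min_le_right (b - c) (w - b)
    rw [hc.eqOn x hx.1 (by linarith [hx.2.1]), hc.eqOn y hy.1 (by linarith [hy.2.1])]
    exact hm' ⟨by linarith [hx.2.1], by linarith [hx.2.2]⟩
      ⟨by linarith [hy.2.1], by linarith [hy.2.2]⟩ hxy
  · rcases hc.start with rfl | ⟨a, ha0, hac, hm, hn⟩
    · have hm := h₀.gap_zero w hw h0
      refine hb.descent w hw ?_
      intro x hx y hy hxy
      rw [hc.eqOn x hx.1 hx.1.1, hc.eqOn y hy.1 hy.1.1]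
      exact hm ⟨hx.1.1, by linarith [hx.2.2]⟩ ⟨hy.1.1, by linarith [hy.2.2]⟩ hxy
    · exact hn w hw ((h₀.gap a c w ha0 hac hw hc.mem h0 hm).mono inter_subset_right)

/-- Replacing `G` by its mean `T` on a set `P` on which `G - T` changes sign at most once, from
positive to negative, and which is `{G > T}` to the left of `b`. -/
theorem PoolInvariant.pool {ν : Measure ℝ} [IsProbabilityMeasure ν] (hν : ν (Iio 0) = 0)
    {G₀ G G' : ℝ → ℝ} (hG₀ : MemLp G₀ 2 ν) (h : PoolInvariant ν G₀ G) {P : Set ℝ}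
    (hP : MeasurableSet P) {b T : ℝ}
    (hin : ∀ y ∈ P, G' y = T) (hout : ∀ y ∉ P, G' y = G y)
    (hleft : ∀ y ∈ massRange ν, y < b → (y ∈ P ↔ T < G y))
    (hright : ∀ y ∈ massRange ν, b ≤ y → G y = G₀ y)
    (hT : ∫ y in P, (G y - T) ∂ν = 0)
    (hcross : ∀ x ∈ P, ∀ y ∈ P, x ≤ y → T < G y → T ≤ G x)
    (hsub : MonotoneOn (fun y => y - G' y) (massRange ν)) (hzero : G' 0 ≤ 0) :
    PoolInvariant ν G₀ G' := by
  have hGi := h.integrable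
  have hG₀i : Integrable G₀ ν := hG₀.integrable (by norm_num)
  have hGT : Integrable (fun y => G y - T) ν := hGi.sub (integrable_const _)
  have hdi : Integrable (fun y => G₀ y - G y) ν := hG₀i.sub hGi
  refine ⟨hsub, hzero, ?_, ?_, ?_⟩
  · have e : G' = P.indicator (fun _ => T) + Pᶜ.indicator G := by
      funext y
      by_cases hy : y ∈ P
      · simp [hy, hin y hy]
      · simp [hy, hout y hy]
    rw [e]
    exact ((memLp_const T).indicator hP).add (h.memLp.indicator hP.compl)
  · intro A hA
    have hAm : MeasurableSet A := hA.ordConnected.measurableSet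
    have e : ∀ y, G₀ y - G' y = (G₀ y - G y) + P.indicator (fun y => G y - T) y := by
      intro y
      by_cases hy : y ∈ P
      · simp [hy, hin y hy]
      · simp [hy, hout y hy]
    simp only [e]
    rw [integral_add hdi.integrableOn (hGT.indicator hP).integrableOn, setIntegral_indicator hP]
    have h1 := h.tail A hA
    have h2 : ∫ y in A ∩ P, (G y - T) ∂ν ≤ 0 := by
      -- If `G` exceeds `T` somewhere in `A ∩ P`, the single sign change gives `T ≤ G` on `P \ A`,
      -- which lies to the left. As `G - T` has integral zero over `P`, its integral over `A ∩ P` is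
      -- again nonpositive.
      by_cases hall : ∀ y ∈ A ∩ P, G y - T ≤ 0
      · exact setIntegral_nonpos (hAm.inter hP) hall
      · push Not at hall
        obtain ⟨y, ⟨hyA, hyP⟩, hy⟩ := hall
        have h3 : 0 ≤ ∫ y in P \ A, (G y - T) ∂ν := by
          refine setIntegral_nonneg (hP.diff hAm) fun x hx => ?_
          have hxy : x ≤ y := by
            by_contra hlt
            exact hx.2 (hA (not_le.1 hlt).le hyA)
          have := hcross x hx.1 y hyP hxy (by linarith)
          linarith
        have h4 := integral_inter_add_sdiff (s := P) (t := A) hAm hGT.integrableOn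
        rw [inter_comm]
        linarith
    linarith
  · rintro ψ hψ ⟨C, hC⟩
    have hC0 : 0 ≤ C := (abs_nonneg _).trans (hC 0)
    -- To the left of `b` one has `G' = min G T`, so `ψ (G')` equals `ψ₁ (G) + ψ T * ψ₂ (G)`: again
    -- a bounded test function of the old `G`.
    set ψ₁ : ℝ → ℝ := (Iic T).indicator ψ with hψ₁
    set ψ₂ : ℝ → ℝ := (Ioi T).indicator (fun _ => 1) with hψ₂
    have hψ₁m : Measurable ψ₁ := hψ.indicator measurableSet_Iic
    have hψ₂m : Measurable ψ₂ := measurable_const.indicator measurableSet_Ioi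
    have hψ₁C : ∀ x, |ψ₁ x| ≤ C := by
      intro x
      by_cases hx : x ∈ Iic T
      · simp only [hψ₁, indicator_of_mem hx]; exact hC x
      · simp only [hψ₁, indicator_of_notMem hx, abs_zero]; exact hC0
    have hψ₂C : ∀ x, |ψ₂ x| ≤ 1 := by
      intro x
      by_cases hx : x ∈ Ioi T
      · simp [hψ₂, indicator_of_mem hx]
      · simp [hψ₂, indicator_of_notMem hx]
    have o1 := h.orth ψ₁ hψ₁m ⟨C, hψ₁C⟩
    have o2 := h.orth ψ₂ hψ₂m ⟨1, hψ₂C⟩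
    have hint : ∀ φ : ℝ → ℝ, Measurable φ → (∀ D, (∀ x, |φ x| ≤ D) →
        Integrable (fun y => (G₀ y - G y) * φ (G y)) ν) := by
      intro φ hφ D hD
      exact hdi.mul_bdd (c := D) (hφ.comp_aemeasurable h.memLp.1.aemeasurable).aestronglyMeasurable
        (Eventually.of_forall fun y => by simpa using hD (G y))
    have i1 := hint ψ₁ hψ₁m C hψ₁C
    have i2 := hint ψ₂ hψ₂m 1 hψ₂C
    -- From `b` on, `G = G₀` kills the old residual, and only the pool contributes, through `ψ T *
    -- (G - T)`, whose integral is zero.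
    have key : (fun y => (G₀ y - G' y) * ψ (G' y)) =ᵐ[ν] fun y =>
        (G₀ y - G y) * ψ₁ (G y) + (ψ T * ((G₀ y - G y) * ψ₂ (G y)) +
          ψ T * P.indicator (fun y => G y - T) y) := by
      filter_upwards [ae_mem_massRange hν] with y hy
      rcases lt_or_ge y b with hyb | hyb
      · by_cases hyP : y ∈ P
        · have hlt := (hleft y hy hyb).1 hyP
          simp only [hin y hyP, hψ₁, hψ₂, indicator_of_mem hyP,
            indicator_of_notMem (show G y ∉ Iic T from not_le.2 hlt),
            indicator_of_mem (show G y ∈ Ioi T from hlt)]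
          ring
        · have hle : G y ≤ T := not_lt.1 fun hlt => hyP ((hleft y hy hyb).2 hlt)
          simp only [hout y hyP, hψ₁, hψ₂, indicator_of_notMem hyP,
            indicator_of_mem (show G y ∈ Iic T from hle),
            indicator_of_notMem (show G y ∉ Ioi T from not_lt.2 hle)]
          ring
      · have hg := hright y hy hyb
        by_cases hyP : y ∈ P
        · simp only [hin y hyP, indicator_of_mem hyP, hg]
          ring
        · simp only [hout y hyP, indicator_of_notMem hyP, hg]
          ring
    have i3 : Integrable (fun y => ψ T * ((G₀ y - G y) * ψ₂ (G y))) ν := i2.const_mul _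
    have i4 : Integrable (fun y => ψ T * P.indicator (fun y => G y - T) y) ν :=
      (hGT.indicator hP).const_mul _
    have i5 : Integrable (fun y => ψ T * ((G₀ y - G y) * ψ₂ (G y)) +
      ψ T * P.indicator (fun y => G y - T) y) ν := i3.add i4
    rw [integral_congr_ae key, integral_add i1 i5, integral_add i3 i4, integral_const_mul,
      integral_const_mul, o1, o2, integral_indicator hP, hT]
    simp

/-! ### Pooling a descent in the interior -/

theorem exists_mem_massRange_gt {ν : Measure ℝ} [IsProbabilityMeasure ν] (hν : ν (Iio 0) = 0)
    {b : ℝ} (h : 0 < ν (Ioi b)) : ∃ y ∈ massRange ν, b < y := by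
  by_contra! hall
  refine h.ne' (measure_mono_null (fun y hy => ?_) (measure_compl_massRange hν))
  exact fun hyS => absurd (hall y hyS) (not_le.2 hy)

section RightMNDI

variable {ν : Measure ℝ} {G : ℝ → ℝ} {b : ℝ}

theorem rightMNDI_subset_Ioi : rightMNDI ν G b ⊆ Ioi b := fun _ h => h.2.1

theorem rightMNDI_low (hb : 0 ≤ b) {x y : ℝ} (hx : x ∈ rightMNDI ν G b) (hy : b < y) (hyx : y ≤ x) :
    y ∈ rightMNDI ν G b := by
  obtain ⟨hxS, hbx, ε, hε, hm⟩ := hx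
  exact ⟨massRange_of_le hxS (hb.trans hy.le) hyx, hy, ε, hε,
    hm.mono (inter_subset_inter_right _ (Ioo_subset_Ioo_right (by linarith)))⟩

theorem monotoneOn_rightMNDI : MonotoneOn G (rightMNDI ν G b) := by
  rintro x ⟨hxS, hbx, -⟩ y ⟨hyS, hby, ε, hε, hm⟩ hxy
  exact hm ⟨hxS, hbx, by linarith⟩ ⟨hyS, hby, by linarith⟩ hxy

theorem IsFirstMDI.exists_subset_rightMNDI {b₁ : ℝ} (h : IsFirstMDI ν G b₁ b) :
    ∃ ε > 0, massRange ν ∩ Ioo b (b + ε) ⊆ rightMNDI ν G b := by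
  obtain ⟨ε, hε, hm⟩ := h.mono_right
  refine ⟨ε, hε, fun y hy => ⟨hy.1, hy.2.1, b + ε - y, by linarith [hy.2.2], ?_⟩⟩
  rwa [show y + (b + ε - y) = b + ε by ring]

theorem IsFirstMDI.rightMNDI_nonempty [IsProbabilityMeasure ν] (hν : ν (Iio 0) = 0) {b₁ : ℝ}
    (h : IsFirstMDI ν G b₁ b) : (rightMNDI ν G b).Nonempty := by
  obtain ⟨ε, hε, hs⟩ := h.exists_subset_rightMNDI
  obtain ⟨y, hy, hby⟩ := exists_mem_massRange_gt hν h.mass_right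
  have hb : 0 ≤ b := h.mem.1.trans h.le
  refine ⟨min y (b + ε / 2), hs ⟨massRange_of_le hy ?_ (min_le_left _ _), lt_min hby (by linarith), ?_⟩⟩
  · exact le_min hy.1 (by linarith)
  · exact (min_le_right _ _).trans_lt (by linarith)

end RightMNDI

/-- The data of a first descent `[b₁, b₂]` with mass to its right, in a function that satisfies the
invariants. -/
structure InnerDescent (ν : Measure ℝ) (G₀ G : ℝ → ℝ) (b₁ b₂ : ℝ) : Prop where
  null : ν (Iio 0) = 0
  start : IsPoolStart ν G₀
  inv : PoolInvariant ν G₀ G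
  mdi : IsFirstMDI ν G b₁ b₂
  eqOn : ∀ y ∈ massRange ν, b₁ ≤ y → G y = G₀ y
  pos : ∀ w, b₁ < w → 0 < ν (Icc b₁ w)

namespace InnerDescent

variable {ν : Measure ℝ} [IsProbabilityMeasure ν] {G₀ G : ℝ → ℝ} {b₁ b₂ : ℝ}

theorem b₁_nonneg (h : InnerDescent ν G₀ G b₁ b₂) : 0 ≤ b₁ := h.mdi.mem.1

theorem b₂_nonneg (h : InnerDescent ν G₀ G b₁ b₂) : 0 ≤ b₂ := h.b₁_nonneg.trans h.mdi.le

theorem b₂_mem (h : InnerDescent ν G₀ G b₁ b₂) : b₂ ∈ massRange ν :=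
  ⟨h.b₂_nonneg, h.mdi.mass_right.trans_le (measure_mono Ioi_subset_Ici_self)⟩

theorem pos_Icc (h : InnerDescent ν G₀ G b₁ b₂) {v w : ℝ} (hv : v ≤ b₁)
    (hw : w ∈ rightMNDI ν G b₂) : 0 < ν (Icc v w) :=
  (h.pos w (h.mdi.le.trans_lt hw.2.1)).trans_le (measure_mono (Icc_subset_Icc_left hv))

/-- The conditional means are bounded by pointwise bounds. -/
theorem condMean_le (h : InnerDescent ν G₀ G b₁ b₂) {v w K : ℝ} (hv : v ≤ b₁)
    (hw : w ∈ rightMNDI ν G b₂) (hK : ∀ y ∈ Icc v w, G y ≤ K) : condMean ν G v w ≤ K :=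
  setAverage_le h.inv.integrable (h.pos_Icc hv hw)
    (setIntegral_nonpos measurableSet_Icc fun y hy => by linarith [hK y hy])

theorem le_condMean (h : InnerDescent ν G₀ G b₁ b₂) {v w K : ℝ} (hv : v ≤ b₁)
    (hw : w ∈ rightMNDI ν G b₂) (hK : ∀ y ∈ Icc v w, K ≤ G y) : K ≤ condMean ν G v w :=
  le_setAverage h.inv.integrable (h.pos_Icc hv hw)
    (setIntegral_nonneg measurableSet_Icc fun y hy => by linarith [hK y hy])

theorem bddAbove (h : InnerDescent ν G₀ G b₁ b₂) {w : ℝ} (hw : w ∈ rightMNDI ν G b₂) :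
    BddAbove (range fun v : Icc (0 : ℝ) b₁ => condMean ν G v w) := by
  refine ⟨w, ?_⟩
  rintro _ ⟨v, rfl⟩
  refine h.condMean_le v.2.2 hw fun y hy => ?_
  exact (h.inv.le_id h.null (massRange_of_le hw.1 (v.2.1.trans hy.1) hy.2)).trans hy.2

theorem le_sup (h : InnerDescent ν G₀ G b₁ b₂) {v w : ℝ} (hv : v ∈ Icc 0 b₁)
    (hw : w ∈ rightMNDI ν G b₂) :
    condMean ν G v w ≤ ⨆ v : Icc (0 : ℝ) b₁, condMean ν G v w :=
  le_ciSup (h.bddAbove hw) ⟨v, hv⟩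

theorem sup_le (h : InnerDescent ν G₀ G b₁ b₂) {w K : ℝ}
    (hK : ∀ v ∈ Icc 0 b₁, condMean ν G v w ≤ K) :
    ⨆ v : Icc (0 : ℝ) b₁, condMean ν G v w ≤ K := by
  have : Nonempty (Icc (0 : ℝ) b₁) := ⟨⟨0, le_rfl, h.b₁_nonneg⟩⟩
  exact ciSup_le fun v => hK v v.2

/-- The choice `v = b₁` suffices. On `[b₁, w]` the function stays above `G z - (z - b₂)`: up to `z`
because `y - G y` is non-decreasing and `G` decreases on the descent, and beyond `z` by
monotonicity. This bounds the infimum over `w` and later controls the slope of the pooled function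
on leaving the pool. -/
theorem lower_bound (h : InnerDescent ν G₀ G b₁ b₂) {z w : ℝ} (hz : z ∈ rightMNDI ν G b₂)
    (hw : w ∈ rightMNDI ν G b₂) :
    G z - (z - b₂) ≤ ⨆ v : Icc (0 : ℝ) b₁, condMean ν G v w := by
  refine (h.le_condMean le_rfl hw fun y hy => ?_).trans (h.le_sup ⟨h.b₁_nonneg, le_rfl⟩ hw)
  have hb₂z : b₂ < z := hz.2.1
  have hsub : ∀ x ∈ massRange ν, x ≤ z → G z - (z - x) ≤ G x := by
    intro x hx hxz
    have := h.inv.sub hx hz.1 hxz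
    simp only at this
    linarith
  rcases le_or_gt y b₂ with hyb | hyb
  · have h1 := h.mdi.anti.antitoneOn ⟨hy.1, hyb⟩ ⟨h.mdi.le, le_rfl⟩ hyb
    have h2 := hsub b₂ h.b₂_mem hb₂z.le
    linarith
  · have hyI := rightMNDI_low h.b₂_nonneg hw hyb hy.2
    rcases le_or_gt y z with hyz | hyz
    · have := hsub y hyI.1 hyz
      linarith
    · have := monotoneOn_rightMNDI hz hyI hyz.le
      linarith

theorem bddBelow (h : InnerDescent ν G₀ G b₁ b₂) :
    BddBelow (range fun w : rightMNDI ν G b₂ => ⨆ v : Icc (0 : ℝ) b₁, condMean ν G v w) := by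
  obtain ⟨z, hz⟩ := h.mdi.rightMNDI_nonempty h.null
  refine ⟨G z - (z - b₂), ?_⟩
  rintro _ ⟨w, rfl⟩
  exact h.lower_bound hz w.2

theorem minMaxValue_le (h : InnerDescent ν G₀ G b₁ b₂) {w : ℝ} (hw : w ∈ rightMNDI ν G b₂) :
    minMaxValue ν G b₁ b₂ ≤ ⨆ v : Icc (0 : ℝ) b₁, condMean ν G v w :=
  ciInf_le h.bddBelow ⟨w, hw⟩

theorem le_minMaxValue (h : InnerDescent ν G₀ G b₁ b₂) {K : ℝ}
    (hK : ∀ w ∈ rightMNDI ν G b₂, K ≤ ⨆ v : Icc (0 : ℝ) b₁, condMean ν G v w) :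
    K ≤ minMaxValue ν G b₁ b₂ := by
  have : Nonempty (rightMNDI ν G b₂) := (h.mdi.rightMNDI_nonempty h.null).to_subtype
  exact le_ciInf fun w => hK w w.2

theorem le_minMaxValue_of_mem (h : InnerDescent ν G₀ G b₁ b₂) {z : ℝ}
    (hz : z ∈ rightMNDI ν G b₂) : G z - (z - b₂) ≤ minMaxValue ν G b₁ b₂ :=
  h.le_minMaxValue fun _ hw => h.lower_bound hz hw

/-- Taking `w` close to `b₂` suffices, since `G` rises by at most `w - b₂` on `(b₂, w]`. -/
theorem minMaxValue_le_of_bound (h : InnerDescent ν G₀ G b₁ b₂) {K : ℝ}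
    (hK : ∀ x ∈ Icc 0 b₂, G x ≤ K) : minMaxValue ν G b₁ b₂ ≤ K := by
  refine le_of_forall_pos_le_add fun ε hε => ?_
  obtain ⟨z, hz⟩ := h.mdi.rightMNDI_nonempty h.null
  have hbz : b₂ < z := hz.2.1
  have hw : min z (b₂ + ε) ∈ rightMNDI ν G b₂ :=
    rightMNDI_low h.b₂_nonneg hz (lt_min hbz (by linarith)) (min_le_left _ _)
  refine (h.minMaxValue_le hw).trans (h.sup_le fun v hv => h.condMean_le hv.2 hw fun y hy => ?_)
  rcases le_or_gt y b₂ with hyb | hyb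
  · linarith [hK y ⟨hv.1.trans hy.1, hyb⟩]
  · have h1 := h.inv.sub h.b₂_mem (massRange_of_le hw.1 (hv.1.trans hy.1) hy.2) hyb.le
    have h2 := hK b₂ ⟨h.b₂_nonneg, le_rfl⟩
    have h3 := hy.2.trans (min_le_right _ _)
    simp only at h1
    linarith

/-- The optimal value is not more than the left limit of `G` at the descent. -/
theorem minMaxValue_le_left (h : InnerDescent ν G₀ G b₁ b₂) {x : ℝ} (hx : x ∈ Ico 0 b₁) :
    minMaxValue ν G b₁ b₂ ≤ G x + (b₁ - x) := by
  have hsub : ∀ y ∈ massRange ν, x ≤ y → G y ≤ G x + (y - x) := by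
    intro y hy hxy
    have := h.inv.sub (massRange_of_le h.mdi.mem hx.1 hx.2.le) hy hxy
    simp only at this
    linarith
  refine h.minMaxValue_le_of_bound fun y hy => ?_
  rcases lt_or_ge y x with hyx | hyx
  · have := h.mdi.mono_left ⟨hy.1, hyx.trans hx.2⟩ hx hyx.le
    linarith [hx.2]
  rcases le_or_gt y b₁ with hyb | hyb
  · have := hsub y (massRange_of_le h.mdi.mem hy.1 hyb) hyx
    linarith
  · have h1 := h.mdi.anti.antitoneOn ⟨le_rfl, h.mdi.le⟩ ⟨hyb.le, hy.2⟩ hyb.le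
    have h2 := hsub b₁ h.mdi.mem hx.2.le
    linarith

theorem minMaxValue_nonpos (h : InnerDescent ν G₀ G b₁ b₂) (hb : b₁ = 0) :
    minMaxValue ν G b₁ b₂ ≤ 0 := by
  refine (h.minMaxValue_le_of_bound (K := G 0) fun y hy => ?_).trans h.inv.zero
  subst hb
  exact h.mdi.anti.antitoneOn ⟨le_rfl, h.mdi.le⟩ hy hy.1

theorem setIntegral_Icc (h : InnerDescent ν G₀ G b₁ b₂) {f : ℝ → ℝ} (hf : Integrable f ν) {v w : ℝ}
    (hv : v ≤ b₁) (hw : b₂ < w) :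
    ∫ y in Icc v w, f y ∂ν =
      (∫ y in Ico v b₁, f y ∂ν) + (∫ y in Icc b₁ b₂, f y ∂ν) + ∫ y in Ioc b₂ w, f y ∂ν := by
  rw [← Icc_union_Ioc_eq_Icc (hv.trans h.mdi.le) hw.le, setIntegral_union
    (disjoint_left.2 fun x hx hx' => absurd hx.2 (not_le.2 hx'.1)) measurableSet_Ioc
    hf.integrableOn hf.integrableOn, ← Ico_union_Icc_eq_Icc hv h.mdi.le, setIntegral_union
    (disjoint_left.2 fun x hx hx' => absurd hx'.1 (not_le.2 hx.2)) measurableSet_Icc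
    hf.integrableOn hf.integrableOn]

theorem measurableSet_left (h : InnerDescent ν G₀ G b₁ b₂) (t : ℝ) :
    MeasurableSet {v ∈ Ico 0 b₁ | t < G v} := by
  refine OrdConnected.measurableSet ⟨fun x hx y hy z hz => ?_⟩
  have hz' : z ∈ Ico 0 b₁ := ⟨hx.1.1.trans hz.1, hz.2.trans_lt hy.1.2⟩
  exact ⟨hz', hx.2.trans_le (h.mdi.mono_left hx.1 hz' hz.1)⟩

theorem measurableSet_right (h : InnerDescent ν G₀ G b₁ b₂) (t : ℝ) :
    MeasurableSet {w ∈ rightMNDI ν G b₂ | G w < t} := by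
  refine OrdConnected.measurableSet ⟨fun x hx y hy z hz => ?_⟩
  have hz' := rightMNDI_low h.b₂_nonneg hy.1 (hx.1.2.1.trans_le hz.1) hz.2
  exact ⟨hz', (monotoneOn_rightMNDI hz' hy.1 hz.2).trans_lt hy.2⟩

theorem measurableSet_pooledInterval (h : InnerDescent ν G₀ G b₁ b₂) (t : ℝ) :
    MeasurableSet (pooledInterval ν G b₁ b₂ t) :=
  ((h.measurableSet_left t).union measurableSet_Icc).union (h.measurableSet_right t)

theorem setIntegral_pooledInterval (h : InnerDescent ν G₀ G b₁ b₂) {f : ℝ → ℝ}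
    (hf : Integrable f ν) (t : ℝ) :
    ∫ y in pooledInterval ν G b₁ b₂ t, f y ∂ν =
      (∫ y in {v ∈ Ico 0 b₁ | t < G v}, f y ∂ν) + (∫ y in Icc b₁ b₂, f y ∂ν) +
        ∫ y in {w ∈ rightMNDI ν G b₂ | G w < t}, f y ∂ν := by
  rw [pooledInterval, setIntegral_union ?_ (h.measurableSet_right t) hf.integrableOn
    hf.integrableOn, setIntegral_union ?_ measurableSet_Icc hf.integrableOn hf.integrableOn]
  · exact disjoint_left.2 fun x hx hx' => absurd hx'.1 (not_le.2 hx.1.2)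
  · refine disjoint_left.2 fun x hx hx' => ?_
    have hlt : b₂ < x := hx'.1.2.1
    rcases hx with hx | hx
    · linarith [hx.1.2, h.mdi.le]
    · linarith [hx.2]

/-- The optimal value is the mean of `G` over the pooled interval. -/
theorem setIntegral_sub_minMaxValue (h : InnerDescent ν G₀ G b₁ b₂) :
    ∫ y in pooledInterval ν G b₁ b₂ (minMaxValue ν G b₁ b₂),
      (G y - minMaxValue ν G b₁ b₂) ∂ν = 0 := by
  set T := minMaxValue ν G b₁ b₂ with hT
  have hf : Integrable (fun y => G y - T) ν := h.inv.integrable.sub (integrable_const _)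
  rw [h.setIntegral_pooledInterval hf]
  set L := {v ∈ Ico 0 b₁ | T < G v} with hL
  set R := {w ∈ rightMNDI ν G b₂ | G w < T} with hR
  have hLm : MeasurableSet L := h.measurableSet_left T
  have hRm : MeasurableSet R := h.measurableSet_right T
  -- `L` is exactly the part of `[0, b₁)` where the integrand is positive, so no interval `[v, b₁)`
  -- has a larger integral.
  have hmax : ∀ v ∈ Icc 0 b₁, ∫ y in Ico v b₁, (G y - T) ∂ν ≤ ∫ y in L, (G y - T) ∂ν := by
    intro v hv
    have e := integral_inter_add_sdiff (s := Ico v b₁) (t := L) hLm hf.integrableOn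
    have e1 : ∫ y in Ico v b₁ \ L, (G y - T) ∂ν ≤ 0 := by
      refine setIntegral_nonpos (measurableSet_Ico.diff hLm) fun y hy => ?_
      have hy0 : y ∈ Ico 0 b₁ := ⟨hv.1.trans hy.1.1, hy.1.2⟩
      have : ¬ T < G y := fun hlt => hy.2 ⟨hy0, hlt⟩
      linarith
    have e2 : ∫ y in Ico v b₁ ∩ L, (G y - T) ∂ν ≤ ∫ y in L, (G y - T) ∂ν := by
      refine setIntegral_mono_set hf.integrableOn ?_ inter_subset_right.eventuallyLE
      filter_upwards [ae_restrict_mem hLm] with y hy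
      have := hy.2
      simp only [Pi.zero_apply]
      linarith
    linarith
  -- Dually, `R` collects the negative part of the integrand on `I₃`.
  have hmin : ∀ w ∈ rightMNDI ν G b₂,
      ∫ y in R, (G y - T) ∂ν ≤ ∫ y in Ioc b₂ w, (G y - T) ∂ν := by
    intro w hw
    have e := integral_inter_add_sdiff (s := Ioc b₂ w) (t := R) hRm hf.integrableOn
    have e' := integral_inter_add_sdiff (s := R) (t := Ioc b₂ w) measurableSet_Ioc hf.integrableOn
    have e1 : 0 ≤ ∫ y in Ioc b₂ w \ R, (G y - T) ∂ν := by
      refine setIntegral_nonneg (measurableSet_Ioc.diff hRm) fun y hy => ?_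
      have : ¬ G y < T := fun hlt => hy.2 ⟨rightMNDI_low h.b₂_nonneg hw hy.1.1 hy.1.2, hlt⟩
      linarith
    have e2 : ∫ y in R \ Ioc b₂ w, (G y - T) ∂ν ≤ 0 := by
      refine setIntegral_nonpos (hRm.diff measurableSet_Ioc) fun y hy => ?_
      have := hy.1.2
      linarith
    rw [inter_comm] at e'
    linarith
  refine le_antisymm ?_ ?_
  · by_contra hpos
    rw [not_le] at hpos
    set δ := (∫ y in L, (G y - T) ∂ν) + (∫ y in Icc b₁ b₂, (G y - T) ∂ν) +
      ∫ y in R, (G y - T) ∂ν with hδ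
    -- With `[v, b₁)` approximating `L` up to `δ / 2`, every `w` gives an integral of at least `δ /
    -- 2`. The mass of `[v, w]` is at most one, so division by it keeps the mean at least `T + δ /
    -- 2`, which contradicts the infimum.
    have hlow : T + δ / 2 ≤ T := by
      conv_rhs => rw [hT]
      refine h.le_minMaxValue fun w hw => ?_
      obtain ⟨v, hv, hvL⟩ := exists_setIntegral_Ico_near hf h.b₁_nonneg (s := L)
        (fun x hx => hx.1) (fun x hx y hxy hyb =>
          ⟨⟨hx.1.1.trans hxy, hyb⟩, hx.2.trans_le
            (h.mdi.mono_left hx.1 ⟨hx.1.1.trans hxy, hyb⟩ hxy)⟩) (half_pos hpos)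
      refine le_trans ?_ (h.le_sup hv hw)
      have e := h.setIntegral_Icc hf hv.2 hw.2.1
      have e1 := (abs_lt.1 hvL).1
      have e2 := hmin w hw
      have hge : δ / 2 ≤ ∫ y in Icc v w, (G y - T) ∂ν := by linarith
      have hm := setAverage_sub_mul h.inv.integrable (h.pos_Icc hv.2 hw) T
      have hm1 : ν.real (Icc v w) ≤ 1 := measureReal_le_one
      have hm0 : 0 ≤ ν.real (Icc v w) := measureReal_nonneg
      change T + δ / 2 ≤ ⨍ y in Icc v w, G y ∂ν
      nlinarith
    linarith
  · by_contra hneg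
    rw [not_le] at hneg
    set δ := (∫ y in L, (G y - T) ∂ν) + (∫ y in Icc b₁ b₂, (G y - T) ∂ν) +
      ∫ y in R, (G y - T) ∂ν with hδ
    -- Now a single `w`, with `(b₂, w]` close to `R`, pushes the means for all `v` simultaneously
    -- below `T` by the fixed amount `-δ / 2`.
    obtain ⟨w, hw, hwR⟩ := exists_setIntegral_Ioc_near hf (I := rightMNDI ν G b₂) (s := R)
      rightMNDI_subset_Ioi (fun x hx y hby hyx => rightMNDI_low h.b₂_nonneg hx hby hyx)
      (h.mdi.rightMNDI_nonempty h.null) (fun x hx => hx.1)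
      (fun x hx y hby hyx =>
        have hy := rightMNDI_low h.b₂_nonneg hx.1 hby hyx
        ⟨hy, (monotoneOn_rightMNDI hy hx.1 hyx).trans_lt hx.2⟩)
      (half_pos (neg_pos.2 hneg))
    have hup : T ≤ T + δ / 2 := by
      conv_lhs => rw [hT]
      refine (h.minMaxValue_le hw).trans (h.sup_le fun v hv => ?_)
      have e := h.setIntegral_Icc hf hv.2 hw.2.1
      have e1 := (abs_lt.1 hwR).2
      have e2 := hmax v hv
      have hge : ∫ y in Icc v w, (G y - T) ∂ν ≤ δ / 2 := by linarith
      have hm := setAverage_sub_mul h.inv.integrable (h.pos_Icc hv.2 hw) T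
      have hm1 : ν.real (Icc v w) ≤ 1 := measureReal_le_one
      have hm0 : 0 ≤ ν.real (Icc v w) := measureReal_nonneg
      change ⨍ y in Icc v w, G y ∂ν ≤ T + δ / 2
      by_contra hlt
      rw [not_le] at hlt
      rcases hm0.eq_or_lt with h0 | h0
      · rw [← h0] at hm; linarith
      · nlinarith
    linarith

end InnerDescent

/-! ### The function after pooling an interior descent: slope, invariants and new frontier -/

namespace InnerDescent

variable {ν : Measure ℝ} [IsProbabilityMeasure ν] {G₀ G : ℝ → ℝ} {b₁ b₂ : ℝ}

open Classical in
/-- The function after pooling an interior descent. -/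
noncomputable def pooled (ν : Measure ℝ) (G : ℝ → ℝ) (b₁ b₂ : ℝ) (y : ℝ) : ℝ :=
  if y ∈ pooledInterval ν G b₁ b₂ (minMaxValue ν G b₁ b₂) then minMaxValue ν G b₁ b₂ else G y

/-- Pooling is truncation from above on the left neighbour and, in `pooled_right`, truncation from
below on the right one. These formulas make monotonicity and slope bounds a matter of `min` and
`max`. -/
theorem pooled_left (h : InnerDescent ν G₀ G b₁ b₂) {y : ℝ} (hy : y ∈ Ico 0 b₁) :
    pooled ν G b₁ b₂ y = min (G y) (minMaxValue ν G b₁ b₂) := by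
  by_cases hlt : minMaxValue ν G b₁ b₂ < G y
  · have hP : y ∈ pooledInterval ν G b₁ b₂ (minMaxValue ν G b₁ b₂) := Or.inl (Or.inl ⟨hy, hlt⟩)
    rw [pooled, if_pos hP, min_eq_right hlt.le]
  · rw [pooled, if_neg, min_eq_left (not_lt.1 hlt)]
    rintro ((h1 | h1) | h1)
    · exact hlt h1.2
    · exact absurd h1.1 (not_le.2 hy.2)
    · have : b₂ < y := h1.1.2.1
      linarith [hy.2, h.mdi.le]

theorem pooled_mid {y : ℝ} (hy : y ∈ Icc b₁ b₂) :
    pooled ν G b₁ b₂ y = minMaxValue ν G b₁ b₂ :=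
  if_pos (Or.inl (Or.inr hy))

theorem not_mem_pooledInterval_left (h : InnerDescent ν G₀ G b₁ b₂) {y : ℝ} (hy : b₂ < y) {t : ℝ}
    (hyP : y ∈ pooledInterval ν G b₁ b₂ t) : y ∈ rightMNDI ν G b₂ ∧ G y < t := by
  rcases hyP with (h1 | h1) | h1
  · linarith [h1.1.2, h.mdi.le]
  · linarith [h1.2]
  · exact h1

theorem pooled_right (h : InnerDescent ν G₀ G b₁ b₂) {y : ℝ} (hy : y ∈ rightMNDI ν G b₂) :
    pooled ν G b₁ b₂ y = max (G y) (minMaxValue ν G b₁ b₂) := by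
  by_cases hlt : G y < minMaxValue ν G b₁ b₂
  · have hP : y ∈ pooledInterval ν G b₁ b₂ (minMaxValue ν G b₁ b₂) := Or.inr ⟨hy, hlt⟩
    rw [pooled, if_pos hP, max_eq_right hlt.le]
  · rw [pooled, if_neg (fun hP => hlt (h.not_mem_pooledInterval_left hy.2.1 hP).2),
      max_eq_left (not_lt.1 hlt)]

theorem pooled_beyond (h : InnerDescent ν G₀ G b₁ b₂) {y : ℝ} (hy : b₂ < y)
    (hyI : y ∉ rightMNDI ν G b₂) : pooled ν G b₁ b₂ y = G y :=
  if_neg fun hP => hyI (h.not_mem_pooledInterval_left hy hP).1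

/-- Truncation does not increase slopes, so only entering and leaving the constant piece matter.
Entering is controlled by `minMaxValue_le_left`, leaving by `le_minMaxValue_of_mem`. -/
theorem sub_pooled (h : InnerDescent ν G₀ G b₁ b₂) :
    MonotoneOn (fun y => y - pooled ν G b₁ b₂ y) (massRange ν) := by
  set T := minMaxValue ν G b₁ b₂ with hT
  have hsub : ∀ x ∈ massRange ν, ∀ y ∈ massRange ν, x ≤ y → x - G x ≤ y - G y :=
    fun x hx y hy hxy => h.inv.sub hx hy hxy
  have left_le : ∀ x ∈ massRange ν, x < b₁ → x - pooled ν G b₁ b₂ x ≤ b₁ - T := by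
    intro x hx hxb
    rw [h.pooled_left ⟨hx.1, hxb⟩]
    have h1 := h.minMaxValue_le_left ⟨hx.1, hxb⟩
    rcases min_choice (G x) T with e | e <;> rw [← hT, e] <;> linarith
  have le_right : ∀ y ∈ rightMNDI ν G b₂, b₂ - T ≤ y - pooled ν G b₁ b₂ y := by
    intro y hy
    rw [h.pooled_right hy]
    have h1 := h.le_minMaxValue_of_mem hy
    have h2 : b₂ < y := hy.2.1
    rcases max_choice (G y) T with e | e <;> rw [← hT, e] <;> linarith
  have le_beyond : ∀ y ∈ massRange ν, b₂ < y → y ∉ rightMNDI ν G b₂ →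
      b₂ - T ≤ y - pooled ν G b₁ b₂ y := by
    intro y hy hby hyI
    obtain ⟨z, hz⟩ := h.mdi.rightMNDI_nonempty h.null
    have hzy : z ≤ y := by
      by_contra hlt
      exact hyI (rightMNDI_low h.b₂_nonneg hz hby (not_le.1 hlt).le)
    rw [h.pooled_beyond hby hyI]
    have := h.le_minMaxValue_of_mem hz
    have := hsub z hz.1 y hy hzy
    linarith
  have le_after : ∀ y ∈ massRange ν, b₂ < y → b₂ - T ≤ y - pooled ν G b₁ b₂ y := by
    intro y hy hby
    by_cases hyI : y ∈ rightMNDI ν G b₂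
    · exact le_right y hyI
    · exact le_beyond y hy hby hyI
  have hb := h.mdi.le
  intro x hx y hy hxy
  simp only
  rcases lt_or_ge x b₁ with hxb | hxb
  · rcases lt_or_ge y b₁ with hyb | hyb
    · rw [h.pooled_left ⟨hx.1, hxb⟩, h.pooled_left ⟨hy.1, hyb⟩]
      have h1 := hsub x hx y hy hxy
      have h2 := min_le_left (G y) T
      have h3 := min_le_right (G y) T
      rcases min_choice (G x) T with e | e <;> rw [← hT, e] <;> linarith
    · refine (left_le x hx hxb).trans ?_
      rcases le_or_gt y b₂ with hyb2 | hyb2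
      · rw [pooled_mid ⟨hyb, hyb2⟩]; linarith
      · linarith [le_after y hy hyb2]
  · rcases le_or_gt x b₂ with hxb2 | hxb2
    · rw [pooled_mid ⟨hxb, hxb2⟩]
      rcases le_or_gt y b₂ with hyb2 | hyb2
      · rw [pooled_mid ⟨hxb.trans hxy, hyb2⟩]; linarith
      · linarith [le_after y hy hyb2]
    · have hyb2 := hxb2.trans_le hxy
      have h1 := hsub x hx y hy hxy
      by_cases hyI : y ∈ rightMNDI ν G b₂
      · have hxI := rightMNDI_low h.b₂_nonneg hyI hxb2 hxy
        rw [h.pooled_right hxI, h.pooled_right hyI]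
        have h2 := le_max_left (G x) T
        have h3 := le_max_right (G x) T
        rcases max_choice (G y) T with e | e <;> rw [← hT, e] <;> linarith
      · rw [h.pooled_beyond hyb2 hyI]
        by_cases hxI : x ∈ rightMNDI ν G b₂
        · rw [h.pooled_right hxI]
          have := le_max_left (G x) T
          linarith
        · rw [h.pooled_beyond hxb2 hxI]; exact h1

theorem pooled_zero (h : InnerDescent ν G₀ G b₁ b₂) : pooled ν G b₁ b₂ 0 ≤ 0 := by
  rcases h.b₁_nonneg.eq_or_lt with h0 | h0
  · rw [pooled_mid ⟨h0.ge, h.b₂_nonneg⟩]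
    exact h.minMaxValue_nonpos h0.symm
  · rw [h.pooled_left ⟨le_rfl, h0⟩]
    exact (min_le_left _ _).trans h.inv.zero

/-- `G - T` changes sign only once on the pool: it is positive on the left part, decreasing on the
descent and negative on the right part. -/
theorem invariant_pooled (h : InnerDescent ν G₀ G b₁ b₂) :
    PoolInvariant ν G₀ (pooled ν G b₁ b₂) := by
  refine h.inv.pool h.null h.start.memLp (h.measurableSet_pooledInterval _) (b := b₁)
    (fun y hy => if_pos hy) (fun y hy => if_neg hy) ?_ h.eqOn h.setIntegral_sub_minMaxValue ?_
    h.sub_pooled h.pooled_zero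
  · intro y hy hyb
    refine ⟨?_, fun hlt => Or.inl (Or.inl ⟨⟨hy.1, hyb⟩, hlt⟩)⟩
    rintro ((h1 | h1) | h1)
    · exact h1.2
    · exact absurd h1.1 (not_le.2 hyb)
    · have : b₂ < y := h1.1.2.1
      linarith [h.mdi.le]
  · intro x hx y hy hxy hlt
    rcases hy with (h1 | h1) | h1
    · rcases hx with (h2 | h2) | h2
      · exact h2.2.le
      · linarith [h2.1, h1.1.2]
      · have : b₂ < x := h2.1.2.1
        linarith [h.mdi.le, h1.1.2]
    · rcases hx with (h2 | h2) | h2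
      · exact h2.2.le
      · exact hlt.le.trans (h.mdi.anti.antitoneOn h2 h1 hxy)
      · have : b₂ < x := h2.1.2.1
        linarith [h1.2]
    · exact absurd h1.2 hlt.not_gt

/-- The function after pooling is non-decreasing up to the end of the right neighbouring
interval. -/
theorem monotoneOn_pooled (h : InnerDescent ν G₀ G b₁ b₂) :
    MonotoneOn (pooled ν G b₁ b₂) {y ∈ massRange ν | y ≤ b₂ ∨ y ∈ rightMNDI ν G b₂} := by
  set T := minMaxValue ν G b₁ b₂ with hT
  have left_le : ∀ x ∈ massRange ν, x ≤ b₂ → pooled ν G b₁ b₂ x ≤ T := by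
    intro x hx hxb
    rcases lt_or_ge x b₁ with h1 | h1
    · rw [h.pooled_left ⟨hx.1, h1⟩]; exact min_le_right _ _
    · rw [pooled_mid ⟨h1, hxb⟩]
  have le_right : ∀ y ∈ massRange ν, b₁ ≤ y → (y ≤ b₂ ∨ y ∈ rightMNDI ν G b₂) →
      T ≤ pooled ν G b₁ b₂ y := by
    intro y hy hby hyI
    rcases le_or_gt y b₂ with h1 | h1
    · rw [pooled_mid ⟨hby, h1⟩]
    · rw [h.pooled_right (hyI.resolve_left (not_le.2 h1))]; exact le_max_right _ _
  intro x hx y hy hxy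
  rcases lt_or_ge y b₁ with hyb | hyb
  · rw [h.pooled_left ⟨hx.1.1, hxy.trans_lt hyb⟩, h.pooled_left ⟨hy.1.1, hyb⟩]
    exact min_le_min_right _ (h.mdi.mono_left ⟨hx.1.1, hxy.trans_lt hyb⟩ ⟨hy.1.1, hyb⟩ hxy)
  rcases le_or_gt x b₂ with hxb | hxb
  · exact (left_le x hx.1 hxb).trans (le_right y hy.1 hyb hy.2)
  · have hxI := hx.2.resolve_left (not_le.2 hxb)
    have hyI := hy.2.resolve_left (not_le.2 (hxb.trans_le hxy))
    rw [h.pooled_right hxI, h.pooled_right hyI]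
    exact max_le_max_right _ (monotoneOn_rightMNDI hxI hyI hxy)

/-- The new frontier is the right end of `I₃`, the infimum of the points of the mass range beyond
it. If there are none, the pooled function is non-decreasing throughout. -/
theorem progress_pooled (h : InnerDescent ν G₀ G b₁ b₂) :
    MonotoneOn (pooled ν G b₁ b₂) (massRange ν) ∨
      ∃ c, b₂ < c ∧ PoolFrontier ν G₀ (pooled ν G b₁ b₂) c := by
  set K := {y ∈ massRange ν | b₂ < y ∧ y ∉ rightMNDI ν G b₂} with hK
  rcases K.eq_empty_or_nonempty with hKe | hne
  · refine Or.inl (h.monotoneOn_pooled.mono fun y hy => ⟨hy, ?_⟩)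
    by_contra! hcon
    have : y ∈ K := ⟨hy, hcon⟩
    rw [hKe] at this
    exact this
  right
  have hb₂ := h.b₂_nonneg
  obtain ⟨ε, hε, hsub⟩ := h.mdi.exists_subset_rightMNDI
  have hbdd : BddBelow K := ⟨b₂, fun y hy => hy.2.1.le⟩
  have hge : ∀ ε > 0, massRange ν ∩ Ioo b₂ (b₂ + ε) ⊆ rightMNDI ν G b₂ → b₂ + ε ≤ sInf K := by
    intro ε _ hsub
    refine le_csInf hne fun y hy => ?_
    by_contra hlt
    exact hy.2.2 (hsub ⟨hy.1, hy.2.1, not_le.1 hlt⟩)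
  have hc : b₂ < sInf K := by linarith [hge ε hε hsub]
  obtain ⟨y₀, hy₀⟩ := hne
  have hcS : sInf K ∈ massRange ν :=
    massRange_of_le hy₀.1 (hb₂.trans hc.le) (csInf_le hbdd hy₀)
  have hbefore : ∀ y ∈ massRange ν, b₂ < y → y < sInf K → y ∈ rightMNDI ν G b₂ := by
    intro y hy hby hlt
    by_contra hyI
    exact absurd (csInf_le hbdd ⟨hy, hby, hyI⟩) (not_le.2 hlt)
  -- Membership in `I₃` is a relatively open condition, so it would persist a little beyond the
  -- infimum of its complement. This also gives the failure of monotonicity past the frontier that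
  -- `start` demands.
  have hcI : sInf K ∉ rightMNDI ν G b₂ := by
    rintro ⟨-, -, δ, hδ, hm⟩
    have : b₂ + (sInf K - b₂ + δ) ≤ sInf K := by
      refine hge _ (by linarith) fun y hy => ?_
      refine ⟨hy.1, hy.2.1, sInf K + δ - y, by linarith [hy.2.2], ?_⟩
      rwa [show y + (sInf K + δ - y) = sInf K + δ by ring]
    linarith
  have hG₀ : ∀ y ∈ massRange ν, b₂ < y → G y = G₀ y :=
    fun y hy hby => h.eqOn y hy (h.mdi.le.trans hby.le)
  have hlow : ∀ y, b₂ ≤ y → y ≤ sInf K → y ∈ massRange ν :=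
    fun y h1 h2 => massRange_of_le hcS (hb₂.trans h1) h2
  refine ⟨sInf K, hc, hcS, ?_, ?_, Or.inr ⟨b₂, hb₂, hc, ?_, ?_⟩⟩
  · refine h.monotoneOn_pooled.mono fun y hy => ?_
    have hyS := massRange_of_le hcS hy.1 hy.2.le
    rcases le_or_gt y b₂ with h1 | h1
    · exact ⟨hyS, Or.inl h1⟩
    · exact ⟨hyS, Or.inr (hbefore y hyS h1 hy.2)⟩
  · intro y hy hcy
    have hby := hc.trans_le hcy
    rw [h.pooled_beyond hby fun hyI => hcI (rightMNDI_low hb₂ hyI hc hcy), hG₀ y hy hby]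
  · intro x hx y hy hxy
    have hxS := hlow x hx.1.le hx.2.le
    have hyS := hlow y hy.1.le hy.2.le
    rw [← hG₀ x hxS hx.1, ← hG₀ y hyS hy.1]
    exact monotoneOn_rightMNDI (hbefore x hxS hx.1 hx.2) (hbefore y hyS hy.1 hy.2) hxy
  · intro w hw hm
    refine hcI ⟨hcS, hc, w - sInf K, by linarith, ?_⟩
    rw [show sInf K + (w - sInf K) = w by ring]
    intro x hx y hy hxy
    rw [hG₀ x hx.1 hx.2.1, hG₀ y hy.1 hy.2.1]
    exact hm hx hy hxy

end InnerDescent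

/-! ### Pooling a descent up to the end of the mass range -/

/-- The data of a first descent `S ∩ [b, ∞)` that reaches the end of the mass range. -/
structure EndDescent (ν : Measure ℝ) (G₀ G : ℝ → ℝ) (b : ℝ) : Prop where
  null : ν (Iio 0) = 0
  start : IsPoolStart ν G₀
  inv : PoolInvariant ν G₀ G
  mdi : IsFirstMDIToEnd ν G b
  eqOn : ∀ y ∈ massRange ν, b ≤ y → G y = G₀ y

namespace EndDescent

variable {ν : Measure ℝ} [IsProbabilityMeasure ν] {G₀ G : ℝ → ℝ} {b : ℝ}

theorem pos_Ici (h : EndDescent ν G₀ G b) {v : ℝ} (hv : v ≤ b) : 0 < ν (Ici v) :=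
  h.mdi.mem.2.trans_le (measure_mono (Ici_subset_Ici.2 hv))

theorem condMeanToEnd_le (h : EndDescent ν G₀ G b) {v K : ℝ} (hv : v ≤ b)
    (hK : ∀ y ∈ massRange ν, G y ≤ K) : condMeanToEnd ν G v ≤ K := by
  refine setAverage_le h.inv.integrable (h.pos_Ici hv) (integral_nonpos_of_ae ?_)
  filter_upwards [ae_restrict_of_ae (ae_mem_massRange h.null)] with y hy
  have := hK y hy
  simp only [Pi.zero_apply]
  linarith

theorem le_b (h : EndDescent ν G₀ G b) {K : ℝ} (hK : ∀ y ∈ Icc 0 b, G y ≤ K) :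
    ∀ y ∈ massRange ν, G y ≤ K := by
  intro y hy
  rcases le_or_gt y b with h1 | h1
  · exact hK y ⟨hy.1, h1⟩
  · exact (h.mdi.anti.antitoneOn ⟨h.mdi.mem, le_refl b⟩ ⟨hy, h1.le⟩ h1.le).trans
      (hK b ⟨h.mdi.mem.1, le_rfl⟩)

theorem bddAbove (h : EndDescent ν G₀ G b) :
    BddAbove (range fun v : Icc (0 : ℝ) b => condMeanToEnd ν G v) := by
  refine ⟨b, ?_⟩
  rintro _ ⟨v, rfl⟩
  exact h.condMeanToEnd_le v.2.2 (h.le_b fun y hy =>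
    (h.inv.le_id h.null (massRange_of_le h.mdi.mem hy.1 hy.2)).trans hy.2)

theorem le_maxValueToEnd (h : EndDescent ν G₀ G b) {v : ℝ} (hv : v ∈ Icc 0 b) :
    condMeanToEnd ν G v ≤ maxValueToEnd ν G b :=
  le_ciSup h.bddAbove ⟨v, hv⟩

theorem maxValueToEnd_le (h : EndDescent ν G₀ G b) {K : ℝ}
    (hK : ∀ v ∈ Icc 0 b, condMeanToEnd ν G v ≤ K) : maxValueToEnd ν G b ≤ K := by
  have : Nonempty (Icc (0 : ℝ) b) := ⟨⟨0, le_rfl, h.mdi.mem.1⟩⟩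
  exact ciSup_le fun v => hK v v.2

theorem maxValueToEnd_le_of_bound (h : EndDescent ν G₀ G b) {K : ℝ}
    (hK : ∀ y ∈ Icc 0 b, G y ≤ K) : maxValueToEnd ν G b ≤ K :=
  h.maxValueToEnd_le fun _ hv => h.condMeanToEnd_le hv.2 (h.le_b hK)

theorem maxValueToEnd_le_left (h : EndDescent ν G₀ G b) {x : ℝ} (hx : x ∈ Ico 0 b) :
    maxValueToEnd ν G b ≤ G x + (b - x) := by
  refine h.maxValueToEnd_le_of_bound fun y hy => ?_
  rcases lt_or_ge y x with hyx | hyx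
  · have := h.mdi.mono_left ⟨hy.1, hyx.trans hx.2⟩ hx hyx.le
    linarith [hx.2]
  · have := h.inv.sub (massRange_of_le h.mdi.mem hx.1 hx.2.le)
      (massRange_of_le h.mdi.mem hy.1 hy.2) hyx
    simp only at this
    linarith [hy.2]

theorem measurableSet_left (h : EndDescent ν G₀ G b) (t : ℝ) :
    MeasurableSet {v ∈ Ico 0 b | t < G v} := by
  refine OrdConnected.measurableSet ⟨fun x hx y hy z hz => ?_⟩
  have hz' : z ∈ Ico 0 b := ⟨hx.1.1.trans hz.1, hz.2.trans_lt hy.1.2⟩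
  exact ⟨hz', hx.2.trans_le (h.mdi.mono_left hx.1 hz' hz.1)⟩

theorem measurableSet_right : MeasurableSet (massRange ν ∩ Ici b) :=
  measurableSet_massRange.inter measurableSet_Ici

theorem setIntegral_Ici (h : EndDescent ν G₀ G b) {f : ℝ → ℝ} (hf : Integrable f ν) {v : ℝ}
    (hv : v ≤ b) :
    ∫ y in Ici v, f y ∂ν = (∫ y in Ico v b, f y ∂ν) + ∫ y in massRange ν ∩ Ici b, f y ∂ν := by
  have e : (massRange ν ∩ Ici b : Set ℝ) =ᵐ[ν] Ici b := by
    filter_upwards [ae_mem_massRange h.null] with y hy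
    exact propext ⟨fun h => h.2, fun h => ⟨hy, h⟩⟩
  rw [setIntegral_congr_set e, ← Ico_union_Ici_eq_Ici hv, setIntegral_union
    (disjoint_left.2 fun x hx hx' => absurd hx.2 (not_lt.2 (mem_Ici.1 hx'))) measurableSet_Ici
    hf.integrableOn hf.integrableOn]

/-- Only the left end of the pool is optimized. A positive integral would give, for some `v`, a mean
above the supremum; a negative one would keep all means below it by a fixed amount. -/
theorem setIntegral_sub_maxValueToEnd (h : EndDescent ν G₀ G b) :
    ∫ y in pooledIntervalToEnd ν G b (maxValueToEnd ν G b), (G y - maxValueToEnd ν G b) ∂ν = 0 := by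
  set T := maxValueToEnd ν G b with hT
  have hf : Integrable (fun y => G y - T) ν := h.inv.integrable.sub (integrable_const _)
  set L := {v ∈ Ico 0 b | T < G v} with hL
  have hLm : MeasurableSet L := h.measurableSet_left T
  rw [pooledIntervalToEnd, setIntegral_union
    (disjoint_left.2 fun x hx hx' => absurd hx.1.2 (not_lt.2 hx'.2)) measurableSet_right
    hf.integrableOn hf.integrableOn]
  have hmax : ∀ v ∈ Icc 0 b, ∫ y in Ico v b, (G y - T) ∂ν ≤ ∫ y in L, (G y - T) ∂ν := by
    intro v hv
    have e := integral_inter_add_sdiff (s := Ico v b) (t := L) hLm hf.integrableOn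
    have e1 : ∫ y in Ico v b \ L, (G y - T) ∂ν ≤ 0 := by
      refine setIntegral_nonpos (measurableSet_Ico.diff hLm) fun y hy => ?_
      have hy0 : y ∈ Ico 0 b := ⟨hv.1.trans hy.1.1, hy.1.2⟩
      have : ¬ T < G y := fun hlt => hy.2 ⟨hy0, hlt⟩
      linarith
    have e2 : ∫ y in Ico v b ∩ L, (G y - T) ∂ν ≤ ∫ y in L, (G y - T) ∂ν := by
      refine setIntegral_mono_set hf.integrableOn ?_ inter_subset_right.eventuallyLE
      filter_upwards [ae_restrict_mem hLm] with y hy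
      have := hy.2
      simp only [Pi.zero_apply]
      linarith
    linarith
  refine le_antisymm ?_ ?_
  · by_contra hpos
    rw [not_le] at hpos
    set δ := (∫ y in L, (G y - T) ∂ν) + ∫ y in massRange ν ∩ Ici b, (G y - T) ∂ν with hδ
    obtain ⟨v, hv, hvL⟩ := exists_setIntegral_Ico_near hf h.mdi.mem.1 (s := L)
      (fun x hx => hx.1) (fun x hx y hxy hyb =>
        ⟨⟨hx.1.1.trans hxy, hyb⟩, hx.2.trans_le
          (h.mdi.mono_left hx.1 ⟨hx.1.1.trans hxy, hyb⟩ hxy)⟩) (half_pos hpos)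
    have hle : ⨍ y in Ici v, G y ∂ν ≤ T := h.le_maxValueToEnd hv
    have e := h.setIntegral_Ici hf hv.2
    have e1 := (abs_lt.1 hvL).1
    have hm := setAverage_sub_mul h.inv.integrable (h.pos_Ici hv.2) T
    have hm0 : 0 ≤ ν.real (Ici v) := measureReal_nonneg
    have := mul_nonpos_of_nonpos_of_nonneg (sub_nonpos.2 hle) hm0
    linarith
  · by_contra hneg
    rw [not_le] at hneg
    set δ := (∫ y in L, (G y - T) ∂ν) + ∫ y in massRange ν ∩ Ici b, (G y - T) ∂ν with hδ
    have hup : T ≤ T + δ / 2 := by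
      conv_lhs => rw [hT]
      refine h.maxValueToEnd_le fun v hv => ?_
      have e := h.setIntegral_Ici hf hv.2
      have e2 := hmax v hv
      have hm := setAverage_sub_mul h.inv.integrable (h.pos_Ici hv.2) T
      have hm1 : ν.real (Ici v) ≤ 1 := measureReal_le_one
      have hm0 : 0 ≤ ν.real (Ici v) := measureReal_nonneg
      change ⨍ y in Ici v, G y ∂ν ≤ T + δ / 2
      by_contra hlt
      rw [not_le] at hlt
      rcases hm0.eq_or_lt with h0 | h0
      · rw [← h0] at hm; linarith
      · nlinarith
    linarith

open Classical in
/-- The function after pooling a descent to the end. -/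
noncomputable def pooled (ν : Measure ℝ) (G : ℝ → ℝ) (b : ℝ) (y : ℝ) : ℝ :=
  if y ∈ pooledIntervalToEnd ν G b (maxValueToEnd ν G b) then maxValueToEnd ν G b else G y

theorem pooled_left {y : ℝ} (hy : y ∈ Ico 0 b) :
    pooled ν G b y = min (G y) (maxValueToEnd ν G b) := by
  by_cases hlt : maxValueToEnd ν G b < G y
  · have hP : y ∈ pooledIntervalToEnd ν G b (maxValueToEnd ν G b) := Or.inl ⟨hy, hlt⟩
    rw [pooled, if_pos hP, min_eq_right hlt.le]
  · rw [pooled, if_neg, min_eq_left (not_lt.1 hlt)]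
    rintro (h1 | h1)
    · exact hlt h1.2
    · exact absurd h1.2 (not_le.2 hy.2)

theorem pooled_right {y : ℝ} (hy : y ∈ massRange ν) (hb : b ≤ y) :
    pooled ν G b y = maxValueToEnd ν G b :=
  if_pos (Or.inr ⟨hy, hb⟩)

theorem monotoneOn_pooled (h : EndDescent ν G₀ G b) :
    MonotoneOn (pooled ν G b) (massRange ν) := by
  intro x hx y hy hxy
  rcases lt_or_ge y b with hyb | hyb
  · rw [pooled_left ⟨hx.1, hxy.trans_lt hyb⟩, pooled_left ⟨hy.1, hyb⟩]
    exact min_le_min_right _ (h.mdi.mono_left ⟨hx.1, hxy.trans_lt hyb⟩ ⟨hy.1, hyb⟩ hxy)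
  · rw [pooled_right hy hyb]
    rcases lt_or_ge x b with hxb | hxb
    · rw [pooled_left ⟨hx.1, hxb⟩]; exact min_le_right _ _
    · rw [pooled_right hx hxb]

theorem sub_pooled (h : EndDescent ν G₀ G b) :
    MonotoneOn (fun y => y - pooled ν G b y) (massRange ν) := by
  intro x hx y hy hxy
  simp only
  rcases lt_or_ge x b with hxb | hxb
  · rw [pooled_left ⟨hx.1, hxb⟩]
    rcases lt_or_ge y b with hyb | hyb
    · rw [pooled_left ⟨hy.1, hyb⟩]
      have h1 := h.inv.sub hx hy hxy
      simp only at h1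
      have h2 := min_le_left (G y) (maxValueToEnd ν G b)
      have h3 := min_le_right (G y) (maxValueToEnd ν G b)
      rcases min_choice (G x) (maxValueToEnd ν G b) with e | e <;> rw [e] <;> linarith
    · rw [pooled_right hy hyb]
      have h1 := h.maxValueToEnd_le_left ⟨hx.1, hxb⟩
      rcases min_choice (G x) (maxValueToEnd ν G b) with e | e <;> rw [e] <;> linarith
  · rw [pooled_right hx hxb, pooled_right hy (hxb.trans hxy)]
    linarith

theorem pooled_zero (h : EndDescent ν G₀ G b) : pooled ν G b 0 ≤ 0 := by
  rcases h.mdi.mem.1.eq_or_lt with h0 | h0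
  · subst h0
    rw [pooled_right h.mdi.mem le_rfl]
    refine (h.maxValueToEnd_le_of_bound (K := G 0) fun y hy => ?_).trans h.inv.zero
    rw [le_antisymm hy.2 hy.1]
  · rw [pooled_left ⟨le_rfl, h0⟩]
    exact (min_le_left _ _).trans h.inv.zero

theorem invariant_pooled (h : EndDescent ν G₀ G b) : PoolInvariant ν G₀ (pooled ν G b) := by
  refine h.inv.pool h.null h.start.memLp ((h.measurableSet_left _).union measurableSet_right)
    (b := b) (fun y hy => if_pos hy) (fun y hy => if_neg hy) ?_ h.eqOn
    h.setIntegral_sub_maxValueToEnd ?_ h.sub_pooled h.pooled_zero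
  · intro y hy hyb
    refine ⟨?_, fun hlt => Or.inl ⟨⟨hy.1, hyb⟩, hlt⟩⟩
    rintro (h1 | h1)
    · exact h1.2
    · exact absurd h1.2 (not_le.2 hyb)
  · intro x hx y hy hxy hlt
    rcases hx with h2 | h2
    · exact h2.2.le
    · rcases hy with h1 | h1
      · exact absurd (h2.2.trans hxy) (not_le.2 h1.1.2)
      · exact hlt.le.trans (h.mdi.anti.antitoneOn h2 h1 hxy)

end EndDescent

/-! ### The pooling procedure: determinism, invariants, termination -/

section Determinism

variable {ν : Measure ℝ} {G : ℝ → ℝ}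

theorem StartsFirstDescent.le {b b' : ℝ} (h : StartsFirstDescent ν G b)
    (h' : StartsFirstDescent ν G b') : b' ≤ b := by
  by_contra hlt
  rw [not_le] at hlt
  refine h.descent (b' - b) (by linarith) fun x hx y hy hxy => ?_
  exact h'.mono_left ⟨hx.1.1, by linarith [hx.2.2]⟩ ⟨hy.1.1, by linarith [hy.2.2]⟩ hxy

theorem not_monotoneOn_and_strictAntiOn {S T : Set ℝ} {x y : ℝ} (hS : MonotoneOn G S)
    (hT : StrictAntiOn G T) (hxy : x < y) (hx : x ∈ S ∩ T) (hy : y ∈ S ∩ T) : False :=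
  absurd (hS hx.1 hy.1 hxy.le) (not_le.2 (hT hx.2 hy.2 hxy))

/-- Immediately to the right of `b₂` the function would be both non-decreasing and strictly
decreasing. This makes the right end unique and the two kinds of steps exclusive. -/
theorem IsFirstMDI.not_strictAntiOn {b₁ b₂ z : ℝ} (h : IsFirstMDI ν G b₁ b₂)
    (hz : z ∈ massRange ν) (hbz : b₂ < z) : ¬ StrictAntiOn G (Icc b₁ z) := by
  intro hanti
  obtain ⟨ε, hε, hm⟩ := h.mono_right
  have hb := h.le
  have hb0 := h.mem.1
  set d := min ε (z - b₂) with hd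
  have hd0 : 0 < d := lt_min hε (by linarith)
  have hd1 : d ≤ ε := min_le_left _ _
  have hd2 : d ≤ z - b₂ := min_le_right _ _
  -- Any two distinct points of `(b₂, b₂ + d)` serve.
  refine not_monotoneOn_and_strictAntiOn hm hanti (x := b₂ + d / 3) (y := b₂ + d / 2)
    (by linarith) ?_ ?_
  · exact ⟨⟨massRange_of_le hz (by linarith) (by linarith), by linarith, by linarith⟩,
      by linarith, by linarith⟩
  · exact ⟨⟨massRange_of_le hz (by linarith) (by linarith), by linarith, by linarith⟩,
      by linarith, by linarith⟩

theorem IsFirstMDI.mem_right {b₁ b₂ : ℝ} (h : IsFirstMDI ν G b₁ b₂) : b₂ ∈ massRange ν :=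
  ⟨h.mem.1.trans h.le, h.mass_right.trans_le (measure_mono Ioi_subset_Ici_self)⟩

theorem IsFirstMDI.right_unique {b₁ b₂ b₂' : ℝ} (h : IsFirstMDI ν G b₁ b₂)
    (h' : IsFirstMDI ν G b₁ b₂') : b₂ = b₂' := by
  rcases lt_trichotomy b₂ b₂' with hlt | heq | hlt
  · exact absurd h'.anti (h.not_strictAntiOn h'.mem_right hlt)
  · exact heq
  · exact absurd h.anti (h'.not_strictAntiOn h.mem_right hlt)

theorem IsFirstMDI.not_toEnd [IsProbabilityMeasure ν] (hν : ν (Iio 0) = 0) {b₁ b₂ : ℝ}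
    (h : IsFirstMDI ν G b₁ b₂) (h' : IsFirstMDIToEnd ν G b₁) : False := by
  obtain ⟨z, hz, hbz⟩ := exists_mem_massRange_gt hν h.mass_right
  refine h.not_strictAntiOn hz hbz (h'.anti.mono fun y hy => ?_)
  exact ⟨massRange_of_le hz (h.mem.1.trans hy.1) hy.2, hy.1⟩

theorem PoolStep.unique [IsProbabilityMeasure ν] (hν : ν (Iio 0) = 0) {G₁ G₂ : ℝ → ℝ}
    (h₁ : PoolStep ν G G₁) (h₂ : PoolStep ν G G₂) : G₁ = G₂ := by
  cases h₁ with
  | inner b₁ b₂ h =>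
    cases h₂ with
    | inner b₁' b₂' h' =>
      obtain rfl := le_antisymm (h'.toStartsFirstDescent.le h.toStartsFirstDescent)
        (h.toStartsFirstDescent.le h'.toStartsFirstDescent)
      obtain rfl := h.right_unique h'
      rfl
    | toEnd b₁' h' =>
      obtain rfl := le_antisymm (h'.toStartsFirstDescent.le h.toStartsFirstDescent)
        (h.toStartsFirstDescent.le h'.toStartsFirstDescent)
      exact (h.not_toEnd hν h').elim
  | toEnd b₁ h =>
    cases h₂ with
    | inner b₁' b₂' h' =>
      obtain rfl := le_antisymm (h'.toStartsFirstDescent.le h.toStartsFirstDescent)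
        (h.toStartsFirstDescent.le h'.toStartsFirstDescent)
      exact (h'.not_toEnd hν h).elim
    | toEnd b₁' h' =>
      obtain rfl := le_antisymm (h'.toStartsFirstDescent.le h.toStartsFirstDescent)
        (h.toStartsFirstDescent.le h'.toStartsFirstDescent)
      rfl

theorem StartsFirstDescent.not_monotoneOn {b : ℝ} (h : StartsFirstDescent ν G b) :
    ¬ MonotoneOn G (massRange ν) :=
  fun hm => h.descent 1 one_pos (hm.mono inter_subset_left)

theorem PoolStep.not_monotoneOn {G' : ℝ → ℝ} (h : PoolStep ν G G') :
    ¬ MonotoneOn G (massRange ν) := by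
  cases h with
  | inner _ _ h => exact h.not_monotoneOn
  | toEnd _ h => exact h.not_monotoneOn

/-- The pooling procedure has at most one output. -/
theorem poolOutput_unique [IsProbabilityMeasure ν] (hν : ν (Iio 0) = 0) {G₁ G₂ : ℝ → ℝ}
    (h₁ : Relation.ReflTransGen (PoolStep ν) G G₁) (hm₁ : MonotoneOn G₁ (massRange ν))
    (h₂ : Relation.ReflTransGen (PoolStep ν) G G₂) (hm₂ : MonotoneOn G₂ (massRange ν)) :
    G₁ = G₂ := by
  induction h₁ using Relation.ReflTransGen.head_induction_on with
  | refl =>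
    rcases h₂.cases_head with h | ⟨_, h, _⟩
    · exact h
    · exact absurd hm₁ h.not_monotoneOn
  | head h _ ih =>
    rcases h₂.cases_head with h' | ⟨_, h', hr⟩
    · subst h'
      exact absurd hm₂ h.not_monotoneOn
    · obtain rfl := h.unique hν h'
      exact ih hr

end Determinism

/-! ### Invariance under a step, existence of steps and termination -/

section Progress

variable {ν : Measure ℝ} [IsProbabilityMeasure ν] {G₀ G : ℝ → ℝ}

/-- The frontier lies at or before the descent, so `G` still equals `G₀` from `b₁` on. It also
ensures mass on every `[b₁, w]`, so that the conditional means are not averages over null sets.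
After an interior step it has passed `b₂`. -/
theorem PoolStep.invariant (hν : ν (Iio 0) = 0) (h₀ : IsPoolStart ν G₀)
    (h : PoolInvariant ν G₀ G) {c : ℝ} (hc : PoolFrontier ν G₀ G c) {G' : ℝ → ℝ}
    (hs : PoolStep ν G G') :
    PoolInvariant ν G₀ G' ∧
      (MonotoneOn G' (massRange ν) ∨ ∃ c', c < c' ∧ PoolFrontier ν G₀ G' c') := by
  cases hs with
  | inner b₁ b₂ hb =>
    have hcb := hc.le_of_descent hb.toStartsFirstDescent
    have hd : InnerDescent ν G₀ G b₁ b₂ := ⟨hν, h₀, h, hb, fun y hy hby => hc.eqOn y hy (hcb.trans hby),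
      fun w hw => hc.measure_Icc_pos h₀ hb.toStartsFirstDescent hw⟩
    refine ⟨hd.invariant_pooled, hd.progress_pooled.imp id ?_⟩
    rintro ⟨c', hc', hf⟩
    exact ⟨c', (hcb.trans hb.le).trans_lt hc', hf⟩
  | toEnd b hb =>
    have hcb := hc.le_of_descent hb.toStartsFirstDescent
    have hd : EndDescent ν G₀ G b := ⟨hν, h₀, h, hb, fun y hy hby => hc.eqOn y hy (hcb.trans hby)⟩
    exact ⟨hd.invariant_pooled, Or.inl hd.monotoneOn_pooled⟩

theorem poolInvariant_of_reflTransGen (hν : ν (Iio 0) = 0) (h₀ : IsPoolStart ν G₀)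
    (h : Relation.ReflTransGen (PoolStep ν) G₀ G) :
    PoolInvariant ν G₀ G ∧ (MonotoneOn G (massRange ν) ∨ ∃ c, PoolFrontier ν G₀ G c) := by
  induction h with
  | refl => exact ⟨h₀.invariant, Or.inr ⟨0, IsPoolStart.frontier hν⟩⟩
  | tail _ hs ih =>
    obtain ⟨hi, hm | ⟨c, hc⟩⟩ := ih
    · exact absurd hm hs.not_monotoneOn
    · obtain ⟨hi', hp⟩ := hs.invariant hν h₀ hi hc
      exact ⟨hi', hp.imp id fun ⟨c', _, h⟩ => ⟨c', h⟩⟩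

/-- A function that is not non-decreasing has a first descent. -/
theorem exists_startsFirstDescent (hν : ν (Iio 0) = 0) (hG : ¬ MonotoneOn G (massRange ν)) :
    ∃ b, StartsFirstDescent ν G b := by
  -- The descent starts at `sSup B`: monotonicity on a neighbourhood of that point could be glued to
  -- the monotonicity before it and would yield a larger element of `B`.
  set B := {b ∈ massRange ν | MonotoneOn G (Ico 0 b)} with hB
  have h0 : (0 : ℝ) ∈ B := ⟨zero_mem_massRange hν, by simp [MonotoneOn]⟩
  have hbdd : BddAbove B := by
    by_contra hn
    rw [not_bddAbove_iff] at hn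
    refine hG fun x hx y hy hxy => ?_
    obtain ⟨b, hb, hyb⟩ := hn y
    exact hb.2 ⟨hx.1, hxy.trans_lt hyb⟩ ⟨hy.1, hyb⟩ hxy
  have hmono : MonotoneOn G (Ico 0 (sSup B)) := by
    intro x hx y hy hxy
    obtain ⟨b, hb, hyb⟩ := exists_lt_of_lt_csSup ⟨0, h0⟩ hy.2
    exact hb.2 ⟨hx.1, hxy.trans_lt hyb⟩ ⟨hy.1, hyb⟩ hxy
  have hs0 : 0 ≤ sSup B := le_csSup hbdd h0
  have hS : sSup B ∈ massRange ν := by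
    by_contra hn
    refine hG (hmono.mono fun y hy => ⟨hy.1, ?_⟩)
    by_contra hlt
    exact hn (massRange_of_le hy hs0 (not_lt.1 hlt))
  refine ⟨sSup B, hS, hmono, fun ε hε hm => ?_⟩
  have hglue := monotoneOn_glue massRange_subset_Ici ordConnected_massRange hS hmono
    (sub_lt_self _ hε) hm
  refine hG (hglue.mono fun y hy => ⟨hy, ?_⟩)
  by_contra hlt
  rw [mem_Iio, not_lt] at hlt
  have hz : sSup B + ε / 2 ∈ B := by
    refine ⟨massRange_of_le hy (by linarith) (by linarith), hglue.mono fun x hx => ?_⟩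
    exact ⟨massRange_of_le hy hx.1 (by linarith [hx.2]), by simp only [mem_Iio]; linarith [hx.2]⟩
  linarith [le_csSup hbdd hz]

/-- Points near, and to the right of, a given point avoid a finite set. -/
theorem exists_Ioo_disjoint_right (A : Finset ℝ) (b : ℝ) :
    ∃ ε > 0, Disjoint (Ioo b (b + ε)) (A : Set ℝ) := by
  have h : ∀ᶠ x in 𝓝[>] b, x ∉ (A : Set ℝ) := by
    have h1 : ((A : Set ℝ) \ {b})ᶜ ∈ 𝓝 b :=
      (A.finite_toSet.subset sdiff_subset).isClosed.isOpen_compl.mem_nhds (by simp)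
    filter_upwards [mem_nhdsWithin_of_mem_nhds h1, self_mem_nhdsWithin] with x hx hbx hxA
    exact hx ⟨hxA, (ne_of_gt hbx)⟩
  obtain ⟨u, hu, hsub⟩ := mem_nhdsGT_iff_exists_Ioo_subset.1 h
  refine ⟨u - b, sub_pos.2 hu, disjoint_left.2 fun x hx hxA => ?_⟩
  exact hsub (by rwa [add_sub_cancel] at hx) hxA

/-- If `G₀` has finitely many monotonicity intervals then a pooling step is possible as long as the
function is not non-decreasing. -/
theorem PoolFrontier.exists_poolStep (hν : ν (Iio 0) = 0) (hfin : HasFinitelyManyMDIs ν G₀)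
    (h : PoolInvariant ν G₀ G) {c : ℝ} (hc : PoolFrontier ν G₀ G c)
    (hG : ¬ MonotoneOn G (massRange ν)) : ∃ G', PoolStep ν G G' := by
  obtain ⟨b₁, hb⟩ := exists_startsFirstDescent hν hG
  have hcb := hc.le_of_descent hb
  by_cases hend : StrictAntiOn G (massRange ν ∩ Ici b₁)
  · exact ⟨_, PoolStep.toEnd b₁ ⟨hb, hend⟩⟩
  -- The right end `b₂` of the descent will be the supremum of `E`. It is finite and in the mass
  -- range, because otherwise the descent would reach the end.
  set E := {b ∈ massRange ν | b₁ ≤ b ∧ StrictAntiOn G (Icc b₁ b)} with hE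
  have hE0 : b₁ ∈ E := ⟨hb.mem, le_rfl, by simp⟩
  have hbdd : BddAbove E := by
    by_contra hn
    rw [not_bddAbove_iff] at hn
    refine hend fun x hx y hy hxy => ?_
    obtain ⟨b, hb, hyb⟩ := hn y
    exact hb.2.2 ⟨hx.2, hxy.le.trans hyb.le⟩ ⟨hy.2, hyb.le⟩ hxy
  set b₂ := sSup E with hb₂
  have hle : b₁ ≤ b₂ := le_csSup hbdd hE0
  have hlt : ∀ y, y < b₂ → StrictAntiOn G (Icc b₁ y) := by
    intro y hy
    obtain ⟨b, hb, hyb⟩ := exists_lt_of_lt_csSup ⟨b₁, hE0⟩ hy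
    exact hb.2.2.mono (Icc_subset_Icc_right hyb.le)
  have hS : b₂ ∈ massRange ν := by
    by_contra hn
    refine hend fun x hx y hy hxy => ?_
    have hyb : y < b₂ := by
      by_contra hge
      exact hn (massRange_of_le hy.1 (hb.mem.1.trans hle) (not_lt.1 hge))
    exact hlt y hyb ⟨hx.2, hxy.le⟩ ⟨hy.2, le_rfl⟩ hxy
  -- `G` has no upward jumps, so that strict decrease extends to the closure from the left
  have hjump : ∀ x y z, x < y → x ∈ massRange ν → z ∈ massRange ν → y ≤ z →
      (∀ w, x < w → w < y → G w ≤ G x) → G y ≤ G x := by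
    intro x y z hxy hx hz hyz hw
    refine le_of_forall_pos_le_add fun δ hδ => ?_
    set w := max ((x + y) / 2) (y - δ) with hwdef
    have hxw : x < w := (by linarith : x < (x + y) / 2).trans_le (le_max_left _ _)
    have hwy : w < y := max_lt (by linarith) (by linarith)
    have h1 := h.sub (massRange_of_le hz (hx.1.trans hxw.le) (hwy.le.trans hyz))
      (massRange_of_le hz (hx.1.trans hxy.le) hyz) hwy.le
    have h2 := hw w hxw hwy
    have h3 : y - δ ≤ w := le_max_right _ _
    simp only at h1
    linarith
  have hanti : StrictAntiOn G (Icc b₁ b₂) := by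
    intro x hx y hy hxy
    rcases hy.2.lt_or_eq with hyb | hyb
    · exact hlt y hyb ⟨hx.1, hxy.le⟩ ⟨hy.1, le_rfl⟩ hxy
    · have hm : (x + y) / 2 < b₂ := by linarith
      have hxS : x ∈ massRange ν := massRange_of_le hS (hb.mem.1.trans hx.1) hx.2
      have h1 : G ((x + y) / 2) < G x :=
        hlt _ hm ⟨hx.1, by linarith⟩ ⟨by linarith [hx.1], le_rfl⟩ (by linarith)
      refine lt_of_le_of_lt ?_ h1
      refine hjump ((x + y) / 2) y b₂ (by linarith)
        (massRange_of_le hS (by linarith [hxS.1]) hm.le) hS hy.2 fun w h2 h3 => ?_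
      exact (hlt w (h3.trans_le hy.2) ⟨by linarith [hx.1], h2.le⟩
        ⟨by linarith [hx.1], le_rfl⟩ h2).le
  by_cases hmass : 0 < ν (Ioi b₂)
  · obtain ⟨A, hA⟩ := hfin
    obtain ⟨ε, hε, hdis⟩ := exists_Ioo_disjoint_right A b₂
    refine ⟨_, PoolStep.inner b₁ b₂ ⟨hb, hle, hmass, hanti, ε, hε, ?_⟩⟩
    have hG₀ : ∀ y ∈ massRange ν ∩ Ioo b₂ (b₂ + ε), G y = G₀ y :=
      fun y hy => hc.eqOn y hy.1 ((hcb.trans hle).trans hy.2.1.le)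
    rcases hA (massRange ν ∩ Ioo b₂ (b₂ + ε)) inter_subset_left
      (ordConnected_massRange.inter ordConnected_Ioo)
      (hdis.mono_left inter_subset_right) with hm | hm
    · intro x hx y hy hxy
      rw [hG₀ x hx, hG₀ y hy]
      exact hm hx hy hxy
    -- If `G₀` were strictly decreasing just after `b₂`, the slope bound would exclude an upward
    -- jump at `b₂`, and the descent would extend beyond the supremum of `E`.
    · exfalso
      obtain ⟨z, hz, hbz⟩ := exists_mem_massRange_gt hν hmass
      set w := min z (b₂ + ε / 2) with hw
      have hw1 : b₂ < w := lt_min hbz (by linarith)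
      have hw2 : w ≤ z := min_le_left _ _
      have hw3 : w ≤ b₂ + ε / 2 := min_le_right _ _
      have hmem : ∀ y, b₂ < y → y ≤ w → y ∈ massRange ν ∩ Ioo b₂ (b₂ + ε) := fun y h1 h2 =>
        ⟨massRange_of_le hz (hS.1.trans h1.le) (h2.trans hw2), h1, by linarith⟩
      have hG : StrictAntiOn G (Ioc b₂ w) := by
        intro x hx y hy hxy
        rw [hG₀ x (hmem x hx.1 hx.2), hG₀ y (hmem y hy.1 hy.2)]
        exact hm (hmem x hx.1 hx.2) (hmem y hy.1 hy.2) hxy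
      have hright : ∀ y ∈ Ioc b₂ w, G y < G b₂ := by
        intro y hy
        have hyS := (hmem y hy.1 hy.2).1
        have h1 := hG (a := (b₂ + y) / 2) ⟨by linarith [hy.1], by linarith [hy.1, hy.2]⟩ hy
          (by linarith [hy.1])
        refine h1.trans_le (le_of_forall_pos_le_add fun δ hδ => ?_)
        set v := min ((b₂ + y) / 2) (b₂ + δ) with hv
        have hv1 : b₂ < v := lt_min (by linarith [hy.1]) (by linarith)
        have hv2 : v ≤ (b₂ + y) / 2 := min_le_left _ _
        have hv3 : v ≤ b₂ + δ := min_le_right _ _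
        have h2 : G ((b₂ + y) / 2) ≤ G v := by
          refine hG.antitoneOn ⟨hv1, ?_⟩ ⟨by linarith [hy.1], ?_⟩ hv2 <;> linarith [hy.1, hy.2]
        have h3 := h.sub hS (hmem v hv1 (by linarith [hy.1, hy.2])).1 hv1.le
        simp only at h3
        linarith
      have : w ∈ E := by
        refine ⟨(hmem w hw1 le_rfl).1, hle.trans hw1.le, fun x hx y hy hxy => ?_⟩
        rcases le_or_gt y b₂ with hyb | hyb
        · exact hanti ⟨hx.1, hxy.le.trans hyb⟩ ⟨hy.1, hyb⟩ hxy
        rcases le_or_gt x b₂ with hxb | hxb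
        · exact (hright y ⟨hyb, hy.2⟩).trans_le
            (hanti.antitoneOn ⟨hx.1, hxb⟩ ⟨hle, le_rfl⟩ hxb)
        · exact hG ⟨hxb, hx.2⟩ ⟨hyb, hy.2⟩ hxy
      exact absurd (le_csSup hbdd this) (not_le.2 hw1)
  · exfalso
    -- Without mass beyond `b₂` the mass range ends at `b₂`, so this is a descent to the end.
    refine hend (hanti.mono fun y hy => ⟨hy.2, ?_⟩)
    by_contra hgt
    rw [not_le] at hgt
    exact hmass (hy.1.2.trans_le (measure_mono fun z hz => hgt.trans_le hz))

/-- The procedure terminates if `G₀` has finitely many monotonicity intervals. -/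
theorem exists_poolOutput (hν : ν (Iio 0) = 0) (h₀ : IsPoolStart ν G₀)
    (hfin : HasFinitelyManyMDIs ν G₀) :
    ∃ G, Relation.ReflTransGen (PoolStep ν) G₀ G ∧ MonotoneOn G (massRange ν) := by
  classical
  obtain ⟨A, hA⟩ := id hfin
  set A' := insert 0 A with hA'
  -- Away from `A`, the function `G₀` is either non-decreasing or strictly decreasing across `c`.
  -- The former contradicts that monotonicity stops at `c`, the latter that it holds just before
  -- `c`.
  have hstart : ∀ G c, PoolFrontier ν G₀ G c → c ∈ A' := by
    intro G c hc
    rcases hc.start with rfl | ⟨a, ha0, hac, hm, hn⟩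
    · exact Finset.mem_insert_self _ _
    · refine Finset.mem_insert_of_mem ?_
      by_contra hcA
      have hop : ((A : Set ℝ))ᶜ ∈ 𝓝 c :=
        A.finite_toSet.isClosed.isOpen_compl.mem_nhds (by simpa using hcA)
      obtain ⟨l, u, ⟨hlc, hcu⟩, hsub⟩ := mem_nhds_iff_exists_Ioo_subset.1 hop
      have hl : max a l < c := max_lt hac hlc
      rcases hA (massRange ν ∩ Ioo (max a l) u) inter_subset_left
        (ordConnected_massRange.inter ordConnected_Ioo)
        (disjoint_left.2 fun x hx hxA =>
          hsub ⟨(le_max_right a l).trans_lt hx.2.1, hx.2.2⟩ hxA) with h1 | h1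
      · refine hn u hcu fun x hx y hy hxy => ?_
        rcases lt_or_ge y c with hyc | hyc
        · exact hm ⟨hx.2.1, hxy.trans_lt hyc⟩ ⟨hy.2.1, hyc⟩ hxy
        rcases lt_or_ge (max a l) x with hx1 | hx1
        · exact h1 ⟨hx.1, hx1, hx.2.2⟩ ⟨hy.1, hl.trans_le hyc, hy.2.2⟩ hxy
        · set m := (max a l + c) / 2 with hmdef
          have hmS : m ∈ massRange ν :=
            massRange_of_le hc.mem (by linarith [le_max_left a l]) (by linarith)
          refine (hm (b := m) ⟨hx.2.1, by linarith⟩ ⟨by linarith [le_max_left a l],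
            by linarith⟩ (by linarith)).trans ?_
          exact h1 ⟨hmS, by linarith, by linarith⟩ ⟨hy.1, hl.trans_le hyc, hy.2.2⟩ (by linarith)
      · have hmem : ∀ x, max a l < x → x < c →
            x ∈ Ioo a c ∩ (massRange ν ∩ Ioo (max a l) u) := fun x h2 h3 =>
          ⟨⟨(le_max_left a l).trans_lt h2, h3⟩,
            massRange_of_le hc.mem (ha0.trans ((le_max_left a l).trans h2.le)) h3.le, h2,
            h3.trans hcu⟩
        exact not_monotoneOn_and_strictAntiOn hm h1
          (x := (2 * max a l + c) / 3) (y := (max a l + c) / 2) (by linarith)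
          (hmem _ (by linarith) (by linarith)) (hmem _ (by linarith) (by linarith))
  -- The induction is on the number of possible frontiers at or beyond the present one, which drops
  -- because the frontier itself is such a point and is passed.
  have main : ∀ n : ℕ, ∀ G c, PoolInvariant ν G₀ G → PoolFrontier ν G₀ G c →
      (A'.filter (c ≤ ·)).card = n →
      ∃ G', Relation.ReflTransGen (PoolStep ν) G G' ∧ MonotoneOn G' (massRange ν) := by
    intro n
    induction n using Nat.strong_induction_on with
    | _ n ih =>
      intro G c hG hc hn
      by_cases hm : MonotoneOn G (massRange ν)
      · exact ⟨G, .refl, hm⟩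
      obtain ⟨G₁, hs⟩ := hc.exists_poolStep hν hfin hG hm
      obtain ⟨hG₁, hm₁ | ⟨c', hcc, hc'⟩⟩ := hs.invariant hν h₀ hG hc
      · exact ⟨G₁, .single hs, hm₁⟩
      have hcard : (A'.filter (c' ≤ ·)).card < n := by
        rw [← hn]
        refine Finset.card_lt_card ⟨fun x hx => ?_, fun hsub => ?_⟩
        · simp only [Finset.mem_filter] at hx ⊢
          exact ⟨hx.1, hcc.le.trans hx.2⟩
        · have := hsub (Finset.mem_filter.2 ⟨hstart G c hc, le_rfl⟩)
          exact absurd (Finset.mem_filter.1 this).2 (not_le.2 hcc)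
      obtain ⟨G', hr, hm'⟩ := ih _ hcard G₁ c' hG₁ hc' rfl
      exact ⟨G', .head hs hr, hm'⟩
  exact main _ G₀ 0 h₀.invariant (IsPoolStart.frontier hν) rfl

end Progress

/-! ### Quantile functions -/

/-- Lebesgue measure on the unit interval. -/
noncomputable def unitMeasure : Measure ℝ := volume.restrict (Ioo 0 1)

instance : IsProbabilityMeasure unitMeasure := ⟨by simp [unitMeasure]⟩

theorem ae_unitMeasure_mem : ∀ᵐ u ∂unitMeasure, u ∈ Ioo (0 : ℝ) 1 :=
  ae_restrict_mem measurableSet_Ioo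

section Quantile

variable {μ : Measure ℝ} [IsProbabilityMeasure μ]

/-- Right continuity of the distribution function makes the infimum attained. The Galois connection
`quantile_le_iff` follows. -/
theorem le_cdf_quantile {u : ℝ} (hu : u ∈ Ioo 0 1) : u ≤ cdf μ (quantile μ u) := by
  have hne : {x | u ≤ cdf μ x}.Nonempty :=
    ((tendsto_cdf_atTop μ).eventually (eventually_ge_nhds hu.2)).exists
  rw [← (cdf μ).iInf_Ioi_eq]
  have : Nonempty (Ioi (quantile μ u)) := ⟨⟨quantile μ u + 1, by simp⟩⟩
  refine le_ciInf fun r => ?_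
  have hq : quantile μ u = sInf {x | u ≤ cdf μ x} := if_pos hu.1
  have hr : sInf {x | u ≤ cdf μ x} < r := hq.symm.trans_lt r.2
  obtain ⟨y, hy, hyr⟩ := exists_lt_of_csInf_lt hne hr
  exact le_trans hy (monotone_cdf μ hyr.le)

theorem quantile_le_iff {u x : ℝ} (hu : u ∈ Ioo 0 1) : quantile μ u ≤ x ↔ u ≤ cdf μ x := by
  refine ⟨fun h => (le_cdf_quantile hu).trans (monotone_cdf μ h), fun h => ?_⟩
  rw [quantile, if_pos hu.1]
  refine csInf_le ?_ h
  obtain ⟨y, hy⟩ := ((tendsto_cdf_atBot μ).eventually (eventually_lt_nhds hu.1)).exists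
  refine ⟨y, fun x hx => ?_⟩
  by_contra hlt
  exact absurd (monotone_cdf μ (not_le.1 hlt).le) (not_le.2 (hy.trans_le hx))

theorem lt_quantile_iff {u x : ℝ} (hu : u ∈ Ioo 0 1) : x < quantile μ u ↔ cdf μ x < u := by
  rw [← not_le, quantile_le_iff hu, not_le]

theorem monotoneOn_quantile : MonotoneOn (quantile μ) (Ioo 0 1) := by
  intro u hu v hv huv
  rw [quantile_le_iff hu]
  exact huv.trans (le_cdf_quantile hv)

theorem aemeasurable_quantile : AEMeasurable (quantile μ) unitMeasure :=
  aemeasurable_restrict_of_monotoneOn measurableSet_Ioo monotoneOn_quantile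

/-- The quantile function has law `μ` under Lebesgue measure on the unit interval. -/
theorem map_quantile : unitMeasure.map (quantile μ) = μ := by
  have : IsProbabilityMeasure (unitMeasure.map (quantile μ)) :=
    Measure.isProbabilityMeasure_map aemeasurable_quantile
  refine Measure.ext_of_Iic _ _ fun x => ?_
  rw [Measure.map_apply_of_aemeasurable aemeasurable_quantile measurableSet_Iic,
    ← ofReal_cdf μ x]
  have e : (quantile μ ⁻¹' Iic x : Set ℝ) =ᵐ[unitMeasure] Iic (cdf μ x) := by
    filter_upwards [ae_unitMeasure_mem] with u hu
    exact propext (quantile_le_iff hu)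
  rw [measure_congr e, unitMeasure, Measure.restrict_apply measurableSet_Iic]
  have h0 := cdf_nonneg μ x
  have h1 := cdf_le_one μ x
  have e2 : (Iic (cdf μ x) ∩ Ioo 0 1 : Set ℝ) =ᵐ[volume] Ioo 0 (cdf μ x) := by
    filter_upwards [compl_mem_ae_iff.2 (measure_singleton (μ := volume) (cdf μ x)),
      compl_mem_ae_iff.2 (measure_singleton (μ := volume) (1 : ℝ))] with u hu hu1
    refine propext ⟨fun h => ⟨h.2.1, lt_of_le_of_ne h.1 hu⟩, fun h => ⟨h.2.le, h.1, ?_⟩⟩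
    exact h.2.trans_le h1
  rw [measure_congr e2, Real.volume_Ioo, sub_zero]

theorem integral_comp_quantile {f : ℝ → ℝ} (hf : AEStronglyMeasurable f μ) :
    ∫ u, f (quantile μ u) ∂unitMeasure = ∫ x, f x ∂μ := by
  conv_rhs => rw [← map_quantile (μ := μ)]
  rw [integral_map aemeasurable_quantile (by rwa [map_quantile])]

theorem memLp_comp_quantile {f : ℝ → ℝ} (hf : MemLp f 2 μ) :
    MemLp (fun u => f (quantile μ u)) 2 unitMeasure := by
  have h : MemLp f 2 (unitMeasure.map (quantile μ)) := by rwa [map_quantile]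
  exact h.comp_of_map aemeasurable_quantile

theorem memLp_id_of_integrable_sq (h : Integrable (fun t : ℝ => t ^ 2) μ) :
    MemLp (fun t : ℝ => t) 2 μ :=
  (memLp_two_iff_integrable_sq aestronglyMeasurable_id).2 h

theorem memLp_quantile (h : Integrable (fun t : ℝ => t ^ 2) μ) :
    MemLp (quantile μ) 2 unitMeasure :=
  memLp_comp_quantile (memLp_id_of_integrable_sq h)

end Quantile

/-! ### Quantile functions of laws on the half line, including level zero -/

section NonnegQuantile

variable {μ : Measure ℝ} [IsProbabilityMeasure μ]

theorem cdf_eq_zero_of_neg (h : μ (Iio 0) = 0) {x : ℝ} (hx : x < 0) : cdf μ x = 0 := by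
  rw [cdf_eq_real, measureReal_def, measure_mono_null (Iic_subset_Iio.2 hx) h]
  rfl

theorem quantile_zero_nonneg (h : μ (Iio 0) = 0) : 0 ≤ quantile μ 0 := by
  rw [quantile, if_neg (lt_irrefl _)]
  refine Real.sInf_nonneg fun x hx => ?_
  by_contra hlt
  exact hx.ne' (cdf_eq_zero_of_neg h (not_le.1 hlt))

/-- Level `0` occurs as `cdf ν y` to the left of the mass of `ν`; the convention for `quantile` at
`0` and the support in `[0, ∞)` keep monotonicity there. -/
theorem monotoneOn_quantile_Ico (h : μ (Iio 0) = 0) : MonotoneOn (quantile μ) (Ico 0 1) := by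
  intro u hu v hv huv
  rcases hu.1.eq_or_lt with rfl | hu0
  · rcases huv.eq_or_lt with rfl | hv0
    · exact le_rfl
    · have h1 := (le_cdf_quantile (μ := μ) ⟨hv0, hv.2⟩)
      conv_lhs => rw [quantile, if_neg (lt_irrefl _)]
      refine csInf_le ⟨0, fun x hx => ?_⟩ (hv0.trans_le h1)
      by_contra hlt
      exact ne_of_gt hx (cdf_eq_zero_of_neg h (not_le.1 hlt))
  · exact monotoneOn_quantile ⟨hu0, hu.2⟩ ⟨hu0.trans_le huv, hv.2⟩ huv

end NonnegQuantile

/-! ### The function `λ(y)` -/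

/-! ### Jumps and left limits of the distribution function -/

section Cdf

variable {ν : Measure ℝ} [IsProbabilityMeasure ν]

theorem measure_singleton_eq_ofReal_jump (y : ℝ) :
    ν {y} = ENNReal.ofReal (cdf ν y - Function.leftLim (cdf ν) y) := by
  conv_lhs => rw [← measure_cdf ν]
  exact StieltjesFunction.measure_singleton _ _

theorem leftLim_le_cdf (y : ℝ) : Function.leftLim (cdf ν) y ≤ cdf ν y :=
  (monotone_cdf ν).leftLim_le le_rfl

theorem measure_singleton_eq_zero_iff (y : ℝ) :
    ν {y} = 0 ↔ Function.leftLim (cdf ν) y = cdf ν y := by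
  rw [measure_singleton_eq_ofReal_jump, ENNReal.ofReal_eq_zero, sub_nonpos]
  exact ⟨fun h => le_antisymm (leftLim_le_cdf y) h, fun h => h.ge⟩

theorem leftLim_cdf_lt_cdf {y : ℝ} (h : ν {y} ≠ 0) : Function.leftLim (cdf ν) y < cdf ν y :=
  lt_of_le_of_ne (leftLim_le_cdf y) fun e => h ((measure_singleton_eq_zero_iff y).2 e)

theorem cdf_le_leftLim {x y : ℝ} (h : x < y) : cdf ν x ≤ Function.leftLim (cdf ν) y :=
  (monotone_cdf ν).le_leftLim h

theorem leftLim_cdf_nonneg (y : ℝ) : 0 ≤ Function.leftLim (cdf ν) y :=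
  (cdf_nonneg ν (y - 1)).trans (cdf_le_leftLim (sub_one_lt y))

/-- On the mass range, bounds on `λ` can thus be taken at levels below `1`; at level `1` the set
defining the quantile may be empty. -/
theorem leftLim_cdf_lt_one {y : ℝ} (hy : y ∈ massRange ν) : Function.leftLim (cdf ν) y < 1 := by
  have h1 : ν.real (Iio y) < 1 := by
    have e : ν.real (Iio y) + ν.real (Ici y) = 1 := by
      rw [← compl_Iio]; exact probReal_add_probReal_compl measurableSet_Iio
    have : 0 < ν.real (Ici y) := ENNReal.toReal_pos hy.2.ne' (measure_ne_top _ _)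
    linarith
  refine lt_of_le_of_lt ?_ h1
  refine le_of_tendsto ((monotone_cdf ν).tendsto_leftLim y) ?_
  filter_upwards [self_mem_nhdsWithin] with x hx
  rw [cdf_eq_real]
  exact measureReal_mono fun z (hz : z ≤ x) => lt_of_le_of_lt hz hx

theorem leftLim_cdf_le_of_le_quantile {u : ℝ} (hu : u ∈ Ioo 0 1) {y : ℝ} (h : y ≤ quantile ν u) :
    Function.leftLim (cdf ν) y ≤ u := by
  refine le_of_tendsto ((monotone_cdf ν).tendsto_leftLim y) ?_
  filter_upwards [self_mem_nhdsWithin] with x hx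
  exact ((lt_quantile_iff hu).1 (lt_of_lt_of_le hx h)).le

theorem le_quantile_of_leftLim_cdf_lt {u : ℝ} (hu : u ∈ Ioo 0 1) {y : ℝ}
    (h : Function.leftLim (cdf ν) y < u) : y ≤ quantile ν u := by
  by_contra hlt
  exact absurd ((le_cdf_quantile hu).trans (cdf_le_leftLim (not_le.1 hlt))) (not_le.2 h)

end Cdf

section LamFun

variable {ν μl : Measure ℝ} [IsProbabilityMeasure ν] [IsProbabilityMeasure μl]

theorem lamFun_of_null {y : ℝ} (h : ν {y} = 0) : lamFun ν μl y = quantile μl (cdf ν y) :=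
  if_pos h

theorem lamFun_of_atom {y : ℝ} (h : ν {y} ≠ 0) :
    lamFun ν μl y = (∫ u in (Function.leftLim (cdf ν) y)..(cdf ν y), quantile μl u) /
      (cdf ν y - Function.leftLim (cdf ν) y) :=
  if_neg h

theorem integrableOn_quantile (hl : Integrable (fun t : ℝ => t ^ 2) μl) :
    IntegrableOn (quantile μl) (Ioo 0 1) :=
  (memLp_quantile hl).integrable (by norm_num)

theorem intervalIntegrable_quantile (hl : Integrable (fun t : ℝ => t ^ 2) μl) {a b : ℝ}
    (ha : 0 ≤ a) (hab : a ≤ b) (hb : b ≤ 1) : IntervalIntegrable (quantile μl) volume a b := by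
  rw [intervalIntegrable_iff_integrableOn_Ioo_of_le hab]
  exact (integrableOn_quantile hl).mono_set (Ioo_subset_Ioo ha hb)

/-- `λ(y)` is a value or an average of the quantile function over levels between `F(y⁻)` and `F(y)`.
With the matching upper bound `lamFun_le_quantile` this makes `λ` monotone. -/
theorem quantile_le_lamFun (hl : Integrable (fun t : ℝ => t ^ 2) μl) (hl0 : μl (Iio 0) = 0) {y : ℝ}
    (hy : y ∈ massRange ν) {u : ℝ} (hu0 : 0 ≤ u) (hu : u ≤ Function.leftLim (cdf ν) y) :
    quantile μl u ≤ lamFun ν μl y := by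
  have h1 := leftLim_cdf_lt_one hy
  have hm := monotoneOn_quantile_Ico hl0
  by_cases h : ν {y} = 0
  · rw [lamFun_of_null h]
    have e := (measure_singleton_eq_zero_iff y).1 h
    exact hm ⟨hu0, hu.trans_lt h1⟩ ⟨cdf_nonneg ν y, e ▸ h1⟩ (e ▸ hu)
  · have hlt := leftLim_cdf_lt_cdf h
    rw [lamFun_of_atom h, le_div_iff₀ (sub_pos.2 hlt)]
    have hi := intervalIntegrable_quantile hl (leftLim_cdf_nonneg y) hlt.le (cdf_le_one ν y)
    have := intervalIntegral.integral_mono_on_of_le_Ioo hlt.le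
      (intervalIntegrable_const (c := quantile μl u)) hi fun v hv =>
        hm ⟨hu0, hu.trans_lt h1⟩ ⟨(leftLim_cdf_nonneg y).trans hv.1.le,
          hv.2.trans_le (cdf_le_one ν y)⟩ (hu.trans hv.1.le)
    rwa [intervalIntegral.integral_const, smul_eq_mul, mul_comm] at this

theorem lamFun_le_quantile (hl : Integrable (fun t : ℝ => t ^ 2) μl) (hl0 : μl (Iio 0) = 0) {y : ℝ}
    {u : ℝ} (hu1 : u < 1) (hu : cdf ν y ≤ u) : lamFun ν μl y ≤ quantile μl u := by
  have hm := monotoneOn_quantile_Ico hl0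
  have h0 := cdf_nonneg ν y
  by_cases h : ν {y} = 0
  · rw [lamFun_of_null h]
    exact hm ⟨h0, hu.trans_lt hu1⟩ ⟨h0.trans hu, hu1⟩ hu
  · have hlt := leftLim_cdf_lt_cdf h
    rw [lamFun_of_atom h, div_le_iff₀ (sub_pos.2 hlt)]
    have hi := intervalIntegrable_quantile hl (leftLim_cdf_nonneg y) hlt.le (cdf_le_one ν y)
    have := intervalIntegral.integral_mono_on_of_le_Ioo hlt.le hi
      (intervalIntegrable_const (c := quantile μl u)) fun v hv =>
        hm ⟨(leftLim_cdf_nonneg y).trans hv.1.le, (hv.2.trans_le hu).trans hu1⟩ ⟨h0.trans hu, hu1⟩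
          (hv.2.le.trans hu)
    rwa [intervalIntegral.integral_const, smul_eq_mul, mul_comm] at this

theorem monotoneOn_lamFun (hl : Integrable (fun t : ℝ => t ^ 2) μl) (hl0 : μl (Iio 0) = 0) :
    MonotoneOn (lamFun ν μl) (massRange ν) := by
  intro x _ y hy hxy
  rcases hxy.eq_or_lt with rfl | hlt
  · exact le_rfl
  · have h := cdf_le_leftLim (ν := ν) hlt
    exact (lamFun_le_quantile hl hl0 (h.trans_lt (leftLim_cdf_lt_one hy)) le_rfl).trans
      (quantile_le_lamFun hl hl0 hy (cdf_nonneg ν x) h)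

theorem lamFun_nonneg (hl : Integrable (fun t : ℝ => t ^ 2) μl) (hl0 : μl (Iio 0) = 0) {y : ℝ}
    (hy : y ∈ massRange ν) : 0 ≤ lamFun ν μl y :=
  (quantile_zero_nonneg hl0).trans (quantile_le_lamFun hl hl0 hy le_rfl (leftLim_cdf_nonneg y))

theorem cdf_eq_of_measure_Icc_eq_zero {b w y : ℝ} (h : ν (Icc b w) = 0) (hy : y ∈ Icc b w) :
    cdf ν y = cdf ν b := by
  rw [cdf_eq_real, cdf_eq_real, ← Iic_union_Ioc_eq_Iic hy.1]
  refine measureReal_congr (union_ae_eq_left_of_ae_eq_empty ?_)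
  exact ae_eq_empty.2 (measure_mono_null
    (Ioc_subset_Icc_self.trans (Icc_subset_Icc_right hy.2)) h)

theorem lamFun_eq_of_measure_Icc_eq_zero {b w y : ℝ} (h : ν (Icc b w) = 0) (hy : y ∈ Icc b w) :
    lamFun ν μl y = quantile μl (cdf ν b) := by
  rw [lamFun_of_null (measure_mono_null (singleton_subset_iff.2 hy) h),
    cdf_eq_of_measure_Icc_eq_zero h hy]

/-- `λ` is left continuous at points that are not atoms. -/
theorem exists_lamFun_near (hl : Integrable (fun t : ℝ => t ^ 2) μl) (hl0 : μl (Iio 0) = 0)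
    {a b δ : ℝ} (ha : 0 ≤ a) (hab : a < b) (hb : b ∈ massRange ν) (hatom : ν {b} = 0) (hδ : 0 < δ) :
    ∃ x ∈ Ioo a b, quantile μl (cdf ν b) - δ ≤ lamFun ν μl x := by
  have e := (measure_singleton_eq_zero_iff b).1 hatom
  have hb1 : cdf ν b < 1 := e ▸ leftLim_cdf_lt_one hb
  have hS : ∀ x, a < x → x < b → x ∈ massRange ν :=
    fun x h1 h2 => massRange_of_le hb (ha.trans h1.le) h2.le
  rcases (cdf_nonneg ν b).eq_or_lt with h0 | h0
  · refine ⟨(a + b) / 2, ⟨by linarith, by linarith⟩, ?_⟩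
    have := quantile_le_lamFun hl hl0 (hS ((a + b) / 2) (by linarith) (by linarith)) le_rfl
      (leftLim_cdf_nonneg ((a + b) / 2))
    rw [← h0]
    linarith
  · have h1 : cdf μl (quantile μl (cdf ν b) - δ) < cdf ν b :=
      (lt_quantile_iff ⟨h0, hb1⟩).1 (sub_lt_self _ hδ)
    -- A level `u` below `cdf ν b` whose quantile already exceeds the target; continuity of `cdf ν`
    -- at `b` yields points before `b` with level above `u`.
    obtain ⟨u, hu1, hu2⟩ := exists_between (max_lt h1 h0)
    have hu0 : 0 < u := (le_max_right _ _).trans_lt hu1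
    have hlim := (monotone_cdf ν).tendsto_leftLim b
    rw [e] at hlim
    obtain ⟨x, hx, hxb⟩ := ((hlim.eventually (lt_mem_nhds hu2)).and self_mem_nhdsWithin).exists
    have hxb' : x < b := hxb
    have hm : max x a < b := max_lt hxb' hab
    have hm1 := le_max_left x a
    have hm2 := le_max_right x a
    have hz1 : a < (max x a + b) / 2 := by linarith
    have hz2 : (max x a + b) / 2 < b := by linarith
    refine ⟨(max x a + b) / 2, ⟨hz1, hz2⟩, ?_⟩
    have h2 : quantile μl (cdf ν b) - δ < quantile μl u :=
      (lt_quantile_iff ⟨hu0, hu2.trans hb1⟩).2 ((le_max_left _ _).trans_lt hu1)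
    refine h2.le.trans (quantile_le_lamFun hl hl0 (hS _ hz1 hz2) hu0.le ?_)
    exact hx.le.trans (cdf_le_leftLim (by linarith))

end LamFun

/-! ### Atoms, level intervals and `λ` as a conditional expectation -/

section Atoms

variable {ν μl : Measure ℝ} [IsProbabilityMeasure ν] [IsProbabilityMeasure μl]

/-- The interval of levels at which the quantile function of `ν` takes the value `y`. -/
noncomputable def levelInterval (ν : Measure ℝ) (y : ℝ) : Set ℝ :=
  Ioo (Function.leftLim (cdf ν) y) (cdf ν y)

theorem levelInterval_subset (y : ℝ) : levelInterval ν y ⊆ Ioo 0 1 :=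
  Ioo_subset_Ioo (leftLim_cdf_nonneg y) (cdf_le_one ν y)

theorem measurableSet_levelInterval (y : ℝ) : MeasurableSet (levelInterval ν y) :=
  measurableSet_Ioo

theorem quantile_eq_of_mem_levelInterval {u y : ℝ} (hu : u ∈ levelInterval ν y) :
    quantile ν u = y :=
  le_antisymm ((quantile_le_iff (levelInterval_subset y hu)).2 hu.2.le)
    (le_quantile_of_leftLim_cdf_lt (levelInterval_subset y hu) hu.1)

theorem countable_atoms : {y | ν {y} ≠ 0}.Countable := by
  have := Measure.countable_meas_pos_of_disjoint_iUnion (μ := ν) (As := fun y : ℝ => ({y} : Set ℝ))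
    (fun y => measurableSet_singleton y) (fun x y hxy => by simpa [Function.onFun] using hxy)
  simpa only [pos_iff_ne_zero] using this

/-- At a level `u` whose quantile is not an atom, `cdf ν (quantile ν u) = u`, so `λ` returns
`quantile μl u`. The end points of the level intervals of atoms are countable. -/
theorem ae_mem_levelInterval_or :
    ∀ᵐ u ∂unitMeasure, u ∈ (⋃ y : {y | ν {y} ≠ 0}, levelInterval ν y) ∨
      quantile μl u = lamFun ν μl (quantile ν u) := by
  have hc : (⋃ y ∈ {y | ν {y} ≠ 0},
      ({Function.leftLim (cdf ν) y, cdf ν y} : Set ℝ)).Countable :=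
    countable_atoms.biUnion fun y _ => (Set.toFinite _).countable
  have hE := ae_restrict_of_ae (s := Ioo (0 : ℝ) 1) (hc.ae_notMem volume)
  filter_upwards [ae_unitMeasure_mem, hE] with u hu huE
  have h1 : Function.leftLim (cdf ν) (quantile ν u) ≤ u := leftLim_cdf_le_of_le_quantile hu le_rfl
  have h2 : u ≤ cdf ν (quantile ν u) := le_cdf_quantile hu
  by_cases h : ν {quantile ν u} = 0
  · right
    have e := (measure_singleton_eq_zero_iff _).1 h
    rw [lamFun_of_null h, le_antisymm (e ▸ h1) h2]
  · left
    have hne : u ≠ Function.leftLim (cdf ν) (quantile ν u) ∧ u ≠ cdf ν (quantile ν u) := by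
      constructor <;> intro e <;> refine huE (mem_biUnion (x := quantile ν u) h ?_)
      · exact Or.inl e
      · exact Or.inr e
    exact mem_iUnion.2 ⟨⟨_, h⟩, lt_of_le_of_ne h1 hne.1.symm, lt_of_le_of_ne h2 hne.2⟩

theorem pairwise_disjoint_levelInterval :
    Pairwise (Function.onFun Disjoint fun y : {y | ν {y} ≠ 0} => levelInterval ν y) := by
  intro x y hxy
  refine disjoint_left.2 fun u hu hu' => hxy (Subtype.ext ?_)
  rw [← quantile_eq_of_mem_levelInterval hu, quantile_eq_of_mem_levelInterval hu']

theorem setIntegral_unitMeasure {s : Set ℝ} (hs : MeasurableSet s) (h : s ⊆ Ioo 0 1) (f : ℝ → ℝ) :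
    ∫ u in s, f u ∂unitMeasure = ∫ u in s, f u := by
  rw [unitMeasure, Measure.restrict_restrict hs, inter_eq_left.2 h]

theorem setIntegral_levelInterval (hl : Integrable (fun t : ℝ => t ^ 2) μl) {y : ℝ}
    (hy : ν {y} ≠ 0) :
    ∫ u in levelInterval ν y, (quantile μl u - lamFun ν μl y) ∂unitMeasure = 0 := by
  have hlt := leftLim_cdf_lt_cdf hy
  have hi : IntegrableOn (quantile μl) (levelInterval ν y) :=
    (integrableOn_quantile hl).mono_set (levelInterval_subset y)
  rw [setIntegral_unitMeasure (measurableSet_levelInterval y) (levelInterval_subset y),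
    integral_sub hi (by simp [levelInterval]), setIntegral_const, lamFun_of_atom hy,
    intervalIntegral.integral_of_le hlt.le, integral_Ioc_eq_integral_Ioo]
  have : volume.real (levelInterval ν y) = cdf ν y - Function.leftLim (cdf ν) y := by
    rw [levelInterval, Real.volume_real_Ioo_of_le hlt.le]
  rw [this, smul_eq_mul, mul_div_cancel₀ _ (sub_pos.2 hlt).ne', levelInterval, sub_self]

theorem aemeasurable_lamFun (hν : ν (Iio 0) = 0) (hl : Integrable (fun t : ℝ => t ^ 2) μl)
    (hl0 : μl (Iio 0) = 0) : AEMeasurable (lamFun ν μl) ν := by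
  have := aemeasurable_restrict_of_monotoneOn (μ := ν) measurableSet_massRange
    (monotoneOn_lamFun (ν := ν) hl hl0)
  rwa [Measure.restrict_eq_self_of_ae_mem (ae_mem_massRange hν)] at this

theorem integrable_quantile_sq (hl : Integrable (fun t : ℝ => t ^ 2) μl) :
    Integrable (fun u => quantile μl u ^ 2) unitMeasure :=
  (memLp_quantile hl).integrable_sq

/-- This is Jensen's inequality for the mean over a level interval, obtained by expanding the
variance. The form with `∫⁻` allows summation over all atoms before integrability of `λ²` is known.
-/
theorem lamFun_sq_levelInterval_le (hl : Integrable (fun t : ℝ => t ^ 2) μl) {y : ℝ}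
    (hy : ν {y} ≠ 0) :
    ∫⁻ u in levelInterval ν y, ENNReal.ofReal (lamFun ν μl (quantile ν u) ^ 2) ∂unitMeasure ≤
      ∫⁻ u in levelInterval ν y, ENNReal.ofReal (quantile μl u ^ 2) ∂unitMeasure := by
  have hm : MeasurableSet (levelInterval ν y) := measurableSet_Ioo
  have hq : IntegrableOn (quantile μl) (levelInterval ν y) unitMeasure :=
    ((memLp_quantile hl).integrable (by norm_num)).integrableOn
  have hq2 : IntegrableOn (fun u => quantile μl u ^ 2) (levelInterval ν y) unitMeasure :=
    (integrable_quantile_sq hl).integrableOn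
  have e1 : ∫⁻ u in levelInterval ν y, ENNReal.ofReal (lamFun ν μl (quantile ν u) ^ 2) ∂unitMeasure
      = ∫⁻ u in levelInterval ν y, ENNReal.ofReal (lamFun ν μl y ^ 2) ∂unitMeasure :=
    setLIntegral_congr_fun hm fun u hu => by
      simp only [quantile_eq_of_mem_levelInterval hu]
  rw [e1, ← ofReal_integral_eq_lintegral_ofReal (integrable_const _)
    (Eventually.of_forall fun _ => sq_nonneg _),
    ← ofReal_integral_eq_lintegral_ofReal hq2 (Eventually.of_forall fun _ => sq_nonneg _)]
  refine ENNReal.ofReal_le_ofReal ?_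
  have h0 := setIntegral_levelInterval hl hy
  have h1 : 0 ≤ ∫ u in levelInterval ν y, (quantile μl u - lamFun ν μl y) ^ 2 ∂unitMeasure :=
    integral_nonneg fun _ => sq_nonneg _
  have i1 : IntegrableOn (fun u => quantile μl u - lamFun ν μl y) (levelInterval ν y) unitMeasure :=
    hq.sub (integrable_const _)
  have i2 : IntegrableOn (fun u => 2 * lamFun ν μl y * (quantile μl u - lamFun ν μl y))
    (levelInterval ν y) unitMeasure := i1.const_mul _
  have i3 : IntegrableOn (fun _ : ℝ => lamFun ν μl y ^ 2) (levelInterval ν y) unitMeasure :=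
    integrable_const _
  have e2 : ∀ u, (quantile μl u - lamFun ν μl y) ^ 2 = quantile μl u ^ 2 - lamFun ν μl y ^ 2 -
      2 * lamFun ν μl y * (quantile μl u - lamFun ν μl y) := fun u => by ring
  have i4 : IntegrableOn (fun u => quantile μl u ^ 2 - lamFun ν μl y ^ 2) (levelInterval ν y)
    unitMeasure := hq2.sub i3
  simp only [e2] at h1
  rw [integral_sub i4 i2, integral_sub hq2 i3, integral_const_mul, h0, mul_zero, sub_zero,
    sub_nonneg] at h1
  exact h1

theorem measurableSet_levels :
    MeasurableSet (⋃ y : {y | ν {y} ≠ 0}, levelInterval ν y) :=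
  (isOpen_iUnion fun _ => isOpen_Ioo).measurableSet

/-- Conditional expectation contracts second moments: Jensen on each level interval of an atom,
equality off them. -/
theorem memLp_lamFun (hν : ν (Iio 0) = 0) (hl : Integrable (fun t : ℝ => t ^ 2) μl)
    (hl0 : μl (Iio 0) = 0) : MemLp (lamFun ν μl) 2 ν := by
  have hmeas := aemeasurable_lamFun (ν := ν) hν hl hl0
  have hmeas' : AEMeasurable (fun u => lamFun ν μl (quantile ν u)) unitMeasure := by
    rw [← map_quantile (μ := ν)] at hmeas
    have := hmeas.comp_aemeasurable aemeasurable_quantile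
    rw [map_quantile] at this
    exact this
  have : Countable {y | ν {y} ≠ 0} := countable_atoms.to_subtype
  have hle : ∫⁻ u, ENNReal.ofReal (lamFun ν μl (quantile ν u) ^ 2) ∂unitMeasure ≤
      ∫⁻ u, ENNReal.ofReal (quantile μl u ^ 2) ∂unitMeasure := by
    rw [← lintegral_add_compl _ (measurableSet_levels (ν := ν)),
      ← lintegral_add_compl (fun u => ENNReal.ofReal (quantile μl u ^ 2))
        (measurableSet_levels (ν := ν))]
    refine add_le_add ?_ (le_of_eq ?_)
    · rw [lintegral_iUnion (fun _ => measurableSet_levelInterval _) pairwise_disjoint_levelInterval,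
        lintegral_iUnion (fun _ => measurableSet_levelInterval _) pairwise_disjoint_levelInterval]
      exact ENNReal.tsum_le_tsum fun y => lamFun_sq_levelInterval_le hl y.2
    · refine setLIntegral_congr_fun_ae measurableSet_levels.compl ?_
      filter_upwards [ae_mem_levelInterval_or (ν := ν) (μl := μl)] with u hu hu'
      rw [hu.resolve_left hu']
  have hint : Integrable (fun u => lamFun ν μl (quantile ν u) ^ 2) unitMeasure := by
    refine ⟨(hmeas'.pow_const 2).aestronglyMeasurable, ?_⟩
    rw [hasFiniteIntegral_iff_ofReal (Eventually.of_forall fun _ => sq_nonneg _)]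
    refine hle.trans_lt ?_
    rw [← hasFiniteIntegral_iff_ofReal (Eventually.of_forall fun _ => sq_nonneg _)]
    exact (integrable_quantile_sq hl).2
  rw [memLp_two_iff_integrable_sq hmeas.aestronglyMeasurable]
  have := (integrable_map_measure (f := quantile ν) (μ := unitMeasure)
    (g := fun y => lamFun ν μl y ^ 2)
    (by rw [map_quantile]; exact (hmeas.pow_const 2).aestronglyMeasurable)
    aemeasurable_quantile).2 hint
  rwa [map_quantile] at this

/-- `λ ∘ q` is the conditional expectation of the quantile function of `μl` given the quantile
function `q` of `ν`. -/
theorem integral_quantile_mul (hν : ν (Iio 0) = 0) (hl : Integrable (fun t : ℝ => t ^ 2) μl)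
    (hl0 : μl (Iio 0) = 0) {f : ℝ → ℝ} (hf : MemLp f 2 ν) :
    ∫ u, quantile μl u * f (quantile ν u) ∂unitMeasure = ∫ y, lamFun ν μl y * f y ∂ν := by
  have hlam := memLp_lamFun (ν := ν) hν hl hl0
  have i1 : Integrable (fun u => quantile μl u * f (quantile ν u)) unitMeasure :=
    (memLp_quantile hl).integrable_mul (memLp_comp_quantile hf)
  have i2 : Integrable (fun u => lamFun ν μl (quantile ν u) * f (quantile ν u)) unitMeasure :=
    (memLp_comp_quantile hlam).integrable_mul (memLp_comp_quantile hf)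
  have i3 : Integrable (fun u => quantile μl u * f (quantile ν u) -
    lamFun ν μl (quantile ν u) * f (quantile ν u)) unitMeasure := i1.sub i2
  have hprod : Integrable (fun y => lamFun ν μl y * f y) ν := hlam.integrable_mul hf
  rw [← integral_comp_quantile (μ := ν) hprod.aestronglyMeasurable, ← sub_eq_zero,
    ← integral_sub i1 i2, ← integral_add_compl (measurableSet_levels (ν := ν)) i3]
  have : Countable {y | ν {y} ≠ 0} := countable_atoms.to_subtype
  have h1 : ∫ u in (⋃ y : {y | ν {y} ≠ 0}, levelInterval ν y),
      (quantile μl u * f (quantile ν u) - lamFun ν μl (quantile ν u) * f (quantile ν u))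
        ∂unitMeasure = 0 := by
    rw [integral_iUnion (fun _ => measurableSet_levelInterval _) pairwise_disjoint_levelInterval
      i3.integrableOn]
    refine (tsum_congr fun y => ?_).trans tsum_zero
    have e : ∀ u ∈ levelInterval ν (y : ℝ), quantile μl u * f (quantile ν u) -
        lamFun ν μl (quantile ν u) * f (quantile ν u) =
        f y * (quantile μl u - lamFun ν μl y) := by
      intro u hu
      rw [quantile_eq_of_mem_levelInterval hu]
      ring
    rw [setIntegral_congr_fun (measurableSet_levelInterval _) e, integral_const_mul,
      setIntegral_levelInterval hl y.2, mul_zero]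
  have h2 : ∫ u in (⋃ y : {y | ν {y} ≠ 0}, levelInterval ν y)ᶜ,
      (quantile μl u * f (quantile ν u) - lamFun ν μl (quantile ν u) * f (quantile ν u))
        ∂unitMeasure = 0 := by
    refine (setIntegral_congr_ae measurableSet_levels.compl ?_).trans (integral_zero _ _)
    filter_upwards [ae_mem_levelInterval_or (ν := ν) (μl := μl)] with u hu hu'
    rw [hu.resolve_left hu', sub_self]
  rw [h1, h2, add_zero]

theorem isPoolStart_initialG (hν : ν (Iio 0) = 0) (hy : Integrable (fun t : ℝ => t ^ 2) ν)
    (hl : Integrable (fun t : ℝ => t ^ 2) μl) (hl0 : μl (Iio 0) = 0) :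
    IsPoolStart ν (initialG ν μl) where
  sub := by
    simpa only [initialG, sub_sub_cancel] using monotoneOn_lamFun (ν := ν) hl hl0
  zero := by
    have := lamFun_nonneg (ν := ν) hl hl0 (zero_mem_massRange hν)
    simp only [initialG]
    linarith
  memLp := (memLp_id_of_integrable_sq hy).sub (memLp_lamFun hν hl hl0)
  gap a b w ha hab hbw hb h0 hm := by
    have hconst : ∀ y ∈ Icc b w, initialG ν μl y = y - quantile μl (cdf ν b) :=
      fun y hy => by rw [initialG, lamFun_eq_of_measure_Icc_eq_zero h0 hy]
    intro x hx y hy hxy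
    rcases lt_or_ge y b with hyb | hyb
    · exact hm ⟨hx.1, hxy.trans_lt hyb⟩ ⟨hy.1, hyb⟩ hxy
    rw [hconst y ⟨hyb, hy.2.le⟩]
    rcases lt_or_ge x b with hxb | hxb
    -- On the null interval `λ` is constant, so only the passage through `b` needs care. There `b`
    -- is no atom, and left continuity of `λ` prevents a downward jump of `G₀`.
    · refine le_of_forall_pos_le_add fun δ hδ => ?_
      obtain ⟨z, hz, hle⟩ := exists_lamFun_near hl hl0 (ha.trans hx.1.le) hxb hb
        (measure_mono_null (singleton_subset_iff.2 (left_mem_Icc.2 hbw.le)) h0) hδ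
      have h1 := hm ⟨hx.1, hxb⟩ ⟨hx.1.trans hz.1, hz.2⟩ hz.1.le
      have h2 : initialG ν μl z = z - lamFun ν μl z := rfl
      linarith [hz.2]
    · rw [hconst x ⟨hxb, hx.2.le⟩]
      linarith
  gap_zero w hw h0 := by
    intro x hx y hy hxy
    rw [initialG, initialG, lamFun_eq_of_measure_Icc_eq_zero h0 ⟨hx.1, hx.2.le⟩,
      lamFun_eq_of_measure_Icc_eq_zero h0 ⟨hy.1, hy.2.le⟩]
    linarith

/-- Comparison of tails of `ν` carries over to the unit interval. -/
theorem setIntegral_Ioo_sub_quantile_nonpos (hν : ν (Iio 0) = 0)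
    (hl : Integrable (fun t : ℝ => t ^ 2) μl) (hl0 : μl (Iio 0) = 0) {w : ℝ → ℝ} (hw : MemLp w 2 ν)
    (htail : ∀ A : Set ℝ, IsUpperSet A → ∫ y in A, (w y - lamFun ν μl y) ∂ν ≤ 0) {a : ℝ}
    (ha : a ∈ Icc 0 1) :
    ∫ u in Ioo a 1, (w (quantile ν u) - quantile μl u) ≤ 0 := by
  set f : ℝ → ℝ := fun u => w (quantile ν u) - quantile μl u with hf
  have hfi : Integrable f unitMeasure :=
    ((memLp_comp_quantile hw).sub (memLp_quantile hl)).integrable (by norm_num)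
  have hvol : ∀ s : Set ℝ, s ⊆ Ioo 0 1 → IntegrableOn f s := fun s hs =>
    IntegrableOn.mono_set (t := Ioo 0 1) hfi hs
  have hset : ∀ A : Set ℝ, IsUpperSet A →
      ∫ u, A.indicator (fun _ => (1 : ℝ)) (quantile ν u) * f u ∂unitMeasure ≤ 0 := by
    intro A hA
    have hAm : MeasurableSet A := hA.ordConnected.measurableSet
    have hind : MemLp (A.indicator (fun _ => (1 : ℝ))) 2 ν := (memLp_const 1).indicator hAm
    have hlam := memLp_lamFun (ν := ν) hν hl hl0
    have j1 : Integrable (fun u => w (quantile ν u) * A.indicator (fun _ => (1 : ℝ)) (quantile ν u))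
      unitMeasure := (memLp_comp_quantile hw).integrable_mul (memLp_comp_quantile hind)
    have j2 : Integrable (fun u => quantile μl u * A.indicator (fun _ => (1 : ℝ)) (quantile ν u))
      unitMeasure := (memLp_quantile hl).integrable_mul (memLp_comp_quantile hind)
    have j3 : Integrable (fun y => w y * A.indicator (fun _ => (1 : ℝ)) y) ν :=
      hw.integrable_mul hind
    have j4 : Integrable (fun y => lamFun ν μl y * A.indicator (fun _ => (1 : ℝ)) y) ν :=
      hlam.integrable_mul hind
    have e : ∫ u, A.indicator (fun _ => (1 : ℝ)) (quantile ν u) * f u ∂unitMeasure =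
        ∫ y in A, (w y - lamFun ν μl y) ∂ν := by
      have e1 : ∀ u, A.indicator (fun _ => (1 : ℝ)) (quantile ν u) * f u =
          w (quantile ν u) * A.indicator (fun _ => (1 : ℝ)) (quantile ν u) -
            quantile μl u * A.indicator (fun _ => (1 : ℝ)) (quantile ν u) := fun u => by
        simp only [hf]; ring
      simp only [e1]
      rw [integral_sub j1 j2, integral_quantile_mul hν hl hl0 hind,
        integral_comp_quantile (μ := ν) (f := fun y => w y * A.indicator (fun _ => (1 : ℝ)) y)
          j3.aestronglyMeasurable, ← integral_sub j3 j4, ← integral_indicator hAm]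
      refine integral_congr_ae (Eventually.of_forall fun y => ?_)
      by_cases hy : y ∈ A <;> simp [hy]
    rw [e]
    exact htail A hA
  have hIoo : ∀ (c : ℝ) (A : Set ℝ), 0 ≤ c → IsUpperSet A →
      (∀ u ∈ Ioo 0 1, c < u → quantile ν u ∈ A) →
      (∀ u ∈ Ioo 0 1, u < c → quantile ν u ∉ A) → ∫ u in Ioo c 1, f u ≤ 0 := by
    intro c A hc hA h1 h2
    refine le_of_eq_of_le ?_ (hset A hA)
    rw [← setIntegral_unitMeasure measurableSet_Ioo (Ioo_subset_Ioo_left hc),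
      ← integral_indicator measurableSet_Ioo]
    refine integral_congr_ae ?_
    have hc' : ∀ᵐ u ∂unitMeasure, u ≠ c :=
      ae_restrict_of_ae (compl_mem_ae_iff.2 (measure_singleton (μ := volume) c))
    filter_upwards [ae_unitMeasure_mem, hc'] with u hu huc
    rcases lt_or_gt_of_ne huc with h | h
    · rw [indicator_of_notMem (fun hh => absurd hh.1 (not_lt.2 h.le)),
        indicator_of_notMem (h2 u hu h), zero_mul]
    · rw [indicator_of_mem (show u ∈ Ioo c 1 from ⟨h, hu.2⟩),
        indicator_of_mem (h1 u hu h), one_mul]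
  rcases ha.1.eq_or_lt with rfl | ha0
  · exact hIoo 0 univ le_rfl isUpperSet_univ (fun _ _ _ => mem_univ _)
      (fun u hu h => absurd h (not_lt.2 hu.1.le))
  rcases ha.2.eq_or_lt with rfl | ha1
  · simp
  have hau : a ∈ Ioo 0 1 := ⟨ha0, ha1⟩
  set y := quantile ν a with hy
  set α := Function.leftLim (cdf ν) y with hα
  set β := cdf ν y with hβ
  have hαa : α ≤ a := leftLim_cdf_le_of_le_quantile hau le_rfl
  have haβ : a ≤ β := le_cdf_quantile hau
  have hα0 : 0 ≤ α := leftLim_cdf_nonneg y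
  have hβ1 : β ≤ 1 := cdf_le_one ν y
  -- At the two ends of the level interval of `y`, the tails are those of the upper sets `(y, ∞)`
  -- and `[y, ∞)`, to which the hypothesis applies.
  have hTβ : ∫ u in Ioo β 1, f u ≤ 0 := by
    refine hIoo β (Ioi y) (cdf_nonneg ν y) (isUpperSet_Ioi y)
      (fun u hu h => (lt_quantile_iff hu).2 h) fun u hu h => ?_
    exact not_lt.2 ((quantile_le_iff hu).2 h.le)
  have hTα : ∫ u in Ioo α 1, f u ≤ 0 := by
    refine hIoo α (Ici y) hα0 (isUpperSet_Ici y)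
      (fun u hu h => le_quantile_of_leftLim_cdf_lt hu h) fun u hu h h' => ?_
    exact absurd (leftLim_cdf_le_of_le_quantile hu h') (not_le.2 h)
  have hq : ∀ u, α < u → u < β → f u = w y - quantile μl u := by
    intro u h1 h2
    simp only [hf]
    rw [quantile_eq_of_mem_levelInterval (y := y) ⟨h1, h2⟩]
  have hmono := monotoneOn_quantile (μ := μl)
  -- Between `α` and `β` the integrand `w y - quantile μl u` is non-increasing in `u`. If it is
  -- nonpositive at `a`, dropping `(a, β)` increases the integral; otherwise adding `(α, a)` does.
  by_cases hcase : w y ≤ quantile μl a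
  · have hsplit : ∫ u in Ioo a 1, f u ≤ ∫ u in Ioo β 1, f u := by
      rcases hβ1.eq_or_lt with h1 | h1
      · rw [h1, Ioo_self, setIntegral_empty]
        refine setIntegral_nonpos measurableSet_Ioo fun u hu => ?_
        rw [hq u (hαa.trans_lt hu.1) (h1 ▸ hu.2)]
        have := hmono hau ⟨ha0.trans hu.1, hu.2⟩ hu.1.le
        linarith
      · rw [← Ioc_union_Ioo_eq_Ioo haβ h1, setIntegral_union
          (disjoint_left.2 fun u hu hu' => absurd hu.2 (not_le.2 hu'.1)) measurableSet_Ioo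
          (hvol _ fun u hu => ⟨ha0.trans hu.1, hu.2.trans_lt h1⟩)
          (hvol _ (Ioo_subset_Ioo_left (ha0.le.trans haβ))), integral_Ioc_eq_integral_Ioo]
        have : ∫ u in Ioo a β, f u ≤ 0 := by
          refine setIntegral_nonpos measurableSet_Ioo fun u hu => ?_
          rw [hq u (hαa.trans_lt hu.1) hu.2]
          have := hmono hau ⟨ha0.trans hu.1, hu.2.trans h1⟩ hu.1.le
          linarith
        linarith
    linarith
  · rw [not_le] at hcase
    have hsplit : ∫ u in Ioo a 1, f u ≤ ∫ u in Ioo α 1, f u := by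
      rw [← Ioc_union_Ioo_eq_Ioo hαa ha1, setIntegral_union
        (disjoint_left.2 fun u hu hu' => absurd hu.2 (not_le.2 hu'.1)) measurableSet_Ioo
        (hvol _ fun u hu => ⟨hα0.trans_lt hu.1, hu.2.trans_lt ha1⟩)
        (hvol _ (Ioo_subset_Ioo_left ha0.le)), integral_Ioc_eq_integral_Ioo]
      have : 0 ≤ ∫ u in Ioo α a, f u := by
        refine setIntegral_nonneg measurableSet_Ioo fun u hu => ?_
        rw [hq u hu.1 (hu.2.trans_le haβ)]
        have := hmono ⟨hα0.trans_lt hu.1, hu.2.trans ha1⟩ hau hu.2.le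
        linarith
      linarith
    linarith

end Atoms

/-! ### Shrinkage functions -/

/-- Odd, non-decreasing and `1`-Lipschitz functions. -/
structure IsShrinkage (η : ℝ → ℝ) : Prop where
  odd : ∀ t, η (-t) = -η t
  mono : Monotone η
  lipschitz : LipschitzWith 1 η

namespace IsShrinkage

variable {η : ℝ → ℝ}

theorem map_zero (h : IsShrinkage η) : η 0 = 0 := by
  have := h.odd 0
  rw [neg_zero] at this
  linarith

theorem abs_sub_le (h : IsShrinkage η) (x y : ℝ) : |η x - η y| ≤ |x - y| := by
  simpa [Real.dist_eq] using h.lipschitz.dist_le_mul x y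

theorem abs_le (h : IsShrinkage η) (x : ℝ) : |η x| ≤ |x| := by
  simpa [h.map_zero] using h.abs_sub_le x 0

theorem nonneg (h : IsShrinkage η) {x : ℝ} (hx : 0 ≤ x) : 0 ≤ η x := by
  rw [← h.map_zero]; exact h.mono hx

theorem monotone_sub (h : IsShrinkage η) : Monotone fun x => x - η x := by
  intro x y hxy
  have h1 := h.abs_sub_le y x
  rw [abs_of_nonneg (sub_nonneg.2 hxy), abs_of_nonneg (sub_nonneg.2 (h.mono hxy))] at h1
  simp only
  linarith

theorem le_self (h : IsShrinkage η) {x : ℝ} (hx : 0 ≤ x) : η x ≤ x := by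
  have := h.monotone_sub hx
  simp only [h.map_zero] at this
  linarith

theorem continuous (h : IsShrinkage η) : Continuous η := h.lipschitz.continuous

theorem memLp_comp (h : IsShrinkage η) {α : Type*} [MeasurableSpace α] {m : Measure α} {f : α → ℝ}
    (hf : MemLp f 2 m) : MemLp (fun x => η (f x)) 2 m :=
  hf.mono (h.continuous.comp_aestronglyMeasurable hf.1)
    (Eventually.of_forall fun x => by simpa using h.abs_le (f x))

theorem of_nonneg (hodd : ∀ t, η (-t) = -η t) (hm : MonotoneOn η (Ici 0))
    (hs : MonotoneOn (fun t => t - η t) (Ici 0)) : IsShrinkage η := by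
  have hmono : Monotone η := monotone_of_odd_of_monotoneOn_nonneg hodd hm
  have hsub : Monotone fun t => t - η t :=
    monotone_of_odd_of_monotoneOn_nonneg (fun t => by rw [hodd]; ring) hs
  refine ⟨hodd, hmono, LipschitzWith.of_le_add_mul 1 fun x y => ?_⟩
  rw [NNReal.coe_one, one_mul, Real.dist_eq]
  rcases le_total x y with h | h
  · linarith [hmono h, abs_nonneg (x - y)]
  · have := hsub h
    simp only at this
    linarith [le_abs_self (x - y)]

end IsShrinkage

/-- `η ∘ q` is the projection of `q - ℓ` onto the cone of nonnegative non-decreasing functions on the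
unit interval, where `q` and `ℓ` are the quantile functions of `ν` and `μl`. -/
structure IsOptimalShrinkage (ν μl : Measure ℝ) (η : ℝ → ℝ) : Prop extends IsShrinkage η where
  tail : ∀ a ∈ Icc (0 : ℝ) 1,
    ∫ u in Ioo a 1, (quantile ν u - η (quantile ν u) - quantile μl u) ≤ 0
  slack : ∫ u, (quantile ν u - η (quantile ν u) - quantile μl u) * η (quantile ν u) ∂unitMeasure = 0

/-! ### From the pooled function to an odd `1`-Lipschitz function -/

section ScalarOfG

theorem isShrinkage_sign_mul_max {g : ℝ → ℝ} (hm : MonotoneOn g (Ici 0))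
    (hs : MonotoneOn (fun y => y - g y) (Ici 0)) (h0 : g 0 ≤ 0) :
    IsShrinkage (fun y => Real.sign y * max 0 (g |y|)) ∧
      ∀ y, 0 ≤ y → Real.sign y * max 0 (g |y|) = max 0 (g y) := by
  have hval : ∀ y, 0 ≤ y → Real.sign y * max 0 (g |y|) = max 0 (g y) := by
    intro y hy
    rcases hy.eq_or_lt with rfl | hy0
    · rw [Real.sign_zero, zero_mul, max_eq_left h0]
    · rw [Real.sign_of_pos hy0, one_mul, abs_of_pos hy0]
  refine ⟨IsShrinkage.of_nonneg (fun t => ?_) ?_ ?_, hval⟩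
  · simp only [Real.sign_neg, abs_neg, neg_mul]
  · intro x hx y hy hxy
    simp only [hval x hx, hval y hy]
    exact max_le_max_left _ (hm hx hy hxy)
  · intro x hx y hy hxy
    have h1 := hs hx hy hxy
    simp only [hval x hx, hval y hy] at h1 ⊢
    have h2 := le_max_left 0 (g x)
    have h3 := le_max_right 0 (g x)
    rcases max_choice 0 (g y) with e | e <;> rw [e] <;> linarith

variable {ν : Measure ℝ} [IsProbabilityMeasure ν] {G₀ G : ℝ → ℝ}

theorem isShrinkage_scalarOfG (hν : ν (Iio 0) = 0) (h : PoolInvariant ν G₀ G)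
    (hm : MonotoneOn G (massRange ν)) :
    IsShrinkage (scalarOfG ν G) ∧ ∀ y ∈ massRange ν, scalarOfG ν G y = max 0 (G y) := by
  classical
  have h0 := zero_mem_massRange hν
  set s := ⨆ z : massRange ν, ((z : ℝ) - G z) with hs
  set g : ℝ → ℝ := fun y => if y ∈ massRange ν then G y else y - s with hg
  have hbelow : ∀ y, 0 ≤ y → y ∉ massRange ν → ∀ z ∈ massRange ν, z ≤ y := by
    intro y hy0 hy z hz
    by_contra hlt
    exact hy (massRange_of_le hz hy0 (not_le.1 hlt).le)
  -- A point `y` beyond the mass range bounds the supremum `s`, giving `z - G z ≤ s ≤ y - G z`.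
  -- These are the slope and monotonicity conditions at the junction. If no such `y` exists, `s` is
  -- never used.
  have hupper : ∀ y, 0 ≤ y → y ∉ massRange ν → ∀ z ∈ massRange ν, ∀ z' ∈ massRange ν,
      z' - G z' ≤ y - G z := by
    intro y hy0 hy z hz z' hz'
    rcases le_total z' z with hzz | hzz
    · have := h.sub hz' hz hzz
      simp only at this
      linarith [hbelow y hy0 hy z hz]
    · have := hm hz hz' hzz
      linarith [hbelow y hy0 hy z' hz']
  have hsle : ∀ y, 0 ≤ y → y ∉ massRange ν → ∀ z ∈ massRange ν, s ≤ y - G z := by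
    intro y hy0 hy z hz
    have : Nonempty (massRange ν) := ⟨⟨0, h0⟩⟩
    exact ciSup_le fun z' => hupper y hy0 hy z hz z' z'.2
  have hles : ∀ y, 0 ≤ y → y ∉ massRange ν → ∀ z ∈ massRange ν, z - G z ≤ s := by
    intro y hy0 hy z hz
    refine le_ciSup (f := fun z : massRange ν => (z : ℝ) - G z) ⟨y - G 0, ?_⟩ ⟨z, hz⟩
    rintro _ ⟨z', rfl⟩
    exact hupper y hy0 hy 0 h0 z' z'.2
  have hgm : MonotoneOn g (Ici 0) := by
    intro x hx y hy hxy
    by_cases hyS : y ∈ massRange ν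
    · have hxS := massRange_of_le hyS hx hxy
      simp only [hg, if_pos hyS, if_pos hxS]
      exact hm hxS hyS hxy
    · by_cases hxS : x ∈ massRange ν
      · simp only [hg, if_neg hyS, if_pos hxS]
        linarith [hsle y hy hyS x hxS]
      · simp only [hg, if_neg hyS, if_neg hxS]
        linarith
  have hgs : MonotoneOn (fun y => y - g y) (Ici 0) := by
    intro x hx y hy hxy
    by_cases hyS : y ∈ massRange ν
    · have hxS := massRange_of_le hyS hx hxy
      simp only [hg, if_pos hyS, if_pos hxS]
      exact h.sub hxS hyS hxy
    · by_cases hxS : x ∈ massRange ν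
      · simp only [hg, if_neg hyS, if_pos hxS]
        linarith [hles y hy hyS x hxS]
      · simp only [hg, if_neg hyS, if_neg hxS]
        linarith
  have hg0 : g 0 ≤ 0 := by
    simp only [hg, if_pos h0]
    exact h.zero
  have e : scalarOfG ν G = fun y => Real.sign y * max 0 (g |y|) := by
    funext y
    simp only [scalarOfG, hg]
    congr
  obtain ⟨h1, h2⟩ := isShrinkage_sign_mul_max hgm hgs hg0
  rw [e]
  refine ⟨h1, fun y hy => ?_⟩
  exact (h2 y hy.1).trans (by simp only [hg, if_pos hy])

/-- Orthogonality is available for bounded test functions only, so the positive part is truncated at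
`n`. Domination by `|G₀ - G| * |G|` permits the limit. -/
theorem PoolInvariant.integral_mul_posPart (hG₀ : MemLp G₀ 2 ν) (h : PoolInvariant ν G₀ G) :
    ∫ y, (G₀ y - G y) * max 0 (G y) ∂ν = 0 := by
  have hd : MemLp (fun y => G₀ y - G y) 2 ν := hG₀.sub h.memLp
  have hbound : Integrable (fun y => |G₀ y - G y| * |G y|) ν := hd.abs.integrable_mul h.memLp.abs
  have hlim : Tendsto (fun n : ℕ => ∫ y, (G₀ y - G y) * min (max 0 (G y)) n ∂ν) atTop
      (𝓝 (∫ y, (G₀ y - G y) * max 0 (G y) ∂ν)) := by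
    refine tendsto_integral_of_dominated_convergence _ (fun n => ?_) hbound (fun n => ?_) ?_
    · refine hd.1.mul ?_
      exact ((continuous_const.max continuous_id).min continuous_const).comp_aestronglyMeasurable
        h.memLp.1
    · refine Eventually.of_forall fun y => ?_
      rw [Real.norm_eq_abs, abs_mul]
      refine mul_le_mul_of_nonneg_left ?_ (abs_nonneg _)
      rw [abs_of_nonneg (le_min (le_max_left _ _) (Nat.cast_nonneg n))]
      exact (min_le_left _ _).trans (max_le (abs_nonneg _) (le_abs_self _))
    · refine Eventually.of_forall fun y => ?_
      refine tendsto_const_nhds.congr' ?_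
      filter_upwards [eventually_ge_atTop ⌈max 0 (G y)⌉₊] with n hn
      rw [min_eq_left (Nat.ceil_le.1 hn)]
  refine tendsto_nhds_unique hlim (tendsto_const_nhds.congr fun n => ?_)
  refine (h.orth (fun t => min (max 0 t) n)
    ((measurable_const.max measurable_id).min measurable_const) ⟨n, fun x => ?_⟩).symm
  rw [abs_of_nonneg (le_min (le_max_left _ _) (Nat.cast_nonneg n))]
  exact min_le_right _ _

end ScalarOfG

/-! ### Optimality of the pooled function -/

section PoolOutput

variable {ν μl : Measure ℝ} [IsProbabilityMeasure ν] [IsProbabilityMeasure μl]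

/-- The output of the pooling procedure is optimal. -/
theorem isOptimalShrinkage_scalarOfG (hν : ν (Iio 0) = 0)
    (hy : Integrable (fun t : ℝ => t ^ 2) ν) (hl : Integrable (fun t : ℝ => t ^ 2) μl)
    (hl0 : μl (Iio 0) = 0) {G : ℝ → ℝ}
    (hr : Relation.ReflTransGen (PoolStep ν) (initialG ν μl) G)
    (hm : MonotoneOn G (massRange ν)) : IsOptimalShrinkage ν μl (scalarOfG ν G) := by
  have h₀ := isPoolStart_initialG (ν := ν) hν hy hl hl0
  have hinv := (poolInvariant_of_reflTransGen hν h₀ hr).1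
  obtain ⟨hη, hval⟩ := isShrinkage_scalarOfG hν hinv hm
  set η := scalarOfG ν G with hηdef
  have hid := memLp_id_of_integrable_sq hy
  have hηL : MemLp η 2 ν := hη.memLp_comp hid
  have hw : MemLp (fun y => y - η y) 2 ν := hid.sub hηL
  have hlam := memLp_lamFun (ν := ν) hν hl hl0
  refine ⟨hη, fun a ha => ?_, ?_⟩
  · refine setIntegral_Ioo_sub_quantile_nonpos hν hl hl0 hw (fun A hA => ?_) ha
    -- Passing from `G` to its positive part only lowers the residual.
    refine le_trans (setIntegral_mono_ae ?_ ?_ ?_) (hinv.tail A hA)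
    · exact ((hw.sub hlam).integrable (by norm_num)).integrableOn
    · exact ((h₀.memLp.sub hinv.memLp).integrable (by norm_num)).integrableOn
    · filter_upwards [ae_mem_massRange hν] with y hyS
      simp only [initialG, hval y hyS]
      linarith [le_max_right 0 (G y)]
  · have i1 : Integrable (fun u => (quantile ν u - η (quantile ν u)) * η (quantile ν u))
        unitMeasure := (memLp_comp_quantile hw).integrable_mul (memLp_comp_quantile hηL)
    have i2 : Integrable (fun u => quantile μl u * η (quantile ν u)) unitMeasure :=
      (memLp_quantile hl).integrable_mul (memLp_comp_quantile hηL)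
    have i3 : Integrable (fun y => (y - η y) * η y) ν := hw.integrable_mul hηL
    have i4 : Integrable (fun y => lamFun ν μl y * η y) ν := hlam.integrable_mul hηL
    simp only [sub_mul _ (quantile μl _)]
    rw [integral_sub i1 i2, integral_quantile_mul hν hl hl0 hηL,
      integral_comp_quantile (μ := ν) (f := fun y => (y - η y) * η y) i3.aestronglyMeasurable,
      ← integral_sub i3 i4, ← hinv.integral_mul_posPart h₀.memLp]
    refine integral_congr_ae ?_
    filter_upwards [ae_mem_massRange hν] with y hyS
    simp only [initialG, hval y hyS]
    rcases max_choice 0 (G y) with e | e <;> rw [e] <;> ring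

end PoolOutput

/-! ### Convergence of quantile functions in `L²` -/

/-- The bounded continuous function that is `1` before `a`, `0` after `b` and linear in between. -/
noncomputable def ramp (a b : ℝ) : BoundedContinuousFunction ℝ ℝ :=
  BoundedContinuousFunction.ofNormedAddCommGroup (fun x => max 0 (min 1 ((b - x) / (b - a))))
    (by fun_prop) 1 (fun x => by
      rw [Real.norm_eq_abs, abs_of_nonneg (le_max_left _ _)]
      exact max_le zero_le_one (min_le_left _ _))

theorem ramp_apply (a b x : ℝ) : ramp a b x = max 0 (min 1 ((b - x) / (b - a))) := rfl

theorem ramp_nonneg (a b x : ℝ) : 0 ≤ ramp a b x := le_max_left _ _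

theorem ramp_le_one (a b x : ℝ) : ramp a b x ≤ 1 := max_le zero_le_one (min_le_left _ _)

theorem ramp_of_le {a b x : ℝ} (hab : a < b) (hx : x ≤ a) : ramp a b x = 1 := by
  have : 1 ≤ (b - x) / (b - a) := by
    rw [le_div_iff₀ (sub_pos.2 hab)]; linarith
  rw [ramp_apply, min_eq_left this, max_eq_right zero_le_one]

theorem ramp_of_ge {a b x : ℝ} (hab : a < b) (hx : b ≤ x) : ramp a b x = 0 := by
  have : (b - x) / (b - a) ≤ 0 :=
    div_nonpos_of_nonpos_of_nonneg (by linarith) (by linarith)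
  rw [ramp_apply, min_eq_right (this.trans zero_le_one), max_eq_left this]

theorem unitMeasure_real_Iic {u : ℝ} (hu : u ∈ Ioo 0 1) : unitMeasure.real (Iic u) = u := by
  rw [measureReal_def, unitMeasure, Measure.restrict_apply measurableSet_Iic]
  have : Iic u ∩ Ioo 0 1 = Ioc 0 u := by
    ext v
    exact ⟨fun h => ⟨h.2.1, h.1⟩, fun h => ⟨h.2, h.1, h.2.trans_lt hu.2⟩⟩
  rw [this, Real.volume_Ioc, sub_zero, ENNReal.toReal_ofReal hu.1.le]

section QuantileConvergence

variable {μ : Measure ℝ} [IsProbabilityMeasure μ] {f : ℕ → ℝ → ℝ}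

theorem integrable_bcf_comp {g : ℝ → ℝ} (hg : AEMeasurable g unitMeasure)
    (φ : BoundedContinuousFunction ℝ ℝ) : Integrable (fun u => φ (g u)) unitMeasure :=
  Integrable.of_bound (φ.continuous.measurable.comp_aemeasurable hg).aestronglyMeasurable ‖φ‖
    (Eventually.of_forall fun _ => φ.norm_coe_le_norm _)

theorem indicator_one_integral (s : Set ℝ) (hs : MeasurableSet s) (m : Measure ℝ) :
    ∫ x, s.indicator (fun _ => (1 : ℝ)) x ∂m = m.real s := by
  rw [integral_indicator hs, setIntegral_const, smul_eq_mul, mul_one]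

/-- Weak convergence implies convergence of quantile functions at continuity points. -/
theorem tendsto_of_weak (hmono : ∀ n, MonotoneOn (f n) (Ioo 0 1))
    (hweak : ∀ φ : BoundedContinuousFunction ℝ ℝ,
      Tendsto (fun n => ∫ u, φ (f n u) ∂unitMeasure) atTop (𝓝 (∫ t, φ t ∂μ)))
    {u : ℝ} (hu : u ∈ Ioo 0 1) (hc : ContinuousWithinAt (quantile μ) (Ioo 0 1) u) :
    Tendsto (fun n => f n u) atTop (𝓝 (quantile μ u)) := by
  have hmeas : ∀ n, AEMeasurable (f n) unitMeasure := fun n =>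
    aemeasurable_restrict_of_monotoneOn measurableSet_Ioo (hmono n)
  have hind : ∀ {s : Set ℝ}, MeasurableSet s → Integrable (s.indicator (fun _ => (1 : ℝ))) μ :=
    fun hs => (integrable_const 1).indicator hs
  have hind' : ∀ {s : Set ℝ}, MeasurableSet s →
      Integrable (s.indicator (fun _ => (1 : ℝ))) unitMeasure :=
    fun hs => (integrable_const 1).indicator hs
  refine tendsto_order.2 ⟨fun a ha => ?_, fun b hb => ?_⟩
  -- If `f n u ≤ a`, monotonicity makes the ramp equal to `1` on `(0, u]`, so its integral is at
  -- least `u`; its limit is at most `cdf μ a' < u`.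
  · obtain ⟨a', ha1, ha2⟩ := exists_between ha
    have h1 : ∫ t, ramp a a' t ∂μ < u := by
      refine lt_of_le_of_lt ?_ ((lt_quantile_iff hu).1 ha2)
      rw [cdf_eq_real, ← indicator_one_integral _ measurableSet_Iic]
      refine integral_mono ((ramp a a').integrable μ) (hind measurableSet_Iic) fun t => ?_
      by_cases ht : t ∈ Iic a'
      · rw [indicator_of_mem ht]; exact ramp_le_one _ _ _
      · rw [indicator_of_notMem ht, ramp_of_ge ha1 (not_le.1 ht).le]
    filter_upwards [(hweak (ramp a a')).eventually (gt_mem_nhds h1)] with n hn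
    by_contra hle
    rw [not_lt] at hle
    have : u ≤ ∫ v, ramp a a' (f n v) ∂unitMeasure := by
      conv_lhs => rw [← unitMeasure_real_Iic hu, ← indicator_one_integral _ measurableSet_Iic]
      refine integral_mono_ae (hind' measurableSet_Iic) (integrable_bcf_comp (hmeas n) _) ?_
      filter_upwards [ae_unitMeasure_mem] with v hv
      by_cases hvu : v ∈ Iic u
      · rw [indicator_of_mem hvu, ramp_of_le ha1 ((hmono n hv hu hvu).trans hle)]
      · rw [indicator_of_notMem hvu]; exact ramp_nonneg _ _ _
    linarith
  -- Continuity at `u` enters only here: it provides a level `u' > u` whose quantile is still below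
  -- `b`.
  · have hnear : ∀ᶠ v in 𝓝[>] u, quantile μ v < b ∧ v ∈ Ioo u 1 := by
      have h1 : ∀ᶠ v in 𝓝[Ioo 0 1] u, quantile μ v < b := hc.eventually (gt_mem_nhds hb)
      rw [isOpen_Ioo.nhdsWithin_eq hu] at h1
      exact (h1.filter_mono nhdsWithin_le_nhds).and (Ioo_mem_nhdsGT hu.2)
    obtain ⟨u', hu'b, hu'⟩ := hnear.exists
    have hu'1 : u' ∈ Ioo 0 1 := ⟨hu.1.trans hu'.1, hu'.2⟩
    have h1 : u < ∫ t, ramp (quantile μ u') b t ∂μ := by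
      refine hu'.1.trans_le ((le_cdf_quantile (μ := μ) hu'1).trans ?_)
      rw [cdf_eq_real, ← indicator_one_integral _ measurableSet_Iic]
      refine integral_mono (hind measurableSet_Iic) ((ramp (quantile μ u') b).integrable μ) fun t => ?_
      by_cases ht : t ∈ Iic (quantile μ u')
      · rw [indicator_of_mem ht, ramp_of_le hu'b ht]
      · rw [indicator_of_notMem ht]; exact ramp_nonneg _ _ _
    filter_upwards [(hweak (ramp (quantile μ u') b)).eventually (lt_mem_nhds h1)] with n hn
    by_contra hle
    rw [not_lt] at hle
    have : ∫ v, ramp (quantile μ u') b (f n v) ∂unitMeasure ≤ u := by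
      conv_rhs => rw [← unitMeasure_real_Iic hu, ← indicator_one_integral _ measurableSet_Iic]
      refine integral_mono_ae (integrable_bcf_comp (hmeas n) _) (hind' measurableSet_Iic) ?_
      filter_upwards [ae_unitMeasure_mem] with v hv
      by_cases hvu : v ∈ Iic u
      · rw [indicator_of_mem hvu]; exact ramp_le_one _ _ _
      · rw [indicator_of_notMem hvu,
          ramp_of_ge hu'b (hle.trans (hmono n hu hv (not_le.1 hvu).le))]
    linarith

theorem ae_tendsto_of_weak (hmono : ∀ n, MonotoneOn (f n) (Ioo 0 1))
    (hweak : ∀ φ : BoundedContinuousFunction ℝ ℝ,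
      Tendsto (fun n => ∫ u, φ (f n u) ∂unitMeasure) atTop (𝓝 (∫ t, φ t ∂μ))) :
    ∀ᵐ u ∂unitMeasure, Tendsto (fun n => f n u) atTop (𝓝 (quantile μ u)) := by
  have hc := (monotoneOn_quantile (μ := μ)).countable_not_continuousWithinAt
  have h1 := ae_restrict_of_ae (s := Ioo (0 : ℝ) 1) (hc.ae_notMem volume)
  filter_upwards [ae_unitMeasure_mem, h1] with u hu hu1
  refine tendsto_of_weak hmono hweak hu ?_
  by_contra hn
  exact hu1 ⟨hu, hn⟩

end QuantileConvergence

/-- Almost everywhere convergence together with convergence of the second moments implies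
convergence in `L²`. -/
theorem tendsto_integral_sq_sub_zero {α : Type*} [MeasurableSpace α] {m : Measure α}
    {f : ℕ → α → ℝ} {g : α → ℝ} (hf : ∀ n, MemLp (f n) 2 m) (hg : MemLp g 2 m)
    (hae : ∀ᵐ x ∂m, Tendsto (fun n => f n x) atTop (𝓝 (g x)))
    (hsq : Tendsto (fun n => ∫ x, f n x ^ 2 ∂m) atTop (𝓝 (∫ x, g x ^ 2 ∂m))) :
    Tendsto (fun n => ∫ x, (f n x - g x) ^ 2 ∂m) atTop (𝓝 0) := by
  have hsum : ∀ n, MemLp (fun x => f n x + g x) 2 m := fun n => (hf n).add hg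
  have i1 : ∀ n, Integrable (fun x => (f n x + g x) ^ 2) m := fun n => (hsum n).integrable_sq
  have i2 : ∀ n, Integrable (fun x => f n x ^ 2) m := fun n => (hf n).integrable_sq
  have i3 : Integrable (fun x => g x ^ 2) m := hg.integrable_sq
  -- By the parallelogram identity it suffices to bound `∫ (f n + g)²` from below. Fatou's lemma
  -- gives the asymptotic bound `4 ∫ g²`, which cancels the other two terms.
  have e : ∀ n, ∫ x, (f n x - g x) ^ 2 ∂m =
      2 * (∫ x, f n x ^ 2 ∂m) + 2 * (∫ x, g x ^ 2 ∂m) - ∫ x, (f n x + g x) ^ 2 ∂m := by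
    intro n
    have e1 : ∀ x, (f n x - g x) ^ 2 = 2 * f n x ^ 2 + 2 * g x ^ 2 - (f n x + g x) ^ 2 :=
      fun x => by ring
    simp only [e1]
    have i4 : Integrable (fun x => 2 * f n x ^ 2) m := (i2 n).const_mul 2
    have i5 : Integrable (fun x => 2 * g x ^ 2) m := i3.const_mul 2
    have i6 : Integrable (fun x => 2 * f n x ^ 2 + 2 * g x ^ 2) m := i4.add i5
    rw [integral_sub i6 (i1 n), integral_add i4 i5, integral_const_mul, integral_const_mul]
  have hfatou : ∀ c, c < 4 * ∫ x, g x ^ 2 ∂m → ∀ᶠ n in atTop, c < ∫ x, (f n x + g x) ^ 2 ∂m := by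
    intro c hc
    rcases lt_or_ge c 0 with hc0 | hc0
    · exact Eventually.of_forall fun n => hc0.trans_le (integral_nonneg fun _ => sq_nonneg _)
    have h1 : ∫⁻ x, ENNReal.ofReal ((2 * g x) ^ 2) ∂m ≤
        liminf (fun n => ∫⁻ x, ENNReal.ofReal ((f n x + g x) ^ 2) ∂m) atTop := by
      refine le_trans (le_of_eq (lintegral_congr_ae ?_))
        (lintegral_liminf_le' fun n => (i1 n).1.aemeasurable.ennreal_ofReal)
      filter_upwards [hae] with x hx
      have hx1 : Tendsto (fun n => (f n x + g x) ^ 2) atTop (𝓝 ((2 * g x) ^ 2)) := by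
        rw [two_mul]; exact (hx.add_const _).pow 2
      exact (ENNReal.tendsto_ofReal hx1).liminf_eq.symm
    have h2 : ENNReal.ofReal c < ∫⁻ x, ENNReal.ofReal ((2 * g x) ^ 2) ∂m := by
      have i4 : Integrable (fun x => (2 * g x) ^ 2) m := by
        simpa only [mul_pow] using i3.const_mul _
      rw [← ofReal_integral_eq_lintegral_ofReal i4 (Eventually.of_forall fun _ => sq_nonneg _)]
      have e2 : ∫ x, (2 * g x) ^ 2 ∂m = 4 * ∫ x, g x ^ 2 ∂m := by
        rw [← integral_const_mul]
        exact integral_congr_ae (Eventually.of_forall fun x => by ring)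
      rw [e2]
      exact (ENNReal.ofReal_lt_ofReal_iff_of_nonneg hc0).2 hc
    filter_upwards [eventually_lt_of_lt_liminf (h2.trans_le h1)] with n hn
    rw [← ofReal_integral_eq_lintegral_ofReal (i1 n) (Eventually.of_forall fun _ => sq_nonneg _)]
      at hn
    exact (ENNReal.ofReal_lt_ofReal_iff_of_nonneg hc0).1 hn
  refine tendsto_order.2 ⟨fun a ha => ?_, fun b hb => ?_⟩
  · exact Eventually.of_forall fun n => ha.trans_le (integral_nonneg fun _ => sq_nonneg _)
  · have h1 := hfatou (4 * (∫ x, g x ^ 2 ∂m) - b / 2) (by linarith)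
    have h2 := hsq.eventually (gt_mem_nhds (show ∫ x, g x ^ 2 ∂m < (∫ x, g x ^ 2 ∂m) + b / 4 by
      linarith))
    filter_upwards [h1, h2] with n hn1 hn2
    rw [e n]
    linarith

/-- Non-decreasing functions on the unit interval whose laws converge to `μ`, together with the
second moments, converge in `L²` to the quantile function of `μ`. -/
theorem tendsto_integral_sq_sub_quantile {μ : Measure ℝ} [IsProbabilityMeasure μ]
    (hμ : Integrable (fun t : ℝ => t ^ 2) μ) {f : ℕ → ℝ → ℝ}
    (hmono : ∀ n, MonotoneOn (f n) (Ioo 0 1)) (hf : ∀ n, MemLp (f n) 2 unitMeasure)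
    (hweak : ∀ φ : BoundedContinuousFunction ℝ ℝ,
      Tendsto (fun n => ∫ u, φ (f n u) ∂unitMeasure) atTop (𝓝 (∫ t, φ t ∂μ)))
    (hsq : Tendsto (fun n => ∫ u, f n u ^ 2 ∂unitMeasure) atTop (𝓝 (∫ t, t ^ 2 ∂μ))) :
    Tendsto (fun n => ∫ u, (f n u - quantile μ u) ^ 2 ∂unitMeasure) atTop (𝓝 0) := by
  refine tendsto_integral_sq_sub_zero hf (memLp_quantile hμ) (ae_tendsto_of_weak hmono hweak) ?_
  rwa [integral_comp_quantile (f := fun t : ℝ => t ^ 2) hμ.aestronglyMeasurable]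

/-! ### Cauchy-Schwarz and products of `L²`-convergent sequences -/

section CauchySchwarz

variable {α : Type*} [MeasurableSpace α] {m : Measure α}

theorem sq_integral_mul_le {f g : α → ℝ} (hf : MemLp f 2 m) (hg : MemLp g 2 m) :
    (∫ x, f x * g x ∂m) ^ 2 ≤ (∫ x, f x ^ 2 ∂m) * ∫ x, g x ^ 2 ∂m := by
  have i1 : Integrable (fun x => f x ^ 2) m := hf.integrable_sq
  have i2 : Integrable (fun x => g x ^ 2) m := hg.integrable_sq
  have i3 : Integrable (fun x => f x * g x) m := hf.integrable_mul hg
  have h : ∀ t : ℝ, 0 ≤ (∫ x, g x ^ 2 ∂m) * (t * t) + (2 * ∫ x, f x * g x ∂m) * t +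
      ∫ x, f x ^ 2 ∂m := by
    intro t
    have h0 : 0 ≤ ∫ x, (f x + t * g x) ^ 2 ∂m := integral_nonneg fun _ => sq_nonneg _
    have e : ∀ x, (f x + t * g x) ^ 2 = f x ^ 2 + (2 * t * (f x * g x) + t ^ 2 * g x ^ 2) :=
      fun x => by ring
    have i4 : Integrable (fun x => 2 * t * (f x * g x)) m := i3.const_mul _
    have i5 : Integrable (fun x => t ^ 2 * g x ^ 2) m := i2.const_mul _
    have i6 : Integrable (fun x => 2 * t * (f x * g x) + t ^ 2 * g x ^ 2) m := i4.add i5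
    simp only [e] at h0
    rw [integral_add i1 i6, integral_add i4 i5, integral_const_mul, integral_const_mul] at h0
    linarith
  have := discrim_le_zero h
  rw [discrim] at this
  linarith

theorem abs_integral_mul_le {f g : α → ℝ} (hf : MemLp f 2 m) (hg : MemLp g 2 m) :
    |∫ x, f x * g x ∂m| ≤ √(∫ x, f x ^ 2 ∂m) * √(∫ x, g x ^ 2 ∂m) := by
  rw [← Real.sqrt_mul (integral_nonneg fun _ => sq_nonneg _)]
  exact Real.abs_le_sqrt (sq_integral_mul_le hf hg)

theorem tendsto_integral_mul {f g : ℕ → α → ℝ} {f' g' : α → ℝ} (hf : ∀ n, MemLp (f n) 2 m)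
    (hg : ∀ n, MemLp (g n) 2 m) (hf' : MemLp f' 2 m) (hg' : MemLp g' 2 m)
    (h1 : Tendsto (fun n => ∫ x, (f n x - f' x) ^ 2 ∂m) atTop (𝓝 0))
    (h2 : Tendsto (fun n => ∫ x, (g n x - g' x) ^ 2 ∂m) atTop (𝓝 0)) :
    Tendsto (fun n => ∫ x, f n x * g n x ∂m) atTop (𝓝 (∫ x, f' x * g' x ∂m)) := by
  have d1 : ∀ n, MemLp (fun x => f n x - f' x) 2 m := fun n => (hf n).sub hf'
  have d2 : ∀ n, MemLp (fun x => g n x - g' x) 2 m := fun n => (hg n).sub hg'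
  have s1 := h1.sqrt
  have s2 := h2.sqrt
  rw [Real.sqrt_zero] at s1 s2
  have hz : ∀ {F : ℕ → ℝ} {B : ℕ → ℝ}, (∀ n, |F n| ≤ B n) → Tendsto B atTop (𝓝 0) →
      Tendsto F atTop (𝓝 0) := fun hF hB =>
    squeeze_zero_norm (fun n => by rw [Real.norm_eq_abs]; exact hF n) hB
  have t1 : Tendsto (fun n => ∫ x, (f n x - f' x) * (g n x - g' x) ∂m) atTop (𝓝 0) :=
    hz (fun n => abs_integral_mul_le (d1 n) (d2 n)) (by simpa using s1.mul s2)
  have t2 : Tendsto (fun n => ∫ x, (f n x - f' x) * g' x ∂m) atTop (𝓝 0) :=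
    hz (fun n => abs_integral_mul_le (d1 n) hg') (by simpa using s1.mul_const _)
  have t3 : Tendsto (fun n => ∫ x, f' x * (g n x - g' x) ∂m) atTop (𝓝 0) :=
    hz (fun n => abs_integral_mul_le hf' (d2 n)) (by simpa using s2.const_mul _)
  have t4 := ((t1.add t2).add t3).add_const (∫ x, f' x * g' x ∂m)
  rw [add_zero, add_zero, zero_add] at t4
  refine t4.congr fun n => ?_
  have i1 : Integrable (fun x => (f n x - f' x) * (g n x - g' x)) m := (d1 n).integrable_mul (d2 n)
  have i2 : Integrable (fun x => (f n x - f' x) * g' x) m := (d1 n).integrable_mul hg'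
  have i3 : Integrable (fun x => f' x * (g n x - g' x)) m := hf'.integrable_mul (d2 n)
  have i4 : Integrable (fun x => f' x * g' x) m := hf'.integrable_mul hg'
  have i5 : Integrable (fun x => (f n x - f' x) * (g n x - g' x) + (f n x - f' x) * g' x) m :=
    i1.add i2
  have i6 : Integrable (fun x => (f n x - f' x) * (g n x - g' x) + (f n x - f' x) * g' x +
    f' x * (g n x - g' x)) m := i5.add i3
  rw [← integral_add i1 i2, ← integral_add i5 i3, ← integral_add i6 i4]
  exact integral_congr_ae (Eventually.of_forall fun x => by ring)

theorem tendsto_integral_sq_add {f g : ℕ → α → ℝ} (hf : ∀ n, MemLp (f n) 2 m)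
    (hg : ∀ n, MemLp (g n) 2 m) (h1 : Tendsto (fun n => ∫ x, f n x ^ 2 ∂m) atTop (𝓝 0))
    (h2 : Tendsto (fun n => ∫ x, g n x ^ 2 ∂m) atTop (𝓝 0)) :
    Tendsto (fun n => ∫ x, (f n x + g n x) ^ 2 ∂m) atTop (𝓝 0) := by
  have h3 : Tendsto (fun n => 2 * (∫ x, f n x ^ 2 ∂m) + 2 * ∫ x, g n x ^ 2 ∂m) atTop (𝓝 0) := by
    simpa using (h1.const_mul 2).add (h2.const_mul 2)
  refine squeeze_zero (fun n => integral_nonneg fun _ => sq_nonneg _) (fun n => ?_) h3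
  have i1 : Integrable (fun x => 2 * f n x ^ 2) m := (hf n).integrable_sq.const_mul 2
  have i2 : Integrable (fun x => 2 * g n x ^ 2) m := (hg n).integrable_sq.const_mul 2
  rw [← integral_const_mul, ← integral_const_mul, ← integral_add i1 i2]
  refine integral_mono ((hf n).add (hg n)).integrable_sq (i1.add i2) fun x => ?_
  simp only
  nlinarith [sq_nonneg (f n x - g n x)]

/-- Changing the argument costs at most the `L²` distance by the common Lipschitz bound; changing
the function at a fixed argument is dominated by `4 f'²`. -/
theorem tendsto_integral_sq_shrinkage {η : ℕ → ℝ → ℝ} {η' : ℝ → ℝ} (hη : ∀ n, IsShrinkage (η n))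
    (hη' : IsShrinkage η') (hlim : ∀ y, Tendsto (fun n => η n y) atTop (𝓝 (η' y)))
    {f : ℕ → α → ℝ} {f' : α → ℝ} (hf : ∀ n, MemLp (f n) 2 m) (hf' : MemLp f' 2 m)
    (h : Tendsto (fun n => ∫ x, (f n x - f' x) ^ 2 ∂m) atTop (𝓝 0)) :
    Tendsto (fun n => ∫ x, (η n (f n x) - η' (f' x)) ^ 2 ∂m) atTop (𝓝 0) := by
  have l1 : ∀ n, MemLp (fun x => η n (f n x)) 2 m := fun n => (hη n).memLp_comp (hf n)
  have l2 : ∀ n, MemLp (fun x => η n (f' x)) 2 m := fun n => (hη n).memLp_comp hf'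
  have l3 : MemLp (fun x => η' (f' x)) 2 m := hη'.memLp_comp hf'
  have d1 : ∀ n, MemLp (fun x => η n (f n x) - η n (f' x)) 2 m := fun n => (l1 n).sub (l2 n)
  have d2 : ∀ n, MemLp (fun x => η n (f' x) - η' (f' x)) 2 m := fun n => (l2 n).sub l3
  have t1 : Tendsto (fun n => ∫ x, (η n (f n x) - η n (f' x)) ^ 2 ∂m) atTop (𝓝 0) := by
    refine squeeze_zero (fun n => integral_nonneg fun _ => sq_nonneg _) (fun n => ?_) h
    refine integral_mono (d1 n).integrable_sq ((hf n).sub hf').integrable_sq fun x => ?_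
    exact sq_le_sq.2 ((hη n).abs_sub_le _ _)
  have t2 : Tendsto (fun n => ∫ x, (η n (f' x) - η' (f' x)) ^ 2 ∂m) atTop (𝓝 0) := by
    have hb : Integrable (fun x => 4 * f' x ^ 2) m := hf'.integrable_sq.const_mul 4
    have := tendsto_integral_of_dominated_convergence (μ := m)
      (F := fun n x => (η n (f' x) - η' (f' x)) ^ 2) (f := fun _ => 0) (fun x => 4 * f' x ^ 2)
      (fun n => (d2 n).integrable_sq.1) hb (fun n => Eventually.of_forall fun x => ?_)
      (Eventually.of_forall fun x => ?_)
    · simpa using this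
    · rw [Real.norm_eq_abs, abs_of_nonneg (sq_nonneg _)]
      have e : 4 * f' x ^ 2 = (2 * f' x) ^ 2 := by ring
      rw [e, sq_le_sq, abs_mul, abs_two]
      have h1 := (hη n).abs_le (f' x)
      have h2 := hη'.abs_le (f' x)
      exact (abs_sub _ _).trans (by linarith)
    · simpa using ((hlim (f' x)).sub_const (η' (f' x))).pow 2
  refine (tendsto_integral_sq_add d1 d2 t1 t2).congr fun n => ?_
  exact integral_congr_ae (Eventually.of_forall fun x => by ring)

end CauchySchwarz

/-! ### Compactness of shrinkage functions -/

/-- Values at rationals lie in compact intervals, so Tychonoff's theorem gives a subsequence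
converging at every rational. The common Lipschitz bound extends this to all points. -/
theorem exists_tendsto_subseq_shrinkage {η : ℕ → ℝ → ℝ} (hη : ∀ n, IsShrinkage (η n)) :
    ∃ η' : ℝ → ℝ, IsShrinkage η' ∧ ∃ k : ℕ → ℕ, StrictMono k ∧
      ∀ y, Tendsto (fun n => η (k n) y) atTop (𝓝 (η' y)) := by
  have hK : IsCompact (Set.pi univ fun r : ℚ => Icc (-|(r : ℝ)|) |(r : ℝ)|) :=
    isCompact_univ_pi fun _ => isCompact_Icc
  obtain ⟨g, -, k, hk, hlim⟩ := hK.tendsto_subseq (x := fun n (r : ℚ) => η n r)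
    (fun n r _ => abs_le.1 ((hη n).abs_le r))
  rw [tendsto_pi_nhds] at hlim
  have hex : ∀ y, ∃ z, Tendsto (fun n => η (k n) y) atTop (𝓝 z) := by
    intro y
    refine cauchySeq_tendsto_of_complete (Metric.cauchySeq_iff'.2 fun ε hε => ?_)
    obtain ⟨r, hr⟩ := exists_rat_near y (show 0 < ε / 4 by linarith)
    obtain ⟨N, hN⟩ := Metric.cauchySeq_iff'.1 (hlim r).cauchySeq (ε / 4) (by linarith)
    refine ⟨N, fun n hn => ?_⟩
    have h1 := hN n hn
    simp only [Function.comp_apply] at h1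
    rw [Real.dist_eq] at h1 ⊢
    have h2 := (hη (k n)).abs_sub_le y r
    have h3 := (hη (k N)).abs_sub_le r y
    rw [abs_sub_comm] at h3
    have h4 := abs_sub_comm (η (k N) y) (η (k N) r)
    have h5 := abs_sub_comm (r : ℝ) y
    have e : η (k n) y - η (k N) y = (η (k n) y - η (k n) r) +
        ((η (k n) r - η (k N) r) + (η (k N) r - η (k N) y)) := by ring
    rw [e]
    refine (abs_add_le _ _).trans_lt ?_
    have h6 := abs_add_le (η (k n) r - η (k N) r) (η (k N) r - η (k N) y)
    linarith
  choose η' hη' using hex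
  refine ⟨η', ⟨fun t => ?_, fun x y hxy => ?_, ?_⟩, k, hk, hη'⟩
  · refine tendsto_nhds_unique (hη' (-t)) ?_
    simpa only [(hη _).odd] using (hη' t).neg
  · exact le_of_tendsto_of_tendsto' (hη' x) (hη' y) fun n => (hη (k n)).mono hxy
  · refine LipschitzWith.of_dist_le_mul fun x y => ?_
    exact le_of_tendsto' ((hη' x).dist (hη' y)) fun n => (hη (k n)).lipschitz.dist_le_mul x y

/-! ### Existence of optimal shrinkage functions -/

/-- Rounding down to the grid of mesh `1 / (n + 1)` in `[0, n + 1]`. -/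
noncomputable def gridFloor (n : ℕ) (y : ℝ) : ℝ :=
  (min ⌊y * ((n : ℝ) + 1)⌋₊ ((n + 1) * (n + 1)) : ℕ) / ((n : ℝ) + 1)

theorem gridFloor_nonneg (n : ℕ) (y : ℝ) : 0 ≤ gridFloor n y := by
  unfold gridFloor; positivity

theorem gridFloor_le (n : ℕ) {y : ℝ} (hy : 0 ≤ y) : gridFloor n y ≤ y := by
  have hn : (0 : ℝ) < (n : ℝ) + 1 := by positivity
  rw [gridFloor, div_le_iff₀ hn]
  refine le_trans ?_ (Nat.floor_le (mul_nonneg hy hn.le))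
  exact_mod_cast min_le_left _ _

theorem measurable_gridFloor (n : ℕ) : Measurable (gridFloor n) := by
  unfold gridFloor
  refine Measurable.div_const ?_ _
  have h : Measurable fun y : ℝ => min ⌊y * ((n : ℝ) + 1)⌋₊ ((n + 1) * (n + 1)) :=
    (Nat.measurable_floor.comp (measurable_id.mul_const _)).min measurable_const
  exact measurable_from_top.comp h

theorem tendsto_gridFloor {y : ℝ} (hy : 0 ≤ y) :
    Tendsto (fun n => gridFloor n y) atTop (𝓝 y) := by
  have h1 : Tendsto (fun n : ℕ => (n : ℝ) + 1) atTop atTop :=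
    tendsto_atTop_add_const_right _ _ tendsto_natCast_atTop_atTop
  refine ((tendsto_nat_floor_mul_div_atTop hy).comp h1).congr' ?_
  filter_upwards [eventually_ge_atTop ⌈y⌉₊] with n hn
  have hyn : y ≤ n := Nat.ceil_le.1 hn
  simp only [Function.comp_apply, gridFloor]
  rw [min_eq_left]
  refine Nat.floor_le_of_le ?_
  push_cast
  exact mul_le_mul_of_nonneg_right (by linarith) (by positivity)

theorem gridFloor_mem (n : ℕ) (y : ℝ) : gridFloor n y ∈
    (((Finset.range ((n + 1) * (n + 1) + 1)).image fun i : ℕ => (i : ℝ) / ((n : ℝ) + 1) :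
      Finset ℝ) : Set ℝ) := by
  rw [Finset.coe_image]
  exact ⟨_, Finset.mem_coe.2 (Finset.mem_range.2 (Nat.lt_succ_of_le (min_le_right _ _))), rfl⟩

/-- If `ν` is carried by a finite set then `G₀` has finitely many monotonicity intervals. -/
theorem hasFinitelyManyMDIs_of_finite {ν μl : Measure ℝ} [IsProbabilityMeasure ν]
    [IsProbabilityMeasure μl] {A : Finset ℝ} (hA : ν (A : Set ℝ)ᶜ = 0) :
    HasFinitelyManyMDIs ν (initialG ν μl) := by
  -- Between points of `A` the distribution function, hence `λ`, is constant, and `G₀` has slope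
  -- one.
  refine ⟨A, fun C _ hC hdis => Or.inl fun x hx y hy hxy => ?_⟩
  have h0 : ν (Icc x y) = 0 :=
    measure_mono_null (fun z hz hzA => disjoint_left.1 hdis (hC.out hx hy hz) hzA) hA
  rw [initialG, initialG, lamFun_eq_of_measure_Icc_eq_zero h0 ⟨le_rfl, hxy⟩,
    lamFun_eq_of_measure_Icc_eq_zero h0 ⟨hxy, le_rfl⟩]
  linarith

/-! ### Optimal functions for general laws by discretization -/

section Existence

variable {ν μl : Measure ℝ} [IsProbabilityMeasure ν] [IsProbabilityMeasure μl]

/-- Residuals converge in `L²`. The tail condition pairs them with a fixed indicator and the slack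
condition with `η n ∘ quantile (ν' n)`, which converges in `L²` too, so both survive the limit. -/
theorem IsOptimalShrinkage.of_tendsto {ν' : ℕ → Measure ℝ} [∀ n, IsProbabilityMeasure (ν' n)]
    (hy : Integrable (fun t : ℝ => t ^ 2) ν) (hy' : ∀ n, Integrable (fun t : ℝ => t ^ 2) (ν' n))
    (hl : Integrable (fun t : ℝ => t ^ 2) μl) {η : ℕ → ℝ → ℝ} {η' : ℝ → ℝ}
    (hη : ∀ n, IsOptimalShrinkage (ν' n) μl (η n)) (hη' : IsShrinkage η')
    (hlim : ∀ y, Tendsto (fun n => η n y) atTop (𝓝 (η' y)))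
    (hq : Tendsto (fun n => ∫ u, (quantile (ν' n) u - quantile ν u) ^ 2 ∂unitMeasure) atTop (𝓝 0)) :
    IsOptimalShrinkage ν μl η' := by
  have q1 : ∀ n, MemLp (quantile (ν' n)) 2 unitMeasure := fun n => memLp_quantile (hy' n)
  have q2 : MemLp (quantile ν) 2 unitMeasure := memLp_quantile hy
  have q3 : MemLp (quantile μl) 2 unitMeasure := memLp_quantile hl
  have e1 : ∀ n, MemLp (fun u => η n (quantile (ν' n) u)) 2 unitMeasure :=
    fun n => (hη n).toIsShrinkage.memLp_comp (q1 n)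
  have e2 : MemLp (fun u => η' (quantile ν u)) 2 unitMeasure := hη'.memLp_comp q2
  have d1 : ∀ n, MemLp (fun u => quantile (ν' n) u - η n (quantile (ν' n) u) - quantile μl u) 2
    unitMeasure := fun n => ((q1 n).sub (e1 n)).sub q3
  have d2 : MemLp (fun u => quantile ν u - η' (quantile ν u) - quantile μl u) 2 unitMeasure :=
    (q2.sub e2).sub q3
  have t1 := tendsto_integral_sq_shrinkage (fun n => (hη n).toIsShrinkage) hη' hlim q1 q2 hq
  have t2 : Tendsto (fun n => ∫ u, ((quantile (ν' n) u - η n (quantile (ν' n) u) - quantile μl u) -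
      (quantile ν u - η' (quantile ν u) - quantile μl u)) ^ 2 ∂unitMeasure) atTop (𝓝 0) := by
    have f1 : ∀ n, MemLp (fun u => quantile (ν' n) u - quantile ν u) 2 unitMeasure :=
      fun n => (q1 n).sub q2
    have f2 : ∀ n, MemLp (fun u => η' (quantile ν u) - η n (quantile (ν' n) u)) 2 unitMeasure :=
      fun n => e2.sub (e1 n)
    have t3 : Tendsto (fun n => ∫ u, (η' (quantile ν u) - η n (quantile (ν' n) u)) ^ 2
        ∂unitMeasure) atTop (𝓝 0) :=
      t1.congr fun n => integral_congr_ae (Eventually.of_forall fun u => by ring)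
    refine (tendsto_integral_sq_add f1 f2 hq t3).congr fun n => ?_
    exact integral_congr_ae (Eventually.of_forall fun u => by ring)
  refine ⟨hη', fun a ha => ?_, ?_⟩
  · have hs : Ioo a 1 ⊆ Ioo (0 : ℝ) 1 := Ioo_subset_Ioo_left ha.1
    have hind : MemLp ((Ioo a 1).indicator fun _ => (1 : ℝ)) 2 unitMeasure :=
      (memLp_const 1).indicator measurableSet_Ioo
    have t4 := tendsto_integral_mul d1 (fun _ => hind) d2 hind t2 (by simp)
    have e : ∀ F : ℝ → ℝ, ∫ u, F u * (Ioo a 1).indicator (fun _ => (1 : ℝ)) u ∂unitMeasure =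
        ∫ u in Ioo a 1, F u := by
      intro F
      rw [← setIntegral_unitMeasure measurableSet_Ioo hs, ← integral_indicator measurableSet_Ioo]
      refine integral_congr_ae (Eventually.of_forall fun u => ?_)
      by_cases hu : u ∈ Ioo a 1 <;> simp [hu]
    simp only [e] at t4
    exact le_of_tendsto' t4 fun n => (hη n).tail a ha
  · have t4 := tendsto_integral_mul d1 e1 d2 e2 t2 t1
    simp only [(hη _).slack] at t4
    exact tendsto_nhds_unique t4 tendsto_const_nhds

/-- Optimal shrinkage functions exist. -/
theorem exists_isOptimalShrinkage (hν : ν (Iio 0) = 0) (hy : Integrable (fun t : ℝ => t ^ 2) ν)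
    (hl : Integrable (fun t : ℝ => t ^ 2) μl) (hl0 : μl (Iio 0) = 0) :
    ∃ η, IsOptimalShrinkage ν μl η := by
  have hm := measurable_gridFloor
  have hp : ∀ n, IsProbabilityMeasure (ν.map (gridFloor n)) :=
    fun n => Measure.isProbabilityMeasure_map (hm n).aemeasurable
  have hae : ∀ᵐ y ∂ν, 0 ≤ y := (ae_mem_massRange hν).mono fun y hy => hy.1
  have hsq : ∀ n, Integrable (fun y => gridFloor n y ^ 2) ν := by
    intro n
    refine hy.mono' ((hm n).pow_const 2).aestronglyMeasurable ?_
    filter_upwards [hae] with y hy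
    rw [Real.norm_eq_abs, abs_of_nonneg (sq_nonneg _)]
    exact pow_le_pow_left₀ (gridFloor_nonneg n y) (gridFloor_le n hy) 2
  have hy' : ∀ n, Integrable (fun t : ℝ => t ^ 2) (ν.map (gridFloor n)) := fun n =>
    (integrable_map_measure (measurable_id.pow_const 2).aestronglyMeasurable
      (hm n).aemeasurable).2 (hsq n)
  have hnull : ∀ n, ν.map (gridFloor n) (Iio 0) = 0 := by
    intro n
    rw [Measure.map_apply (hm n) measurableSet_Iio]
    convert measure_empty (μ := ν)
    exact eq_empty_of_forall_notMem fun y hy => absurd hy (not_lt.2 (gridFloor_nonneg n y))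
  have hfin : ∀ n, HasFinitelyManyMDIs (ν.map (gridFloor n))
      (initialG (ν.map (gridFloor n)) μl) := by
    intro n
    refine hasFinitelyManyMDIs_of_finite (A := (Finset.range ((n + 1) * (n + 1) + 1)).image
      fun i : ℕ => (i : ℝ) / ((n : ℝ) + 1)) ?_
    rw [Measure.map_apply (hm n) (Finset.measurableSet _).compl]
    convert measure_empty (μ := ν)
    exact eq_empty_of_forall_notMem fun y hy => hy (gridFloor_mem n y)
  have hη : ∀ n, ∃ η, IsOptimalShrinkage (ν.map (gridFloor n)) μl η := by
    intro n
    obtain ⟨G, hr, hG⟩ := exists_poolOutput (hnull n)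
      (isPoolStart_initialG (hnull n) (hy' n) hl hl0) (hfin n)
    exact ⟨_, isOptimalShrinkage_scalarOfG (hnull n) (hy' n) hl hl0 hr hG⟩
  choose η hη using hη
  have hq : Tendsto (fun n => ∫ u, (quantile (ν.map (gridFloor n)) u - quantile ν u) ^ 2
      ∂unitMeasure) atTop (𝓝 0) := by
    refine tendsto_integral_sq_sub_quantile hy (fun n => monotoneOn_quantile)
      (fun n => memLp_quantile (hy' n)) (fun φ => ?_) ?_
    · have e : ∀ n, ∫ u, φ (quantile (ν.map (gridFloor n)) u) ∂unitMeasure =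
          ∫ y, φ (gridFloor n y) ∂ν := by
        intro n
        rw [integral_comp_quantile φ.continuous.aestronglyMeasurable,
          integral_map (hm n).aemeasurable φ.continuous.aestronglyMeasurable]
      simp only [e]
      refine tendsto_integral_of_dominated_convergence (fun _ => ‖φ‖) (fun n => ?_)
        (integrable_const _) (fun n => Eventually.of_forall fun y => φ.norm_coe_le_norm _) ?_
      · exact (φ.continuous.measurable.comp (hm n)).aestronglyMeasurable
      · filter_upwards [hae] with y hy
        exact (φ.continuous.tendsto y).comp (tendsto_gridFloor hy)
    · have e : ∀ n, ∫ u, quantile (ν.map (gridFloor n)) u ^ 2 ∂unitMeasure =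
          ∫ y, gridFloor n y ^ 2 ∂ν := by
        intro n
        rw [integral_comp_quantile (f := fun t : ℝ => t ^ 2) (hy' n).aestronglyMeasurable,
          integral_map (hm n).aemeasurable (hy' n).aestronglyMeasurable]
      simp only [e]
      refine tendsto_integral_of_dominated_convergence (fun y => y ^ 2)
        (fun n => (hsq n).aestronglyMeasurable) hy (fun n => ?_) ?_
      · filter_upwards [hae] with y hy
        rw [Real.norm_eq_abs, abs_of_nonneg (sq_nonneg _)]
        exact pow_le_pow_left₀ (gridFloor_nonneg n y) (gridFloor_le n hy) 2
      · filter_upwards [hae] with y hy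
        exact (tendsto_gridFloor hy).pow 2
  obtain ⟨η', hη', k, hk, hlim⟩ :=
    exists_tendsto_subseq_shrinkage fun n => (hη n).toIsShrinkage
  exact ⟨η', .of_tendsto hy (fun n => hy' (k n)) hl (fun n => hη (k n)) hη' hlim
    (hq.comp hk.tendsto_atTop)⟩

end Existence

/-! ### Vectors as step functions on the unit interval -/

/-- The step function on `(0, 1)` that takes the value `a i` on `[i / p, (i + 1) / p)`. -/
noncomputable def stepFun {p : ℕ} (a : Fin p → ℝ) (u : ℝ) : ℝ :=
  if h : ⌊(p : ℝ) * u⌋₊ < p then a ⟨⌊(p : ℝ) * u⌋₊, h⟩ else 0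

section StepFun

variable {p : ℕ}

theorem floor_mul_lt (hp : 0 < p) {u : ℝ} (hu : u ∈ Ioo (0 : ℝ) 1) : ⌊(p : ℝ) * u⌋₊ < p := by
  have hp' : (0 : ℝ) < p := Nat.cast_pos.2 hp
  rw [Nat.floor_lt (mul_nonneg hp'.le hu.1.le)]
  exact mul_lt_of_lt_one_right hp' hu.2

theorem stepFun_apply (hp : 0 < p) (a : Fin p → ℝ) {u : ℝ} (hu : u ∈ Ioo (0 : ℝ) 1) :
    stepFun a u = a ⟨⌊(p : ℝ) * u⌋₊, floor_mul_lt hp hu⟩ :=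
  dif_pos _

theorem stepFun_of_eq_zero (hp : p = 0) (a : Fin p → ℝ) (u : ℝ) : stepFun a u = 0 := by
  subst hp
  exact dif_neg (Nat.not_lt_zero _)

theorem monotoneOn_stepFun {a : Fin p → ℝ} (ha : Monotone a) :
    MonotoneOn (stepFun a) (Ioo 0 1) := by
  intro u hu v hv huv
  rcases p.eq_zero_or_pos with hp | hp
  · rw [stepFun_of_eq_zero hp, stepFun_of_eq_zero hp]
  · rw [stepFun_apply hp a hu, stepFun_apply hp a hv]
    exact ha (Nat.floor_le_floor (mul_le_mul_of_nonneg_left huv (Nat.cast_nonneg p)))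

theorem stepFun_ae_eq_sum (hp : 0 < p) (a : Fin p → ℝ) :
    stepFun a =ᵐ[unitMeasure] fun u => ∑ i : Fin p,
      (Ico ((i : ℝ) / p) (((i : ℝ) + 1) / p)).indicator (fun _ => a i) u := by
  have hp' : (0 : ℝ) < p := Nat.cast_pos.2 hp
  filter_upwards [ae_unitMeasure_mem] with u hu
  have hpu : 0 ≤ (p : ℝ) * u := mul_nonneg hp'.le hu.1.le
  have hiff : ∀ i : Fin p, u ∈ Ico ((i : ℝ) / p) (((i : ℝ) + 1) / p) ↔
      ⟨⌊(p : ℝ) * u⌋₊, floor_mul_lt hp hu⟩ = i := by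
    intro i
    rw [mem_Ico, div_le_iff₀ hp', lt_div_iff₀ hp', Fin.ext_iff, Nat.floor_eq_iff hpu, mul_comm u]
  rw [stepFun_apply hp a hu, Finset.sum_eq_single ⟨⌊(p : ℝ) * u⌋₊, floor_mul_lt hp hu⟩]
  · rw [indicator_of_mem ((hiff _).2 rfl)]
  · intro i _ hi
    rw [indicator_of_notMem fun h => hi ((hiff i).1 h).symm]
  · intro h
    exact absurd (Finset.mem_univ _) h

theorem memLp_stepFun (a : Fin p → ℝ) : MemLp (stepFun a) 2 unitMeasure := by
  rcases p.eq_zero_or_pos with hp | hp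
  · have : stepFun a = fun _ => (0 : ℝ) := funext fun u => stepFun_of_eq_zero hp a u
    rw [this]
    exact memLp_const 0
  · refine MemLp.ae_eq (stepFun_ae_eq_sum hp a).symm ?_
    exact memLp_finsetSum _ fun i _ => (memLp_const (a i)).indicator measurableSet_Ico

theorem integral_stepFun (a : Fin p → ℝ) : ∫ u, stepFun a u ∂unitMeasure = (∑ i, a i) / p := by
  rcases p.eq_zero_or_pos with hp | hp
  · simp only [stepFun_of_eq_zero hp, integral_zero, hp, Nat.cast_zero, div_zero]
  · have hp' : (0 : ℝ) < p := Nat.cast_pos.2 hp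
    rw [integral_congr_ae (stepFun_ae_eq_sum hp a), integral_finsetSum _ fun i _ =>
      (integrable_const (a i)).indicator measurableSet_Ico, Finset.sum_div]
    refine Finset.sum_congr rfl fun i _ => ?_
    have hsub : Ico ((i : ℝ) / p) (((i : ℝ) + 1) / p) ⊆ Ico 0 1 := by
      refine Ico_subset_Ico (by positivity) ?_
      rw [div_le_one hp']
      exact_mod_cast i.2
    have hvol : unitMeasure.real (Ico ((i : ℝ) / p) (((i : ℝ) + 1) / p)) = 1 / p := by
      rw [measureReal_def, unitMeasure, Measure.restrict_congr_set Ioo_ae_eq_Ico,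
        Measure.restrict_apply measurableSet_Ico, inter_eq_left.2 hsub, Real.volume_Ico,
        ← sub_div, add_sub_cancel_left, ENNReal.toReal_ofReal (by positivity)]
    rw [integral_indicator measurableSet_Ico, setIntegral_const, hvol, smul_eq_mul]
    ring

/-- Pointwise operations commute with the passage to step functions. -/
theorem integral_eq_sum_of_stepFun (hp : 0 < p) {F : ℝ → ℝ} {b : Fin p → ℝ}
    (h : ∀ u (hu : u ∈ Ioo (0 : ℝ) 1), F u = b ⟨⌊(p : ℝ) * u⌋₊, floor_mul_lt hp hu⟩) :
    ∫ u, F u ∂unitMeasure = (∑ i, b i) / p := by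
  rw [← integral_stepFun]
  refine integral_congr_ae ?_
  filter_upwards [ae_unitMeasure_mem] with u hu
  rw [h u hu, stepFun_apply hp b hu]

/-- Nonpositive tail integrals test nonpositively against nonnegative non-decreasing step
functions. -/
theorem integral_mul_stepFun_nonpos (hp : 0 < p) {F : ℝ → ℝ} (hF : MemLp F 2 unitMeasure)
    (htail : ∀ a ∈ Icc (0 : ℝ) 1, ∫ u in Ioo a 1, F u ≤ 0) {x : Fin p → ℝ} (hx : Monotone x)
    (hx0 : ∀ i, 0 ≤ x i) : ∫ u, F u * stepFun x u ∂unitMeasure ≤ 0 := by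
  have hp' : (0 : ℝ) < p := Nat.cast_pos.2 hp
  -- Abel summation: indices are shifted by one so that `X 0 = 0`. All increments are then
  -- nonnegative, the first because `x ≥ 0`, and the step function is a nonnegative combination of
  -- indicators of `[j / p, ∞)`.
  set X : ℕ → ℝ := fun j => if h : 0 < j ∧ j ≤ p then x ⟨j - 1, by omega⟩ else 0 with hX
  have hX0 : X 0 = 0 := dif_neg (by omega)
  have hXs : ∀ j (hj : j < p), X (j + 1) = x ⟨j, hj⟩ := fun j hj => dif_pos ⟨by omega, by omega⟩
  have hd : ∀ j < p, 0 ≤ X (j + 1) - X j := by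
    intro j hj
    rw [hXs j hj]
    rcases j with _ | j
    · rw [hX0, sub_zero]; exact hx0 _
    · rw [hXs j (by omega), sub_nonneg]
      exact hx (Fin.mk_le_mk.2 (Nat.le_succ j))
  have hrep : ∀ u ∈ Ioo (0 : ℝ) 1, stepFun x u =
      ∑ j ∈ Finset.range p, (X (j + 1) - X j) * (Ici ((j : ℝ) / p)).indicator (fun _ => 1) u := by
    intro u hu
    have hlt := floor_mul_lt hp hu
    have hpu : 0 ≤ (p : ℝ) * u := mul_nonneg hp'.le hu.1.le
    rw [stepFun_apply hp x hu, ← hXs _ hlt, ← sub_zero (X (_ + 1)), ← hX0,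
      ← Finset.sum_range_sub X]
    rw [← Finset.sum_subset (Finset.range_subset_range.2 (Nat.succ_le_of_lt hlt))]
    · refine Finset.sum_congr rfl fun j hj => ?_
      rw [Finset.mem_range, Nat.lt_succ_iff, Nat.le_floor_iff hpu] at hj
      rw [indicator_of_mem, mul_one]
      rw [mem_Ici, div_le_iff₀ hp', mul_comm]
      exact hj
    · intro j _ hj
      rw [Finset.mem_range, Nat.lt_succ_iff, Nat.le_floor_iff hpu] at hj
      rw [indicator_of_notMem, mul_zero]
      rw [mem_Ici, div_le_iff₀ hp', mul_comm]
      exact hj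
  have e : ∫ u, F u * stepFun x u ∂unitMeasure = ∫ u, ∑ j ∈ Finset.range p,
      (X (j + 1) - X j) * (Ici ((j : ℝ) / p)).indicator F u ∂unitMeasure := by
    refine integral_congr_ae ?_
    filter_upwards [ae_unitMeasure_mem] with u hu
    rw [hrep u hu, Finset.mul_sum]
    refine Finset.sum_congr rfl fun j _ => ?_
    by_cases h : u ∈ Ici ((j : ℝ) / p)
    · rw [indicator_of_mem h, indicator_of_mem h]; ring
    · rw [indicator_of_notMem h, indicator_of_notMem h]; ring
  have hFi : Integrable F unitMeasure := hF.integrable (by norm_num)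
  rw [e, integral_finsetSum _ fun j _ => (hFi.indicator measurableSet_Ici).const_mul _]
  refine Finset.sum_nonpos fun j hj => ?_
  rw [Finset.mem_range] at hj
  rw [integral_const_mul]
  refine mul_nonpos_of_nonneg_of_nonpos (hd j hj) ?_
  have hj0 : 0 ≤ (j : ℝ) / p := by positivity
  have hj1 : (j : ℝ) / p ≤ 1 := by
    rw [div_le_one hp']; exact_mod_cast hj.le
  rw [integral_indicator measurableSet_Ici, unitMeasure, Measure.restrict_restrict measurableSet_Ici]
  refine le_of_eq_of_le (setIntegral_congr_set ?_) (htail _ ⟨hj0, hj1⟩)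
  filter_upwards [compl_mem_ae_iff.2 (measure_singleton (μ := volume) ((j : ℝ) / p))] with u hu
  refine propext ⟨fun h => ⟨lt_of_le_of_ne h.1 (Ne.symm hu), h.2.2⟩, fun h => ⟨h.1.le, ?_, h.2⟩⟩
  exact lt_of_le_of_lt hj0 h.1

end StepFun

/-! ### Order statistics and the objective -/

section OrderStat

variable {p : ℕ}

theorem monotone_orderStat (a : Fin p → ℝ) : Monotone (orderStat a) := Tuple.monotone_sort a

theorem sum_comp_orderStat (a : Fin p → ℝ) (φ : ℝ → ℝ) :
    ∑ i, φ (orderStat a i) = ∑ i, φ (a i) :=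
  Equiv.sum_comp (Tuple.sort a) fun i => φ (a i)

/-- The permutation sorting `a` also sorts `φ ∘ a`. Ties may lead to a different sorting
permutation, but not to a different sorted vector. -/
theorem orderStat_comp {φ : ℝ → ℝ} (hφ : Monotone φ) (a : Fin p → ℝ) (i : Fin p) :
    orderStat (fun j => φ (a j)) i = φ (orderStat a i) := by
  have h : (fun j => φ (a j)) ∘ Tuple.sort a =
      (fun j => φ (a j)) ∘ Tuple.sort (fun j => φ (a j)) :=
    Tuple.comp_sort_eq_comp_iff_monotone.2 (hφ.comp (Tuple.monotone_sort a))
  exact (congrFun h i).symm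

/-- Rearrangement inequality. -/
theorem sum_mul_le_sum_orderStat_mul (a b : Fin p → ℝ) :
    ∑ i, a i * b i ≤ ∑ i, orderStat a i * orderStat b i := by
  have hmv : Monovary (orderStat a) (orderStat b) :=
    (monotone_orderStat a).monovary (monotone_orderStat b)
  have h := hmv.sum_mul_comp_perm_le_sum_mul
    (σ := (Tuple.sort a).trans (Tuple.sort b).symm)
  refine le_of_eq_of_le ?_ h
  rw [← Equiv.sum_comp (Tuple.sort a)]
  refine Finset.sum_congr rfl fun i _ => ?_
  simp [orderStat]

theorem orderStat_abs_nonneg (x : Fin p → ℝ) (i : Fin p) : 0 ≤ orderStat (fun j => |x j|) i :=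
  abs_nonneg _

/-- The sorted `ℓ₁` norm. -/
noncomputable def sortedL1 (lam x : Fin p → ℝ) : ℝ := ∑ i, lam i * orderStat (fun j => |x j|) i

theorem sortedL1_nonneg {lam : Fin p → ℝ} (h : ∀ i, 0 ≤ lam i) (x : Fin p → ℝ) :
    0 ≤ sortedL1 lam x :=
  Finset.sum_nonneg fun i _ => mul_nonneg (h i) (orderStat_abs_nonneg x i)

/-- By rearrangement the sorted pairing is the largest one. The maximum over permutations makes
continuity evident, although the sorting permutation itself jumps. -/
theorem sortedL1_eq_sup {lam : Fin p → ℝ} (hlam : Monotone lam) (x : Fin p → ℝ) :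
    sortedL1 lam x = Finset.univ.sup' Finset.univ_nonempty
      fun σ : Equiv.Perm (Fin p) => ∑ i, lam i * |x (σ i)| := by
  refine le_antisymm ?_ (Finset.sup'_le _ _ fun σ _ => ?_)
  · exact Finset.le_sup' (fun σ : Equiv.Perm (Fin p) => ∑ i, lam i * |x (σ i)|)
      (Finset.mem_univ (Tuple.sort fun j => |x j|))
  · have hmv : Monovary lam (orderStat fun j => |x j|) :=
      hlam.monovary (monotone_orderStat _)
    have h := hmv.sum_mul_comp_perm_le_sum_mul
      (σ := σ.trans (Tuple.sort fun j => |x j|).symm)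
    refine le_of_eq_of_le (Finset.sum_congr rfl fun i _ => ?_) h
    simp [orderStat]

theorem continuous_sortedL1 {lam : Fin p → ℝ} (hlam : Monotone lam) :
    Continuous (sortedL1 lam) := by
  have e : sortedL1 lam = fun x => Finset.univ.sup' Finset.univ_nonempty
      fun σ : Equiv.Perm (Fin p) => ∑ i, lam i * |x (σ i)| := funext (sortedL1_eq_sup hlam)
  rw [e]
  exact Continuous.finset_sup'_apply _ fun σ _ => by fun_prop

theorem slopeObjective_eq (lam y x : Fin p → ℝ) :
    slopeObjective lam y x = (1 / 2) * ∑ i, (y i - x i) ^ 2 + sortedL1 lam x := rfl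

theorem exists_slopeObjective_le {lam : Fin p → ℝ} (hlam : Monotone lam) (h0 : ∀ i, 0 ≤ lam i)
    (y : Fin p → ℝ) : ∃ x, ∀ z, slopeObjective lam y x ≤ slopeObjective lam y z := by
  have hc : Continuous (slopeObjective lam y) := by
    have h1 : Continuous fun x : Fin p → ℝ => (1 / 2) * ∑ i, (y i - x i) ^ 2 := by fun_prop
    exact h1.add (continuous_sortedL1 hlam)
  refine hc.exists_forall_le' y ?_
  set C := sortedL1 lam y with hC
  have hC0 : 0 ≤ C := sortedL1_nonneg h0 y
  have hy : slopeObjective lam y y = C := by simp [slopeObjective_eq, hC]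
  -- Outside this box the quadratic term alone is at least `(2 * C + 1) ^ 2 / 2 ≥ C`, the value of
  -- the objective at `y`.
  have hcomp : IsCompact (Set.pi univ fun i => Icc (y i - (2 * C + 1)) (y i + (2 * C + 1))) :=
    isCompact_univ_pi fun _ => isCompact_Icc
  filter_upwards [hcomp.compl_mem_cocompact] with x hx
  rw [hy, slopeObjective_eq]
  have hJ := sortedL1_nonneg h0 x
  have hex : ∃ i, x i ∉ Icc (y i - (2 * C + 1)) (y i + (2 * C + 1)) := by
    by_contra! hall
    exact hx fun i _ => hall i
  obtain ⟨i, hi⟩ := hex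
  have h1 : (y i - x i) ^ 2 ≤ ∑ i, (y i - x i) ^ 2 :=
    Finset.single_le_sum (f := fun i => (y i - x i) ^ 2) (fun _ _ => sq_nonneg _)
      (Finset.mem_univ i)
  have h2 : 2 * C + 1 ≤ |y i - x i| := by
    by_contra hlt
    rw [not_le, abs_lt] at hlt
    exact hi ⟨by linarith, by linarith⟩
  have h3 : (2 * C + 1) ^ 2 ≤ (y i - x i) ^ 2 := by
    rw [← sq_abs (y i - x i)]
    exact pow_le_pow_left₀ (by linarith) h2 2
  nlinarith

theorem slopeObjective_slopeProx_le {lam : Fin p → ℝ} (hlam : Monotone lam) (h0 : ∀ i, 0 ≤ lam i)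
    (y z : Fin p → ℝ) : slopeObjective lam y (slopeProx lam y) ≤ slopeObjective lam y z :=
  Classical.epsilon_spec (exists_slopeObjective_le hlam h0 y) z

/-- Comparison with `0` gives `‖y - x‖² ≤ ‖y‖²`, and `‖x‖² ≤ 2‖y - x‖² + 2‖y‖²`. -/
theorem sum_sq_slopeProx_le {lam : Fin p → ℝ} (hlam : Monotone lam) (h0 : ∀ i, 0 ≤ lam i)
    (y : Fin p → ℝ) : ∑ i, slopeProx lam y i ^ 2 ≤ 4 * ∑ i, y i ^ 2 := by
  have h := slopeObjective_slopeProx_le hlam h0 y 0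
  have hz : sortedL1 lam 0 = 0 := by simp [sortedL1, orderStat]
  rw [slopeObjective_eq, slopeObjective_eq, hz] at h
  have hJ := sortedL1_nonneg h0 (slopeProx lam y)
  simp only [Pi.zero_apply, sub_zero] at h
  have h1 : ∑ i, slopeProx lam y i ^ 2 ≤
      ∑ i, (2 * (y i - slopeProx lam y i) ^ 2 + 2 * y i ^ 2) :=
    Finset.sum_le_sum fun i _ => by nlinarith [sq_nonneg (2 * y i - slopeProx lam y i)]
  rw [Finset.sum_add_distrib, ← Finset.mul_sum, ← Finset.mul_sum] at h1
  linarith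

/-- The basic inequality for a minimizer, compared with a point `z`. -/
theorem sum_sq_slopeProx_sub_le {lam : Fin p → ℝ} (hlam : Monotone lam) (h0 : ∀ i, 0 ≤ lam i)
    (y z : Fin p → ℝ) :
    (1 / 2) * ∑ i, (slopeProx lam y i - z i) ^ 2 ≤
      (sortedL1 lam z - ∑ i, (y i - z i) * z i) +
        (∑ i, (y i - z i) * slopeProx lam y i - sortedL1 lam (slopeProx lam y)) := by
  have h := slopeObjective_slopeProx_le hlam h0 y z
  rw [slopeObjective_eq, slopeObjective_eq] at h
  have e : ∑ i, (y i - slopeProx lam y i) ^ 2 = ∑ i, (y i - z i) ^ 2 +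
      2 * ∑ i, (y i - z i) * z i - 2 * ∑ i, (y i - z i) * slopeProx lam y i +
        ∑ i, (slopeProx lam y i - z i) ^ 2 := by
    rw [Finset.mul_sum, Finset.mul_sum, ← Finset.sum_add_distrib, ← Finset.sum_sub_distrib,
      ← Finset.sum_add_distrib]
    exact Finset.sum_congr rfl fun i _ => by ring
  linarith

end OrderStat

/-! ### Shrinkage functions and absolute values -/

namespace IsShrinkage

variable {η : ℝ → ℝ}

theorem abs_apply (h : IsShrinkage η) (x : ℝ) : |η x| = η |x| := by
  rcases le_total 0 x with hx | hx
  · rw [abs_of_nonneg hx, abs_of_nonneg (h.nonneg hx)]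
  · have h1 := h.nonneg (neg_nonneg.2 hx)
    rw [abs_of_nonpos hx, h.odd] at *
    rw [abs_of_nonpos (by linarith)]

theorem abs_sub_apply (h : IsShrinkage η) (x : ℝ) : |x - η x| = |x| - η |x| := by
  rcases le_total 0 x with hx | hx
  · rw [abs_of_nonneg hx, abs_of_nonneg (sub_nonneg.2 (h.le_self hx))]
  · have h1 := h.le_self (neg_nonneg.2 hx)
    rw [h.odd] at h1
    rw [abs_of_nonpos hx, h.odd, abs_of_nonpos (by linarith)]
    ring

theorem sub_mul_apply (h : IsShrinkage η) (x : ℝ) : (x - η x) * η x = (|x| - η |x|) * η |x| := by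
  rcases le_total 0 x with hx | hx
  · rw [abs_of_nonneg hx]
  · rw [abs_of_nonpos hx, h.odd]; ring

end IsShrinkage

/-! ### The comparison in finite dimension -/

section FiniteEstimate

variable {ν μl : Measure ℝ} [IsProbabilityMeasure ν] [IsProbabilityMeasure μl] {η : ℝ → ℝ}

/-- Comparison of the proximal point with the coordinatewise shrinkage, in terms of the distance
of the step functions of `|y|` and `lam` from the limiting quantile functions. -/
theorem IsOptimalShrinkage.sum_sq_sub_le (hy : Integrable (fun t : ℝ => t ^ 2) ν)
    (hl : Integrable (fun t : ℝ => t ^ 2) μl) (hη : IsOptimalShrinkage ν μl η) {p : ℕ} (hp : 0 < p)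
    {lam : Fin p → ℝ} (hlam : Monotone lam) (h0 : ∀ i, 0 ≤ lam i) (y : Fin p → ℝ) :
    (∑ i, (slopeProx lam y i - η (y i)) ^ 2) / p ≤
      2 * (∫ u, (stepFun lam u - (stepFun (orderStat fun j => |y j|) u -
          η (stepFun (orderStat fun j => |y j|) u))) *
            η (stepFun (orderStat fun j => |y j|) u) ∂unitMeasure) +
        2 * (√(∫ u, ((stepFun (orderStat fun j => |y j|) u -
            η (stepFun (orderStat fun j => |y j|) u) - stepFun lam u) -
              (quantile ν u - η (quantile ν u) - quantile μl u)) ^ 2 ∂unitMeasure) *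
          √(4 * ((∑ i, y i ^ 2) / p))) := by
  have hp' : (0 : ℝ) < p := Nat.cast_pos.2 hp
  have hs := hη.toIsShrinkage
  set x := slopeProx lam y with hx
  set Y := orderStat fun j => |y j| with hY
  set X := orderStat fun j => |x j| with hX
  have hbase := sum_sq_slopeProx_sub_le hlam h0 y fun i => η (y i)
  -- the value at the shrinkage point
  have hJz : sortedL1 lam (fun i => η (y i)) = ∑ i, lam i * η (Y i) := by
    simp only [sortedL1, hs.abs_apply]
    exact Finset.sum_congr rfl fun i _ => by rw [orderStat_comp hs.mono]
  have huz : ∑ i, (y i - η (y i)) * η (y i) = ∑ i, (Y i - η (Y i)) * η (Y i) := by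
    simp only [hs.sub_mul_apply (y _)]
    exact (sum_comp_orderStat (fun j => |y j|) fun t => (t - η t) * η t).symm
  have hR : ∫ u, (stepFun lam u - (stepFun Y u - η (stepFun Y u))) * η (stepFun Y u) ∂unitMeasure =
      (sortedL1 lam (fun i => η (y i)) - ∑ i, (y i - η (y i)) * η (y i)) / p := by
    rw [integral_eq_sum_of_stepFun hp (b := fun i => (lam i - (Y i - η (Y i))) * η (Y i))
      fun u hu => by rw [stepFun_apply hp lam hu, stepFun_apply hp Y hu], hJz, huz,
      ← Finset.sum_sub_distrib]
    congr 1
    exact Finset.sum_congr rfl fun i _ => by ring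
  -- duality
  have hdual : ∑ i, (y i - η (y i)) * x i ≤ ∑ i, (Y i - η (Y i)) * X i := by
    have h1 : ∑ i, (y i - η (y i)) * x i ≤ ∑ i, (|y i| - η |y i|) * |x i| := by
      refine Finset.sum_le_sum fun i _ => ?_
      rw [← hs.abs_sub_apply, ← abs_mul]
      exact le_abs_self _
    refine h1.trans ((sum_mul_le_sum_orderStat_mul (fun i => |y i| - η |y i|) fun i => |x i|).trans
      (le_of_eq ?_))
    refine Finset.sum_congr rfl fun i _ => ?_
    rw [orderStat_comp (φ := fun t => t - η t) hs.monotone_sub]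
  have hF : MemLp (fun u => stepFun Y u - η (stepFun Y u) - stepFun lam u) 2 unitMeasure :=
    ((memLp_stepFun Y).sub (hs.memLp_comp (memLp_stepFun Y))).sub (memLp_stepFun lam)
  have hF' : MemLp (fun u => quantile ν u - η (quantile ν u) - quantile μl u) 2 unitMeasure :=
    ((memLp_quantile hy).sub (hs.memLp_comp (memLp_quantile hy))).sub (memLp_quantile hl)
  have hXL := memLp_stepFun X
  have hD : ∫ u, (stepFun Y u - η (stepFun Y u) - stepFun lam u) * stepFun X u ∂unitMeasure =
      (∑ i, (Y i - η (Y i)) * X i - sortedL1 lam x) / p := by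
    rw [integral_eq_sum_of_stepFun hp (b := fun i => (Y i - η (Y i) - lam i) * X i)
      fun u hu => by rw [stepFun_apply hp lam hu, stepFun_apply hp Y hu, stepFun_apply hp X hu],
      sortedL1, ← Finset.sum_sub_distrib]
    congr 1
    exact Finset.sum_congr rfl fun i _ => by ring
  -- The limiting residual has nonpositive pairing with the sorted `|x|`, whatever `x` is. So only
  -- the `L²` distance between the finite and the limiting residual remains, multiplied by the norm
  -- of `x`.
  have htail := integral_mul_stepFun_nonpos hp hF' hη.tail (monotone_orderStat fun j => |x j|)
    (orderStat_abs_nonneg x)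
  have hcs := (le_abs_self _).trans (abs_integral_mul_le (hF.sub hF') hXL)
  simp only [Pi.sub_apply, sub_mul _ (quantile ν _ - η (quantile ν _) - quantile μl _)] at hcs
  have j1 : Integrable (fun u => (stepFun Y u - η (stepFun Y u) - stepFun lam u) * stepFun X u)
    unitMeasure := hF.integrable_mul hXL
  have j2 : Integrable (fun u => (quantile ν u - η (quantile ν u) - quantile μl u) * stepFun X u)
    unitMeasure := hF'.integrable_mul hXL
  rw [integral_sub j1 j2, hD] at hcs
  have hX2 : ∫ u, stepFun X u ^ 2 ∂unitMeasure ≤ 4 * ((∑ i, y i ^ 2) / p) := by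
    rw [integral_eq_sum_of_stepFun hp (b := fun i => X i ^ 2)
      fun u hu => by rw [stepFun_apply hp X hu], ← mul_div_assoc]
    refine div_le_div_of_nonneg_right ?_ hp'.le
    have h1 := sum_comp_orderStat (fun j => |x j|) fun t => t ^ 2
    simp only [sq_abs] at h1
    rw [hX, h1]
    exact sum_sq_slopeProx_le hlam h0 y
  have hmul := mul_le_mul_of_nonneg_left (Real.sqrt_le_sqrt hX2)
    (Real.sqrt_nonneg (∫ u, ((stepFun Y u - η (stepFun Y u) - stepFun lam u) -
              (quantile ν u - η (quantile ν u) - quantile μl u)) ^ 2 ∂unitMeasure))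
  rw [hR]
  have hb : (∑ i, (x i - η (y i)) ^ 2) / p ≤
      2 * ((sortedL1 lam (fun i => η (y i)) - ∑ i, (y i - η (y i)) * η (y i)) / p) +
        2 * ((∑ i, (Y i - η (Y i)) * X i - sortedL1 lam x) / p) := by
    rw [← mul_div_assoc, ← mul_div_assoc, ← add_div]
    refine div_le_div_of_nonneg_right ?_ hp'.le
    linarith
  linarith

end FiniteEstimate

/-! ### Converging sequences -/

section Converging

variable {μ : Measure ℝ} [IsProbabilityMeasure μ]

theorem IsConvergingSequence.tendsto_stepFun {a : (p : ℕ) → Fin p → ℝ}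
    (h : IsConvergingSequence a μ) (hm : ∀ p, Monotone (a p)) :
    Tendsto (fun p => ∫ u, (stepFun (a p) u - quantile μ u) ^ 2 ∂unitMeasure) atTop (𝓝 0) := by
  refine tendsto_integral_sq_sub_quantile h.integrable_sq (fun p => monotoneOn_stepFun (hm p))
    (fun p => memLp_stepFun (a p)) (fun φ => (h.weak φ).congr' ?_) (h.secondMoment.congr' ?_)
  · filter_upwards [eventually_gt_atTop 0] with p hp
    exact (integral_eq_sum_of_stepFun hp (b := fun i => φ (a p i)) fun u hu => by
      rw [stepFun_apply hp (a p) hu]).symm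
  · filter_upwards [eventually_gt_atTop 0] with p hp
    exact (integral_eq_sum_of_stepFun hp (b := fun i => a p i ^ 2) fun u hu => by
      rw [stepFun_apply hp (a p) hu]).symm

instance : IsProbabilityMeasure (absLaw μ) :=
  Measure.isProbabilityMeasure_map measurable_id.abs.aemeasurable

theorem absLaw_Iio_zero : absLaw μ (Iio 0) = 0 := by
  have hm : Measurable fun y : ℝ => |y| := measurable_id.abs
  rw [absLaw, Measure.map_apply hm measurableSet_Iio]
  convert measure_empty (μ := μ)
  exact eq_empty_of_forall_notMem fun y hy => absurd hy (not_lt.2 (abs_nonneg y))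

theorem integrable_sq_absLaw (h : Integrable (fun t : ℝ => t ^ 2) μ) :
    Integrable (fun t : ℝ => t ^ 2) (absLaw μ) := by
  have hm : Measurable fun y : ℝ => |y| := measurable_id.abs
  refine (integrable_map_measure (measurable_id.pow_const 2).aestronglyMeasurable
    hm.aemeasurable).2 ?_
  simpa [Function.comp_def] using h

theorem IsConvergingSequence.orderStat_abs {y : (p : ℕ) → Fin p → ℝ}
    (h : IsConvergingSequence y μ) :
    IsConvergingSequence (fun p => orderStat fun j => |y p j|) (absLaw μ) where
  weak φ := by
    have hm : Measurable fun y : ℝ => |y| := measurable_id.abs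
    have h1 := h.weak (φ.compContinuous ⟨fun t => |t|, continuous_abs⟩)
    rw [absLaw, integral_map hm.aemeasurable φ.continuous.aestronglyMeasurable]
    refine h1.congr fun p => ?_
    rw [sum_comp_orderStat (fun j => |y p j|) φ]
    rfl
  integrable_sq := integrable_sq_absLaw h.integrable_sq
  secondMoment := by
    have hm : Measurable fun y : ℝ => |y| := measurable_id.abs
    rw [absLaw, integral_map (f := fun t : ℝ => t ^ 2) hm.aemeasurable
      (measurable_id.pow_const 2).aestronglyMeasurable]
    simp only [sq_abs]
    refine h.secondMoment.congr fun p => ?_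
    rw [sum_comp_orderStat (fun j => |y p j|) fun t => t ^ 2]
    simp only [sq_abs]

end Converging

/-- Optimal shrinkage functions describe the proximal operator asymptotically. -/
theorem IsOptimalShrinkage.tendsto {μy μl : Measure ℝ} [IsProbabilityMeasure μy]
    [IsProbabilityMeasure μl] {η : ℝ → ℝ} (hη : IsOptimalShrinkage (absLaw μy) μl η)
    {y lam : (p : ℕ) → Fin p → ℝ} (hy : IsConvergingSequence y μy)
    (hl : IsConvergingSequence lam μl) (hmono : ∀ p, Monotone (lam p)) (h0 : ∀ p i, 0 ≤ lam p i) :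
    Tendsto (fun p : ℕ => (∑ i, (slopeProx (lam p) (y p) i - η (y p i)) ^ 2) / (p : ℝ))
      atTop (𝓝 0) := by
  have hs := hη.toIsShrinkage
  have hY := hy.orderStat_abs
  set Y : (p : ℕ) → Fin p → ℝ := fun p => orderStat fun j => |y p j| with hYdef
  have t1 := hY.tendsto_stepFun fun p => monotone_orderStat _
  have t2 := hl.tendsto_stepFun hmono
  have q1 := memLp_quantile hY.integrable_sq
  have q2 := memLp_quantile hl.integrable_sq
  have s1 : ∀ p, MemLp (stepFun (Y p)) 2 unitMeasure := fun p => memLp_stepFun _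
  have s2 : ∀ p, MemLp (stepFun (lam p)) 2 unitMeasure := fun p => memLp_stepFun _
  have t3 := tendsto_integral_sq_shrinkage (fun _ => hs) hs (fun _ => tendsto_const_nhds) s1 q1 t1
  have e1 : ∀ p, MemLp (fun u => η (stepFun (Y p) u)) 2 unitMeasure := fun p => hs.memLp_comp (s1 p)
  have e2 : MemLp (fun u => η (quantile (absLaw μy) u)) 2 unitMeasure := hs.memLp_comp q1
  have t4 : Tendsto (fun p => ∫ u, ((stepFun (Y p) u - η (stepFun (Y p) u) - stepFun (lam p) u) -
      (quantile (absLaw μy) u - η (quantile (absLaw μy) u) - quantile μl u)) ^ 2 ∂unitMeasure)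
      atTop (𝓝 0) := by
    have f1 : ∀ p, MemLp (fun u => stepFun (Y p) u - quantile (absLaw μy) u) 2 unitMeasure :=
      fun p => (s1 p).sub q1
    have f2 : ∀ p, MemLp (fun u => η (quantile (absLaw μy) u) - η (stepFun (Y p) u)) 2
      unitMeasure := fun p => e2.sub (e1 p)
    have f3 : ∀ p, MemLp (fun u => quantile μl u - stepFun (lam p) u) 2 unitMeasure :=
      fun p => q2.sub (s2 p)
    have t5 : Tendsto (fun p => ∫ u, (η (quantile (absLaw μy) u) - η (stepFun (Y p) u)) ^ 2
        ∂unitMeasure) atTop (𝓝 0) :=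
      t3.congr fun p => integral_congr_ae (Eventually.of_forall fun u => by ring)
    have t6 : Tendsto (fun p => ∫ u, (quantile μl u - stepFun (lam p) u) ^ 2 ∂unitMeasure)
        atTop (𝓝 0) :=
      t2.congr fun p => integral_congr_ae (Eventually.of_forall fun u => by ring)
    refine (tendsto_integral_sq_add (fun p => (f1 p).add (f2 p)) f3
      (tendsto_integral_sq_add f1 f2 t1 t5) t6).congr fun p => ?_
    exact integral_congr_ae (Eventually.of_forall fun u => by simp only [Pi.add_apply]; ring)
  have t7 : Tendsto (fun p => ∫ u, (stepFun (Y p) u - η (stepFun (Y p) u) - stepFun (lam p) u) *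
      η (stepFun (Y p) u) ∂unitMeasure) atTop (𝓝 0) := by
    -- The limit of these pairings is the integral in `slack`, which is zero.
    have := tendsto_integral_mul (fun p => ((s1 p).sub (e1 p)).sub (s2 p)) e1
      ((q1.sub e2).sub q2) e2 t4 t3
    simp only [Pi.sub_apply] at this
    rwa [hη.slack] at this
  have t8 : Tendsto (fun p => ∫ u, (stepFun (lam p) u - (stepFun (Y p) u - η (stepFun (Y p) u))) *
      η (stepFun (Y p) u) ∂unitMeasure) atTop (𝓝 0) := by
    have := t7.neg
    rw [neg_zero] at this
    refine this.congr fun p => ?_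
    rw [← integral_neg]
    exact integral_congr_ae (Eventually.of_forall fun u => by ring)
  have t9 := ((hy.secondMoment.const_mul 4).sqrt)
  have t10 := ((t8.const_mul 2).add ((t4.sqrt.mul t9).const_mul 2))
  simp only [Real.sqrt_zero, zero_mul, mul_zero, add_zero] at t10
  refine squeeze_zero' (Eventually.of_forall fun p =>
    div_nonneg (Finset.sum_nonneg fun _ _ => sq_nonneg _) (Nat.cast_nonneg p)) ?_ t10
  filter_upwards [eventually_gt_atTop 0] with p hp
  exact hη.sum_sq_sub_le hY.integrable_sq hl.integrable_sq hp (hmono p) (h0 p) (y p)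

/-! ### The proposition -/

theorem proposition1 (μy μl : Measure ℝ) [IsProbabilityMeasure μy] [IsProbabilityMeasure μl]
    (hy : Integrable (fun t : ℝ => t ^ 2) μy) (hl : Integrable (fun t : ℝ => t ^ 2) μl)
    (hl_nonneg : μl (Iio 0) = 0) :
    ∃ η : ℝ → ℝ,
      (∀ t, η (-t) = -η t) ∧ Monotone η ∧ LipschitzWith 1 η ∧
      (∀ η' : ℝ → ℝ, IsPoolOutput μy μl η' → η' = η) ∧
      (HasFinitelyManyMDIs (absLaw μy) (initialG (absLaw μy) μl) → IsPoolOutput μy μl η) ∧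
      ∀ y lam : (p : ℕ) → Fin p → ℝ,
        IsConvergingSequence y μy → IsConvergingSequence lam μl →
        (∀ p, Monotone (lam p)) → (∀ p i, 0 ≤ lam p i) →
        Tendsto (fun p : ℕ => (∑ i, (slopeProx (lam p) (y p) i - η (y p i)) ^ 2) / (p : ℝ))
          atTop (𝓝 0) := by
  have hν : absLaw μy (Iio 0) = 0 := absLaw_Iio_zero
  have hy' := integrable_sq_absLaw hy
  -- When there is an output, `η` has to be that function; otherwise any optimal function will do,
  -- as the statements about outputs are then vacuous.
  by_cases hex : ∃ G, Relation.ReflTransGen (PoolStep (absLaw μy)) (initialG (absLaw μy) μl) G ∧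
      MonotoneOn G (massRange (absLaw μy))
  · obtain ⟨G, hr, hm⟩ := hex
    have hη := isOptimalShrinkage_scalarOfG hν hy' hl hl_nonneg hr hm
    refine ⟨scalarOfG (absLaw μy) G, hη.odd, hη.mono, hη.lipschitz, ?_, fun _ => ⟨G, hr, hm, rfl⟩,
      fun y lam h1 h2 h3 h4 => hη.tendsto h1 h2 h3 h4⟩
    rintro _ ⟨G', hr', hm', rfl⟩
    rw [poolOutput_unique hν hr' hm' hr hm]
  · obtain ⟨η, hη⟩ := exists_isOptimalShrinkage hν hy' hl hl_nonneg
    refine ⟨η, hη.odd, hη.mono, hη.lipschitz, ?_, fun hfin => ?_,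
      fun y lam h1 h2 h3 h4 => hη.tendsto h1 h2 h3 h4⟩
    · rintro _ ⟨G', hr', hm', rfl⟩
      exact absurd ⟨G', hr', hm'⟩ hex
    · exact absurd (exists_poolOutput hν (isPoolStart_initialG hν hy' hl hl_nonneg) hfin) hex
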